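/- Let $\mathbb K$ be an algebraically closed field of characteristic zero, and let $\mathbf{Art}_{\mathbb K}$ be the category of local Artinian $\mathbb K$-algebras $(A,\mathfrak m_A)$ with residue field $\mathbb K$. For a ($\mathbb Z$-graded) differential graded Lie algebra (DGLA) $L$ over $\mathbb K$ let $\operatorname{Def}_L:\mathbf{Art}_{\mathbb K}\to\mathbf{Set}$ be its deformation functor: $\operatorname{Def}_L(A)$ is the set of all $x\in L^1\otimes\mathfrak m_A$ with $dx+\frac12[x,x]=0$, modulo the gauge action $e^a*x=x+\sum_{n\ge 0}\frac{(\operatorname{ad}a)^n}{(n+1)!}([a,x]-da)$ of $a\in L^0\otimes\mathfrak m_A$. Let $\mathfrak g^\Delta$ be a semicosimplicial DGLA, that is, a sequence of DGLAs $\mathfrak g_n$, $n\ge 0$, with DGLA morphisms $\partial_{k,n}:\mathfrak g_{n-1}\to\mathfrak g_n$, $0\le k\le n$, $n\ge 1$, such that $\partial_{k+1,n+1}\partial_{l,n}=\partial_{l,n+1}\partial_{k,n}$ for $k\ge l$. Let $\Omega_n=\mathbb K[t_0,\dots,t_n,dt_0,\dots,dt_n]/(\sum t_i-1,\sum dt_i)$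 be the differential graded commutative algebra of polynomial differential forms on the standard $n$-simplex, with face maps $\delta^{k,n}:\Omega_n\to\Omega_{n-1}$, $0\le k\le n$. The Thom–Whitney DGLA $\operatorname{Tot}_{TW}(\mathfrak g^\Delta)$ is the DGLA whose component of degree $m$ is $$\Big\{(x_n)_{n\ge 0}\in\prod_{n\ge 0}(\Omega_n\otimes\mathfrak g_n)^m \;\Big|\; \delta^{k,n}x_n=\partial_{k,n}x_{n-1}\ \text{ for all } n\ge 1,\ 0\le k\le n\Big\},$$ where $(\Omega_n\otimes\mathfrak g_n)^m=\bigoplus_{i+j=m}\Omega_n^i\otimes\mathfrak g_n^j$, with differential and bracket induced componentwise by those of the DGLAs $\Omega_n\otimes\mathfrak g_n$. Let $\mathfrak g^{\Delta_{[0,2]}}$ be the truncated semicosimplicial DGLA which agrees with $\mathfrak g^\Delta$ at the levels $0,1,2$ and is zero at all levels $n\ge 3$, and let $\operatorname{Id}_{[0,2]}:\mathfrak g^\Delta\to\mathfrak g^{\Delta_{[0,2]}}$ be the morphism which is the identity at the levels $0,1,2$ and zero at all levels $n\ge 3$. Assume that $H^j(\mathfrak g_i)=0$ for all $i\ge 0$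 and all $j<0$. Then the DGLA morphism $\operatorname{Tot}_{TW}(\mathfrak g^\Delta)\to\operatorname{Tot}_{TW}(\mathfrak g^{\Delta_{[0,2]}})$ induced by $\operatorname{Id}_{[0,2]}$ induces a natural isomorphism of functors $$\operatorname{Def}_{\operatorname{Tot}_{TW}(\mathfrak g^\Delta)}\xrightarrow{\ \sim\ }\operatorname{Def}_{\operatorname{Tot}_{TW}(\mathfrak g^{\Delta_{[0,2]}})}.$$ -/

import Mathlib

open CategoryTheory TensorProduct

universe u v v' w

noncomputable section

section Graded

variable {K : Type u} [Field K] {ι : Type} [DecidableEq ι] {M : Type v} [AddCommGroup M] [Module K M]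

/-- The endomorphism of an internally graded vector space which is multiplication by `c i` on the
component of degree `i`. -/
def gradedScale {deg : ι → Submodule K M} (h : DirectSum.IsInternal deg) (c : ι → K) :
    M →ₗ[K] M :=
  DirectSum.toModule K ι M (fun i => c i • (deg i).subtype) ∘ₗ
    (LinearEquiv.ofBijective (DirectSum.coeLinearMap deg) h).symm.toLinearMap

theorem gradedScale_apply {deg : ι → Submodule K M} (h : DirectSum.IsInternal deg) (c : ι → K)
    {i : ι} {x : M} (hx : x ∈ deg i) : gradedScale h c x = c i • x := by
  have : (LinearEquiv.ofBijective (DirectSum.coeLinearMap deg) h).symm x =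
      DirectSum.lof K ι (fun i => deg i) i ⟨x, hx⟩ := by
    rw [LinearEquiv.symm_apply_eq]
    exact (DirectSum.coeLinearMap_lof (A := deg) i ⟨x, hx⟩).symm
  simp [gradedScale, this]

/-- A family of subspaces on which a fixed operator acts by pairwise distinct scalars, and which
spans, is an internal grading. -/
theorem isInternal_of_scale {deg : ι → Submodule K M} (D : M →ₗ[K] M) (c : ι → K)
    (hc : Function.Injective c) (hD : ∀ i, ∀ x ∈ deg i, D x = c i • x) (htop : iSup deg = ⊤) :
    DirectSum.IsInternal deg := by
  refine DirectSum.isInternal_submodule_of_iSupIndep_of_iSup_eq_top ?_ htop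
  have h := (Module.End.eigenspaces_iSupIndep D).comp hc
  refine h.mono fun i x hx => ?_
  exact Module.End.mem_eigenspace_iff.2 (hD i x hx)

end Graded

/-- A (cohomologically, nonnegatively graded) commutative differential graded algebra. -/
structure CDGA (K : Type u) [Field K] where
  carrier : Type v
  [ring : Ring carrier]
  [algebra : Algebra K carrier]
  deg : ℕ → Submodule K carrier
  internal : DirectSum.IsInternal deg
  one_mem : (1 : carrier) ∈ deg 0
  mul_mem : ∀ {i j : ℕ} {x y : carrier}, x ∈ deg i → y ∈ deg j → x * y ∈ deg (i + j)
  mul_comm' : ∀ {i j : ℕ} {x y : carrier}, x ∈ deg i → y ∈ deg j →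
    x * y = (-1 : K) ^ (i * j) • (y * x)
  d : carrier →ₗ[K] carrier
  d_mem : ∀ {i : ℕ} {x : carrier}, x ∈ deg i → d x ∈ deg (i + 1)
  d_d : ∀ x, d (d x) = 0
  d_mul : ∀ {i : ℕ} {x : carrier} (y : carrier), x ∈ deg i →
    d (x * y) = d x * y + (-1 : K) ^ i • (x * d y)

attribute [instance] CDGA.ring CDGA.algebra

/-- Morphisms of commutative differential graded algebras. -/
structure CDGA.Hom {K : Type u} [Field K] (C : CDGA.{u, v} K) (D : CDGA.{u, v'} K) where
  toAlgHom : C.carrier →ₐ[K] D.carrier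
  map_deg : ∀ {i : ℕ} {x : C.carrier}, x ∈ C.deg i → toAlgHom x ∈ D.deg i
  map_d : ∀ x, toAlgHom (C.d x) = D.d (toAlgHom x)

/-- A differential graded Lie algebra over `K` (in characteristic zero): a `ℤ`-graded vector space
`L = ⨁ L^i` with a differential of degree `1` and a graded skew-symmetric bracket satisfying the
graded Jacobi identity and the graded Leibniz rule. -/
structure DGLA (K : Type u) [Field K] where
  carrier : Type v
  [addCommGroup : AddCommGroup carrier]
  [module : Module K carrier]
  deg : ℤ → Submodule K carrier
  internal : DirectSum.IsInternal deg
  d : carrier →ₗ[K] carrier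
  d_mem : ∀ {i : ℤ} {x : carrier}, x ∈ deg i → d x ∈ deg (i + 1)
  d_d : ∀ x, d (d x) = 0
  bracket : carrier →ₗ[K] carrier →ₗ[K] carrier
  bracket_mem : ∀ {i j : ℤ} {x y : carrier}, x ∈ deg i → y ∈ deg j → bracket x y ∈ deg (i + j)
  bracket_skew : ∀ {i j : ℤ} {x y : carrier}, x ∈ deg i → y ∈ deg j →
    bracket x y = -((-1 : K) ^ (i * j) • bracket y x)
  jacobi : ∀ {i j k : ℤ} {x y z : carrier}, x ∈ deg i → y ∈ deg j → z ∈ deg k →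
    bracket x (bracket y z) =
      bracket (bracket x y) z + (-1 : K) ^ (i * j) • bracket y (bracket x z)
  leibniz : ∀ {i j : ℤ} {x y : carrier}, x ∈ deg i → y ∈ deg j →
    d (bracket x y) = bracket (d x) y + (-1 : K) ^ i • bracket x (d y)

attribute [instance] DGLA.addCommGroup DGLA.module

namespace DGLA

variable {K : Type u} [Field K]

/-- Morphisms of differential graded Lie algebras. -/
structure Hom (L : DGLA.{u, v} K) (M : DGLA.{u, v'} K) where
  toLinearMap : L.carrier →ₗ[K] M.carrier
  map_deg : ∀ {i : ℤ} {x : L.carrier}, x ∈ L.deg i → toLinearMap x ∈ M.deg i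
  map_d : ∀ x, toLinearMap (L.d x) = M.d (toLinearMap x)
  map_bracket : ∀ x y, toLinearMap (L.bracket x y) = M.bracket (toLinearMap x) (toLinearMap y)

/-- The identity morphism. -/
def Hom.id (L : DGLA.{u, v} K) : Hom L L where
  toLinearMap := LinearMap.id
  map_deg h := h
  map_d _ := rfl
  map_bracket _ _ := rfl

/-- The zero morphism. -/
def Hom.zero (L : DGLA.{u, v} K) (M : DGLA.{u, v'} K) : Hom L M where
  toLinearMap := 0
  map_deg _ := (M.deg _).zero_mem
  map_d _ := by simp
  map_bracket _ _ := by simp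

/-- The zero differential graded Lie algebra. -/
def zero (K : Type u) [Field K] : DGLA.{u, v} K where
  carrier := PUnit
  deg _ := ⊥
  internal := DirectSum.isInternal_submodule_of_iSupIndep_of_iSup_eq_top
    (fun _ => disjoint_bot_left) (Subsingleton.elim _ _)
  d := 0
  d_mem _ := rfl
  d_d _ := rfl
  bracket := 0
  bracket_mem _ _ := rfl
  bracket_skew _ _ := rfl
  jacobi _ _ _ := rfl
  leibniz _ _ := rfl

/-- Cocycles of degree `j`. -/
def cocycles (L : DGLA.{u, v} K) (j : ℤ) : Submodule K L.carrier :=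
  L.deg j ⊓ LinearMap.ker L.d

/-- Coboundaries of degree `j`. -/
def coboundaries (L : DGLA.{u, v} K) (j : ℤ) : Submodule K L.carrier :=
  (L.deg (j - 1)).map L.d

/-- The cohomology `H^j(L)` of the complex underlying a DGLA. -/
abbrev cohomology (L : DGLA.{u, v} K) (j : ℤ) : Type v :=
  L.cocycles j ⧸ (L.coboundaries j).submoduleOf (L.cocycles j)

end DGLA

namespace SimplexForms

variable (K : Type u) [Field K] (n : ℕ)

/-- The polynomial functions `K[t_0, …, t_n] / (∑ t_i - 1)` on the standard `n`-simplex. -/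
def Fun : Type u :=
  MvPolynomial (Fin (n + 1)) K ⧸
    Ideal.span {(∑ i, MvPolynomial.X i - 1 : MvPolynomial (Fin (n + 1)) K)}

instance : CommRing (Fun K n) :=
  inferInstanceAs (CommRing (MvPolynomial (Fin (n + 1)) K ⧸
    Ideal.span {(∑ i, MvPolynomial.X i - 1 : MvPolynomial (Fin (n + 1)) K)}))

instance : Algebra K (Fun K n) :=
  inferInstanceAs (Algebra K (MvPolynomial (Fin (n + 1)) K ⧸
    Ideal.span {(∑ i, MvPolynomial.X i - 1 : MvPolynomial (Fin (n + 1)) K)}))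

/-- The space `⟨dt_0, …, dt_n⟩ / (∑ dt_i)`. -/
def Cot : Type u := (Fin (n + 1) → K) ⧸ Submodule.span K {(1 : Fin (n + 1) → K)}

instance : AddCommGroup (Cot K n) :=
  inferInstanceAs (AddCommGroup ((Fin (n + 1) → K) ⧸ Submodule.span K {(1 : Fin (n + 1) → K)}))

instance : Module K (Cot K n) :=
  inferInstanceAs (Module K ((Fin (n + 1) → K) ⧸ Submodule.span K {(1 : Fin (n + 1) → K)}))

/-- The graded commutative algebra
`Ω_n = K[t_0, …, t_n, dt_0, …, dt_n] / (∑ t_i - 1, ∑ dt_i)` of polynomial differential forms on the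
standard `n`-simplex: polynomial functions tensored with the exterior algebra on the `dt_i`. -/
abbrev Form : Type u := Fun K n ⊗[K] ExteriorAlgebra K (Cot K n)

/-- The quotient map `K[t_0, …, t_n] → K[t_0, …, t_n] / (∑ t_i - 1)`. -/
def funMk : MvPolynomial (Fin (n + 1)) K →ₐ[K] Fun K n := Ideal.Quotient.mkₐ K _

/-- The quotient map `⟨dt_0, …, dt_n⟩ → ⟨dt_0, …, dt_n⟩ / (∑ dt_i)`. -/
def cotMk : (Fin (n + 1) → K) →ₗ[K] Cot K n :=
  (Submodule.span K {(1 : Fin (n + 1) → K)}).mkQ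

/-- The element `dt_i` of the exterior algebra. -/
def dt (i : Fin (n + 1)) : ExteriorAlgebra K (Cot K n) :=
  ExteriorAlgebra.ι K (cotMk K n (Pi.single i 1))

theorem sum_dt : ∑ i, dt K n i = 0 := by
  have h : ∑ i : Fin (n + 1), (Pi.single i (1 : K) : Fin (n + 1) → K) = 1 :=
    Finset.univ_sum_single (1 : Fin (n + 1) → K)
  have h' : cotMk K n 1 = 0 :=
    (Submodule.Quotient.mk_eq_zero _).2 (Submodule.mem_span_singleton_self _)
  simp only [dt, ← map_sum, h, h', map_zero]

theorem funMk_surjective : Function.Surjective (funMk K n) := Ideal.Quotient.mkₐ_surjective K _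

/-- `f ↦ ∑ (∂f/∂t_i) dt_i` on polynomials in `t_0, …, t_n`. -/
def polyD : MvPolynomial (Fin (n + 1)) K →ₗ[K] Form K n :=
  ∑ i, (TensorProduct.mk K (Fun K n) (ExteriorAlgebra K (Cot K n))).flip (dt K n i) ∘ₗ
    (funMk K n).toLinearMap ∘ₗ (MvPolynomial.pderiv i).toLinearMap

theorem polyD_apply (f : MvPolynomial (Fin (n + 1)) K) :
    polyD K n f = ∑ i, funMk K n (MvPolynomial.pderiv i f) ⊗ₜ[K] dt K n i := by
  simp [polyD]

theorem polyD_ker : (Ideal.span {(∑ i, MvPolynomial.X i - 1 :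
    MvPolynomial (Fin (n + 1)) K)}).restrictScalars K ≤ LinearMap.ker (polyD K n) := by
  intro f hf
  obtain ⟨g, rfl⟩ := Ideal.mem_span_singleton'.1 hf
  have h0 : funMk K n (∑ i, MvPolynomial.X i - 1) = 0 :=
    Ideal.Quotient.eq_zero_iff_mem.2 (Ideal.mem_span_singleton_self _)
  have h1 : ∀ i, MvPolynomial.pderiv i (∑ j, MvPolynomial.X j - 1 :
      MvPolynomial (Fin (n + 1)) K) = 1 := by
    intro i
    simp [map_sum, MvPolynomial.pderiv_X, Pi.single_apply]
  rw [LinearMap.mem_ker, polyD_apply]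
  simp only [Derivation.leibniz, h1, smul_eq_mul, map_add, map_mul, h0, mul_one, zero_mul, add_zero]
  rw [← TensorProduct.tmul_sum, sum_dt, TensorProduct.tmul_zero]

/-- The exterior derivative on functions, `f ↦ ∑ (∂f/∂t_i) dt_i`. -/
def funD : Fun K n →ₗ[K] Form K n :=
  ((Ideal.span {(∑ i, MvPolynomial.X i - 1 :
    MvPolynomial (Fin (n + 1)) K)}).restrictScalars K).liftQ (polyD K n) (polyD_ker K n) ∘ₗ
  (Submodule.Quotient.restrictScalarsEquiv K (Ideal.span {(∑ i, MvPolynomial.X i - 1 :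
    MvPolynomial (Fin (n + 1)) K)})).symm.toLinearMap

theorem funD_mk (f : MvPolynomial (Fin (n + 1)) K) :
    funD K n (funMk K n f) = ∑ i, funMk K n (MvPolynomial.pderiv i f) ⊗ₜ[K] dt K n i := by
  rw [← polyD_apply]; rfl

theorem funD_X (i : Fin (n + 1)) :
    funD K n (funMk K n (MvPolynomial.X i)) = 1 ⊗ₜ[K] dt K n i := by
  rw [funD_mk, Finset.sum_eq_single i]
  · simp
  · intro j _ hj
    rw [MvPolynomial.pderiv_X_of_ne hj.symm, map_zero, TensorProduct.zero_tmul]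
  · simp

theorem funD_mul (p q : Fun K n) :
    funD K n (p * q) = (p ⊗ₜ[K] 1) * funD K n q + (q ⊗ₜ[K] 1) * funD K n p := by
  obtain ⟨f, rfl⟩ := funMk_surjective K n p
  obtain ⟨g, rfl⟩ := funMk_surjective K n q
  rw [← map_mul, funD_mk, funD_mk, funD_mk, Finset.mul_sum, Finset.mul_sum,
    ← Finset.sum_add_distrib]
  refine Finset.sum_congr rfl fun i _ => ?_
  simp [Derivation.leibniz, TensorProduct.add_tmul]

/-- The exterior derivative, `d(f λ) = (df) λ` for a function `f` and a product `λ` of `dt_i`s. -/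
def d : Form K n →ₗ[K] Form K n :=
  TensorProduct.lift
    ((LinearMap.mul K (Form K n)).compl₂ Algebra.TensorProduct.includeRight.toLinearMap ∘ₗ
      funD K n)

theorem d_tmul (f : MvPolynomial (Fin (n + 1)) K) (l : ExteriorAlgebra K (Cot K n)) :
    d K n (funMk K n f ⊗ₜ l) =
      ∑ i, funMk K n (MvPolynomial.pderiv i f) ⊗ₜ[K] (dt K n i * l) := by
  simp [d, funD_mk]

theorem ext_comm_one {V : Type v} [AddCommGroup V] [Module K V] (x : V) {j : ℕ}
    {l : ExteriorAlgebra K V} (hl : l ∈ ⋀[K]^j V) :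
    ExteriorAlgebra.ι K x * l = (-1 : K) ^ j • (l * ExteriorAlgebra.ι K x) := by
  induction hl using Submodule.pow_induction_on_left' with
  | algebraMap r => simp [Algebra.commutes]
  | add a b i ha hb iha ihb => rw [mul_add, iha, ihb, add_mul, smul_add]
  | mem_mul m hm i a ha ih =>
    obtain ⟨y, rfl⟩ := hm
    have h := eq_neg_of_add_eq_zero_left (ExteriorAlgebra.ι_add_mul_swap (R := K) x y)
    rw [← mul_assoc, h, neg_mul, mul_assoc, ih, pow_succ, mul_smul_comm, mul_assoc]
    simp

theorem ext_comm {V : Type v} [AddCommGroup V] [Module K V] {i j : ℕ}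
    {k l : ExteriorAlgebra K V} (hk : k ∈ ⋀[K]^i V) (hl : l ∈ ⋀[K]^j V) :
    k * l = (-1 : K) ^ (i * j) • (l * k) := by
  induction hk using Submodule.pow_induction_on_left' with
  | algebraMap r => simp [Algebra.commutes]
  | add a b i ha hb iha ihb => rw [add_mul, iha, ihb, mul_add, smul_add]
  | mem_mul m hm i a ha ih =>
    obtain ⟨y, rfl⟩ := hm
    rw [mul_assoc, ih, mul_smul_comm, ← mul_assoc, ext_comm_one K y hl, smul_mul_assoc, smul_smul,
      mul_assoc, ← pow_add, Nat.succ_mul]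

/-- The forms of degree `i`. -/
def deg (i : ℕ) : Submodule K (Form K n) :=
  Submodule.span K {z | ∃ f : MvPolynomial (Fin (n + 1)) K, ∃ l ∈ ⋀[K]^i (Cot K n),
    z = funMk K n f ⊗ₜ l}

theorem tmul_mem_deg {i : ℕ} (f : MvPolynomial (Fin (n + 1)) K)
    {l : ExteriorAlgebra K (Cot K n)} (hl : l ∈ ⋀[K]^i (Cot K n)) :
    funMk K n f ⊗ₜ l ∈ deg K n i := Submodule.subset_span ⟨f, l, hl, rfl⟩

theorem dt_mem (i : Fin (n + 1)) : dt K n i ∈ ⋀[K]^1 (Cot K n) := by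
  have h : dt K n i ∈ LinearMap.range (ExteriorAlgebra.ι K (M := Cot K n)) := ⟨_, rfl⟩
  rwa [← pow_one (LinearMap.range (ExteriorAlgebra.ι K (M := Cot K n)))] at h

theorem ext_mul_mem {V : Type v} [AddCommGroup V] [Module K V] {i j : ℕ}
    {k l : ExteriorAlgebra K V} (hk : k ∈ ⋀[K]^i V) (hl : l ∈ ⋀[K]^j V) :
    k * l ∈ ⋀[K]^(i + j) V := by
  have h := Submodule.mul_mem_mul hk hl
  rwa [← pow_add] at h

theorem d_comp_d (x : Form K n) : d K n (d K n x) = 0 := by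
  have hpd : ∀ (i j : Fin (n + 1)) (f : MvPolynomial (Fin (n + 1)) K),
      MvPolynomial.pderiv i (MvPolynomial.pderiv j f) =
        MvPolynomial.pderiv j (MvPolynomial.pderiv i f) := by
    intro i j f
    let D : Fin (n + 1) → Derivation K (MvPolynomial (Fin (n + 1)) K)
      (MvPolynomial (Fin (n + 1)) K) := fun i => MvPolynomial.pderiv i
    have : ⁅D i, D j⁆ = 0 := by
      refine MvPolynomial.derivation_ext fun k => ?_
      simp [D, Derivation.commutator_apply, MvPolynomial.pderiv_X, Pi.single_apply, apply_ite]
    have h := congrArg (fun D => D f) this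
    simpa [D, Derivation.commutator_apply, sub_eq_zero] using h
  induction x using TensorProduct.induction_on with
  | zero => simp
  | add a b ha hb => rw [map_add, map_add, ha, hb, add_zero]
  | tmul p l =>
    obtain ⟨f, rfl⟩ := funMk_surjective K n p
    simp only [d_tmul, map_sum]
    rw [← Finset.sum_product']
    refine Finset.sum_involution (fun p _ => (p.2, p.1)) ?_ ?_ ?_ ?_
    · rintro ⟨i, j⟩ -
      have h : dt K n j * (dt K n i * l) + dt K n i * (dt K n j * l) = 0 := by
        rw [← mul_assoc, ← mul_assoc, ← add_mul]
        simp only [dt, ExteriorAlgebra.ι_add_mul_swap, zero_mul]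
      simp only [hpd i j f, ← TensorProduct.tmul_add, h, TensorProduct.tmul_zero]
    · rintro ⟨i, j⟩ - h he
      apply h
      simp only [Prod.mk.injEq] at he
      obtain rfl := he.1
      simp only [dt, ← mul_assoc, ExteriorAlgebra.ι_sq_zero, zero_mul, TensorProduct.tmul_zero]
    · simp
    · simp

theorem d_mul {i : ℕ} {x : Form K n} (y : Form K n) (hx : x ∈ deg K n i) :
    d K n (x * y) = d K n x * y + (-1 : K) ^ i • (x * d K n y) := by
  induction hx using Submodule.span_induction with
  | zero => simp
  | add a b _ _ ha hb => rw [add_mul, map_add, ha, hb, map_add, add_mul, add_mul, smul_add]; abel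
  | smul c a _ ha =>
    rw [smul_mul_assoc, map_smul, ha, map_smul, smul_mul_assoc, smul_mul_assoc, smul_add,
      smul_comm c]
  | mem x hx =>
    obtain ⟨f, l, hl, rfl⟩ := hx
    induction y using TensorProduct.induction_on with
    | zero => simp
    | add a b ha hb => rw [mul_add, map_add, ha, hb, map_add, mul_add, mul_add, smul_add]; abel
    | tmul q m =>
      obtain ⟨g, rfl⟩ := funMk_surjective K n q
      rw [Algebra.TensorProduct.tmul_mul_tmul, ← map_mul, d_tmul, d_tmul, d_tmul, Finset.sum_mul,
        Finset.mul_sum, Finset.smul_sum, ← Finset.sum_add_distrib]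
      refine Finset.sum_congr rfl fun k _ => ?_
      rw [Algebra.TensorProduct.tmul_mul_tmul, Algebra.TensorProduct.tmul_mul_tmul, ← mul_assoc l,
        ← TensorProduct.tmul_smul, ← smul_mul_assoc, dt, ← ext_comm_one K _ hl]
      simp only [Derivation.leibniz, smul_eq_mul, map_add, map_mul, TensorProduct.add_tmul,
        mul_assoc]
      rw [add_comm, mul_comm (funMk K n g)]

theorem iSup_deg : iSup (deg K n) = ⊤ := by
  rw [eq_top_iff]
  rintro x -
  induction x using TensorProduct.induction_on with
  | zero => exact Submodule.zero_mem _
  | add a b ha hb => exact Submodule.add_mem _ ha hb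
  | tmul p l =>
    obtain ⟨f, rfl⟩ := funMk_surjective K n p
    have hl : l ∈ (⨆ i : ℕ, ⋀[K]^i (Cot K n)) := by
      rw [(DirectSum.Decomposition.isInternal
        (fun i : ℕ => ⋀[K]^i (Cot K n))).submodule_iSup_eq_top]
      trivial
    have : (⨆ i : ℕ, ⋀[K]^i (Cot K n)) ≤
        (iSup (deg K n)).comap (TensorProduct.mk K _ _ (funMk K n f)) :=
      iSup_le fun i m hm => Submodule.mem_iSup_of_mem i (tmul_mem_deg K n f hm)
    exact this hl

theorem isInternal_deg [CharZero K] : DirectSum.IsInternal (deg K n) := by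
  have h := DirectSum.Decomposition.isInternal (fun i : ℕ => ⋀[K]^i (Cot K n))
  refine isInternal_of_scale (TensorProduct.map LinearMap.id (gradedScale h fun i => (i : K)))
    (fun i => (i : K)) Nat.cast_injective (fun i x hx => ?_) (iSup_deg K n)
  induction hx using Submodule.span_induction with
  | zero => simp
  | add a b _ _ ha hb => rw [map_add, ha, hb, smul_add]
  | smul c a _ ha => rw [map_smul, ha, smul_comm]
  | mem x hx =>
    obtain ⟨f, l, hl, rfl⟩ := hx
    rw [TensorProduct.map_tmul, gradedScale_apply h _ hl, TensorProduct.tmul_smul]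
    rfl

theorem mul_mem {i j : ℕ} {x y : Form K n} (hx : x ∈ deg K n i) (hy : y ∈ deg K n j) :
    x * y ∈ deg K n (i + j) := by
  have : deg K n i * deg K n j ≤ deg K n (i + j) := by
    rw [deg, deg, Submodule.span_mul_span, Submodule.span_le]
    rintro _ ⟨_, ⟨f, l, hl, rfl⟩, _, ⟨g, m, hm, rfl⟩, rfl⟩
    simp only [Algebra.TensorProduct.tmul_mul_tmul, ← map_mul]
    exact tmul_mem_deg K n _ (ext_mul_mem K hl hm)
  exact this (Submodule.mul_mem_mul hx hy)

theorem mul_comm' {i j : ℕ} {x y : Form K n} (hx : x ∈ deg K n i) (hy : y ∈ deg K n j) :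
    x * y = (-1 : K) ^ (i * j) • (y * x) := by
  induction hx, hy using Submodule.span_induction₂ with
  | zero_left => simp
  | zero_right => simp
  | add_left a b c _ _ _ ha hb => rw [add_mul, ha, hb, mul_add, smul_add]
  | add_right a b c _ _ _ ha hb => rw [mul_add, ha, hb, add_mul, smul_add]
  | smul_left c a b _ _ ha => rw [smul_mul_assoc, ha, mul_smul_comm, smul_comm]
  | smul_right c a b _ _ ha => rw [mul_smul_comm, ha, smul_mul_assoc, smul_comm]
  | mem_mem x y hx hy =>
    obtain ⟨f, l, hl, rfl⟩ := hx
    obtain ⟨g, m, hm, rfl⟩ := hy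
    rw [Algebra.TensorProduct.tmul_mul_tmul, Algebra.TensorProduct.tmul_mul_tmul,
      ext_comm K hl hm, TensorProduct.tmul_smul, mul_comm (funMk K n f)]

theorem d_mem {i : ℕ} {x : Form K n} (hx : x ∈ deg K n i) : d K n x ∈ deg K n (i + 1) := by
  have : deg K n i ≤ (deg K n (i + 1)).comap (d K n) := by
    rw [deg, Submodule.span_le]
    rintro _ ⟨f, l, hl, rfl⟩
    simp only [Submodule.comap_coe, Set.mem_preimage, SetLike.mem_coe, d_tmul]
    refine Submodule.sum_mem _ fun k _ => tmul_mem_deg K n _ ?_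
    have h := ext_mul_mem K (dt_mem K n k) hl
    rwa [add_comm 1 i] at h
  exact this hx

end SimplexForms

/-- The commutative differential graded algebra `Ω_n` of polynomial differential forms on the
standard `n`-simplex. -/
def simplexForms (K : Type u) [Field K] [CharZero K] (n : ℕ) : CDGA.{u, u} K where
  carrier := SimplexForms.Form K n
  deg := SimplexForms.deg K n
  internal := SimplexForms.isInternal_deg K n
  one_mem := by
    have h := SimplexForms.tmul_mem_deg K n (i := 0) 1 (l := 1)
      (SetLike.one_mem_graded (fun i : ℕ => ⋀[K]^i (SimplexForms.Cot K n)))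
    rw [map_one] at h
    exact h
  mul_mem := SimplexForms.mul_mem K n
  mul_comm' := SimplexForms.mul_comm' K n
  d := SimplexForms.d K n
  d_mem := SimplexForms.d_mem K n
  d_d := SimplexForms.d_comp_d K n
  d_mul := SimplexForms.d_mul K n

namespace SimplexForms

variable (K : Type u) [Field K] (n : ℕ)

/-- Restriction to the `k`-th face on polynomials: `t_k ↦ 0`, and the other coordinates are
renumbered in increasing order. -/
def polyFace (k : Fin (n + 2)) : MvPolynomial (Fin (n + 2)) K →ₐ[K] Fun K n :=
  MvPolynomial.aeval
    (k.insertNth (α := fun _ => Fun K n) 0 (fun j => funMk K n (MvPolynomial.X j)))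

theorem polyFace_ker (k : Fin (n + 2)) (f : MvPolynomial (Fin (n + 2)) K)
    (hf : f ∈ Ideal.span {(∑ i, MvPolynomial.X i - 1 : MvPolynomial (Fin (n + 2)) K)}) :
    polyFace K n k f = 0 := by
  obtain ⟨g, rfl⟩ := Ideal.mem_span_singleton'.1 hf
  have h0 : funMk K n (∑ i, MvPolynomial.X i - 1) = 0 :=
    Ideal.Quotient.eq_zero_iff_mem.2 (Ideal.mem_span_singleton_self _)
  have : polyFace K n k (∑ i, MvPolynomial.X i - 1) = 0 := by
    rw [← h0, Fin.sum_univ_succAbove _ k]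
    simp [polyFace]
  rw [map_mul, this, mul_zero]

/-- Restriction of polynomial functions to the `k`-th face. -/
def funFace (k : Fin (n + 2)) : Fun K (n + 1) →ₐ[K] Fun K n :=
  Ideal.Quotient.liftₐ _ (polyFace K n k) (polyFace_ker K n k)

/-- Restriction to the `k`-th face on the `dt_i`: `dt_k ↦ 0`, and the others are renumbered in
increasing order. -/
def cotFace (k : Fin (n + 2)) : Cot K (n + 1) →ₗ[K] Cot K n :=
  Submodule.mapQ _ _ (LinearMap.funLeft K K k.succAbove) (by
    rw [Submodule.span_singleton_le_iff_mem]
    exact Submodule.mem_span_singleton_self (1 : Fin (n + 1) → K))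

theorem cotFace_mk (k : Fin (n + 2)) (x : Fin (n + 2) → K) :
    cotFace K n k (cotMk K (n + 1) x) = cotMk K n (LinearMap.funLeft K K k.succAbove x) := rfl

/-- Restriction of polynomial forms to the `k`-th face. -/
def formFace (k : Fin (n + 2)) : Form K (n + 1) →ₐ[K] Form K n :=
  Algebra.TensorProduct.map (funFace K n k) (ExteriorAlgebra.map (cotFace K n k))

theorem funFace_mk (k : Fin (n + 2)) (f : MvPolynomial (Fin (n + 2)) K) :
    funFace K n k (funMk K (n + 1) f) = polyFace K n k f := rfl

theorem funFace_X_self (k : Fin (n + 2)) :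
    funFace K n k (funMk K (n + 1) (MvPolynomial.X k)) = 0 := by
  simp [funFace_mk, polyFace]

theorem funFace_X_succAbove (k : Fin (n + 2)) (j : Fin (n + 1)) :
    funFace K n k (funMk K (n + 1) (MvPolynomial.X (k.succAbove j))) =
      funMk K n (MvPolynomial.X j) := by
  simp [funFace_mk, polyFace]

theorem extFace_dt_self (k : Fin (n + 2)) :
    ExteriorAlgebra.map (cotFace K n k) (dt K (n + 1) k) = 0 := by
  rw [dt, ExteriorAlgebra.map_apply_ι, cotFace_mk]
  have : LinearMap.funLeft K K k.succAbove (Pi.single k (1 : K)) = 0 := by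
    ext j
    simp [LinearMap.funLeft_apply, Fin.succAbove_ne]
  rw [this]; simp

theorem extFace_dt_succAbove (k : Fin (n + 2)) (j : Fin (n + 1)) :
    ExteriorAlgebra.map (cotFace K n k) (dt K (n + 1) (k.succAbove j)) = dt K n j := by
  rw [dt, ExteriorAlgebra.map_apply_ι, cotFace_mk, dt]
  have : LinearMap.funLeft K K k.succAbove (Pi.single (k.succAbove j) (1 : K)) = Pi.single j 1 := by
    ext i
    simp [LinearMap.funLeft_apply, Pi.single_apply]
  rw [this]

theorem extFace_mem (k : Fin (n + 2)) {i : ℕ} {l : ExteriorAlgebra K (Cot K (n + 1))}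
    (hl : l ∈ ⋀[K]^i (Cot K (n + 1))) :
    ExteriorAlgebra.map (cotFace K n k) l ∈ ⋀[K]^i (Cot K n) := by
  induction hl using Submodule.pow_induction_on_left' with
  | algebraMap r => rw [AlgHom.commutes]; exact SetLike.algebraMap_mem_graded (fun i : ℕ => ⋀[K]^i (Cot K n)) r
  | add a b i ha hb iha ihb => rw [map_add]; exact Submodule.add_mem _ iha ihb
  | mem_mul m hm i a ha ih =>
    obtain ⟨y, rfl⟩ := hm
    rw [map_mul, ExteriorAlgebra.map_apply_ι]
    have h := Submodule.mul_mem_mul (LinearMap.mem_range_self (ExteriorAlgebra.ι K)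
      (cotFace K n k y)) ih
    rwa [← pow_succ'] at h

theorem formFace_mem (k : Fin (n + 2)) {i : ℕ} {x : Form K (n + 1)} (hx : x ∈ deg K (n + 1) i) :
    formFace K n k x ∈ deg K n i := by
  have : deg K (n + 1) i ≤ (deg K n i).comap (formFace K n k).toLinearMap := by
    rw [deg, Submodule.span_le]
    rintro _ ⟨f, l, hl, rfl⟩
    obtain ⟨g, hg⟩ := funMk_surjective K n (funFace K n k (funMk K (n + 1) f))
    simp only [Submodule.comap_coe, Set.mem_preimage, SetLike.mem_coe, formFace,
      AlgHom.toLinearMap_apply, Algebra.TensorProduct.map_tmul, ← hg]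
    exact tmul_mem_deg K n _ (extFace_mem K n k hl)
  exact this hx

theorem funFace_funD (k : Fin (n + 2)) (p : Fun K (n + 1)) :
    formFace K n k (funD K (n + 1) p) = funD K n (funFace K n k p) := by
  obtain ⟨f, rfl⟩ := funMk_surjective K (n + 1) p
  induction f using MvPolynomial.induction_on with
  | C a =>
    have h : ∀ m, funD K m (funMk K m (MvPolynomial.C a)) = 0 := fun m => by
      rw [funD_mk]; simp
    have h' : funFace K n k (funMk K (n + 1) (MvPolynomial.C a)) = funMk K n (MvPolynomial.C a) := by
      rw [← MvPolynomial.algebraMap_eq, ← MvPolynomial.algebraMap_eq, AlgHom.commutes,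
        AlgHom.commutes, AlgHom.commutes]
    rw [h, h', h, map_zero]
  | add f g hf hg => simp only [map_add, hf, hg]
  | mul_X f i hf =>
    rw [map_mul, funD_mul, map_add, map_mul, map_mul, hf, map_mul, funD_mul]
    have hX : formFace K n k (funD K (n + 1) (funMk K (n + 1) (MvPolynomial.X i))) =
        funD K n (funFace K n k (funMk K (n + 1) (MvPolynomial.X i))) := by
      rw [funD_X]
      induction i using Fin.succAboveCases k with
      | x => simp [formFace, extFace_dt_self, funFace_X_self]
      | p j => rw [funFace_X_succAbove, funD_X]; simp [formFace, extFace_dt_succAbove]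
    rw [hX]
    simp [formFace]

theorem formFace_d (k : Fin (n + 2)) (x : Form K (n + 1)) :
    formFace K n k (d K (n + 1) x) = d K n (formFace K n k x) := by
  induction x using TensorProduct.induction_on with
  | zero => simp
  | add a b ha hb => simp only [map_add, ha, hb]
  | tmul p l =>
    have : ∀ m (q : Fun K m) l, d K m (q ⊗ₜ l) = funD K m q * (1 ⊗ₜ l) := fun m q l => rfl
    rw [this, map_mul, funFace_funD]
    simp [formFace, this]

end SimplexForms

/-- The `k`-th face map `δ^k : Ω_{n+1} → Ω_n`. -/
def simplexFace (K : Type u) [Field K] [CharZero K] (n : ℕ) (k : Fin (n + 2)) :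
    CDGA.Hom (simplexForms K (n + 1)) (simplexForms K n) where
  toAlgHom := SimplexForms.formFace K n k
  map_deg := SimplexForms.formFace_mem K n k
  map_d := SimplexForms.formFace_d K n k

namespace CDGA

variable {K : Type u} [Field K] (C : CDGA.{u, v'} K) (L : DGLA.{u, v} K)

/-- The elements of total degree `k` in `C ⊗ L`, spanned by the products of homogeneous elements
whose degrees add up to `k`. -/
def tensorDeg (k : ℤ) : Submodule K (C.carrier ⊗[K] L.carrier) :=
  Submodule.span K {z | ∃ (i : ℕ) (j : ℤ), (i : ℤ) + j = k ∧
    ∃ a ∈ C.deg i, ∃ x ∈ L.deg j, z = a ⊗ₜ x}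

/-- The differential of `C ⊗ L`, `d(a ⊗ x) = da ⊗ x + (-1)^{|a|} a ⊗ dx`. -/
def tensorD : C.carrier ⊗[K] L.carrier →ₗ[K] C.carrier ⊗[K] L.carrier :=
  TensorProduct.map C.d LinearMap.id +
    TensorProduct.map (gradedScale C.internal fun i => (-1 : K) ^ i) L.d

/-- The bracket of `C ⊗ L`, `[a ⊗ x, b ⊗ y] = (-1)^{|x||b|} ab ⊗ [x, y]`: the sign is `1` on the
even part of `b`, and `(-1)^{|x|}` on its odd part. -/
def tensorBracket : C.carrier ⊗[K] L.carrier →ₗ[K] C.carrier ⊗[K] L.carrier →ₗ[K]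
    C.carrier ⊗[K] L.carrier :=
  TensorProduct.map₂
    ((LinearMap.mul K C.carrier).compl₂ (gradedScale C.internal fun i => if Even i then 1 else 0))
    L.bracket +
  TensorProduct.map₂
    ((LinearMap.mul K C.carrier).compl₂ (gradedScale C.internal fun i => if Even i then 0 else 1))
    (L.bracket ∘ₗ gradedScale L.internal fun j => (-1 : K) ^ j)

variable {C L}

theorem tmul_mem_tensorDeg {i : ℕ} {j k : ℤ} (hk : (i : ℤ) + j = k) {a : C.carrier}
    {x : L.carrier} (ha : a ∈ C.deg i) (hx : x ∈ L.deg j) : a ⊗ₜ x ∈ tensorDeg C L k :=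
  Submodule.subset_span ⟨i, j, hk, a, ha, x, hx, rfl⟩

theorem tensorD_tmul {i : ℕ} {a : C.carrier} (ha : a ∈ C.deg i) (x : L.carrier) :
    tensorD C L (a ⊗ₜ x) = C.d a ⊗ₜ x + (-1 : K) ^ i • (a ⊗ₜ L.d x) := by
  simp [tensorD, gradedScale_apply C.internal _ ha, TensorProduct.smul_tmul']

theorem tensorBracket_tmul {i : ℕ} {j : ℤ} (a : C.carrier) {x : L.carrier} (hx : x ∈ L.deg j)
    {b : C.carrier} (hb : b ∈ C.deg i) (y : L.carrier) :
    tensorBracket C L (a ⊗ₜ x) (b ⊗ₜ y) =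
      (-1 : K) ^ (j * (i : ℤ)) • ((a * b) ⊗ₜ L.bracket x y) := by
  simp only [tensorBracket, LinearMap.add_apply, TensorProduct.map₂_apply_tmul,
    TensorProduct.map_tmul, LinearMap.compl₂_apply, LinearMap.mul_apply', LinearMap.comp_apply,
    gradedScale_apply C.internal _ hb, gradedScale_apply L.internal _ hx]
  rcases Nat.even_or_odd i with hi | hi
  · have h : Even (j * (i : ℤ)) := ((Int.even_coe_nat i).2 hi).mul_left j
    simp [hi, h.neg_one_zpow]
  · have h : (-1 : K) ^ (j * (i : ℤ)) = (-1) ^ j := by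
      rw [mul_comm, zpow_mul, zpow_natCast, hi.neg_one_pow]
    simp [Nat.not_even_iff_odd.2 hi, h]

theorem iSup_tensorDeg : iSup (tensorDeg C L) = ⊤ := by
  rw [eq_top_iff, ← TensorProduct.map₂_mk_top_top_eq_top, ← C.internal.submodule_iSup_eq_top,
    ← L.internal.submodule_iSup_eq_top, Submodule.map₂_iSup_left]
  refine iSup_le fun i => ?_
  rw [Submodule.map₂_iSup_right]
  refine iSup_le fun j => ?_
  rw [Submodule.map₂_le]
  exact fun a ha x hx => Submodule.mem_iSup_of_mem _ (tmul_mem_tensorDeg rfl ha hx)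

/-- The operator which is multiplication by the total degree. -/
def tensorEuler (C : CDGA.{u, v'} K) (L : DGLA.{u, v} K) :
    C.carrier ⊗[K] L.carrier →ₗ[K] C.carrier ⊗[K] L.carrier :=
  TensorProduct.map (gradedScale C.internal fun i => (i : K)) LinearMap.id +
    TensorProduct.map LinearMap.id (gradedScale L.internal fun j => (j : K))

theorem tensorEuler_apply {k : ℤ} {z : C.carrier ⊗[K] L.carrier} (hz : z ∈ tensorDeg C L k) :
    tensorEuler C L z = (k : K) • z := by
  induction hz using Submodule.span_induction with
  | zero => simp
  | add a b _ _ ha hb => rw [map_add, ha, hb, smul_add]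
  | smul c a _ ha => rw [map_smul, ha, smul_comm]
  | mem z hz =>
    obtain ⟨i, j, rfl, a, ha, x, hx, rfl⟩ := hz
    simp [tensorEuler, gradedScale_apply C.internal _ ha, gradedScale_apply L.internal _ hx,
      TensorProduct.smul_tmul', add_smul]

theorem isInternal_tensorDeg [CharZero K] : DirectSum.IsInternal (tensorDeg C L) :=
  isInternal_of_scale (tensorEuler C L) (fun k => (k : K)) Int.cast_injective
    (fun _ _ => tensorEuler_apply) iSup_tensorDeg

theorem tensorD_mem {k : ℤ} {z : C.carrier ⊗[K] L.carrier} (hz : z ∈ tensorDeg C L k) :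
    tensorD C L z ∈ tensorDeg C L (k + 1) := by
  induction hz using Submodule.span_induction with
  | zero => simp
  | add a b _ _ ha hb => rw [map_add]; exact Submodule.add_mem _ ha hb
  | smul c a _ ha => rw [map_smul]; exact Submodule.smul_mem _ _ ha
  | mem z hz =>
    obtain ⟨i, j, rfl, a, ha, x, hx, rfl⟩ := hz
    rw [tensorD_tmul ha]
    exact Submodule.add_mem _ (tmul_mem_tensorDeg (by push_cast; ring) (C.d_mem ha) hx)
      (Submodule.smul_mem _ _ (tmul_mem_tensorDeg (by ring) ha (L.d_mem hx)))

theorem tensorBracket_mem {k l : ℤ} {z w : C.carrier ⊗[K] L.carrier} (hz : z ∈ tensorDeg C L k)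
    (hw : w ∈ tensorDeg C L l) : tensorBracket C L z w ∈ tensorDeg C L (k + l) := by
  induction hz, hw using Submodule.span_induction₂ with
  | zero_left => simp
  | zero_right => simp
  | add_left a b c _ _ _ ha hb =>
    rw [map_add, LinearMap.add_apply]; exact Submodule.add_mem _ ha hb
  | add_right a b c _ _ _ ha hb => rw [map_add]; exact Submodule.add_mem _ ha hb
  | smul_left c a b _ _ ha =>
    rw [map_smul, LinearMap.smul_apply]; exact Submodule.smul_mem _ _ ha
  | smul_right c a b _ _ ha => rw [map_smul]; exact Submodule.smul_mem _ _ ha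
  | mem_mem z w hz hw =>
    obtain ⟨i, j, rfl, a, ha, x, hx, rfl⟩ := hz
    obtain ⟨i', j', rfl, b, hb, y, hy, rfl⟩ := hw
    rw [tensorBracket_tmul a hx hb]
    exact Submodule.smul_mem _ _ (tmul_mem_tensorDeg (by push_cast; ring) (C.mul_mem ha hb)
      (L.bracket_mem hx hy))

theorem tensorD_tensorD (z : C.carrier ⊗[K] L.carrier) : tensorD C L (tensorD C L z) = 0 := by
  have hz : z ∈ iSup (tensorDeg C L) := iSup_tensorDeg (C := C) (L := L) ▸ trivial
  induction hz using Submodule.iSup_induction' with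
  | zero => simp
  | add a b _ _ ha hb => rw [map_add, map_add, ha, hb, add_zero]
  | mem k z hz =>
    induction hz using Submodule.span_induction with
    | zero => simp
    | add a b _ _ ha hb => rw [map_add, map_add, ha, hb, add_zero]
    | smul c a _ ha => rw [map_smul, map_smul, ha, smul_zero]
    | mem z hz =>
      obtain ⟨i, j, rfl, a, ha, x, hx, rfl⟩ := hz
      rw [tensorD_tmul ha, map_add, map_smul, tensorD_tmul ha, tensorD_tmul (C.d_mem ha), C.d_d,
        L.d_d, TensorProduct.zero_tmul, TensorProduct.tmul_zero, smul_zero, add_zero, zero_add,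
        ← add_smul, show (-1 : K) ^ (i + 1) + (-1) ^ i = 0 by ring, zero_smul]

theorem tensorBracket_skew {k l : ℤ} {z w : C.carrier ⊗[K] L.carrier} (hz : z ∈ tensorDeg C L k)
    (hw : w ∈ tensorDeg C L l) :
    tensorBracket C L z w = -((-1 : K) ^ (k * l) • tensorBracket C L w z) := by
  induction hz, hw using Submodule.span_induction₂ with
  | zero_left => simp
  | zero_right => simp
  | add_left a b c _ _ _ ha hb =>
    rw [map_add, LinearMap.add_apply, ha, hb, map_add, smul_add, neg_add]
  | add_right a b c _ _ _ ha hb =>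
    rw [map_add, ha, hb, map_add, LinearMap.add_apply, smul_add, neg_add]
  | smul_left c a b _ _ ha =>
    rw [map_smul, LinearMap.smul_apply, ha, map_smul, smul_neg, smul_comm]
  | smul_right c a b _ _ ha =>
    rw [map_smul, ha, map_smul, LinearMap.smul_apply, smul_neg, smul_comm]
  | mem_mem z w hz hw =>
    obtain ⟨i, j, rfl, a, ha, x, hx, rfl⟩ := hz
    obtain ⟨i', j', rfl, b, hb, y, hy, rfl⟩ := hw
    rw [tensorBracket_tmul a hx hb, tensorBracket_tmul b hy ha, C.mul_comm' ha hb,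
      L.bracket_skew hx hy]
    simp only [TensorProduct.tmul_neg, TensorProduct.tmul_smul, ← TensorProduct.smul_tmul',
      smul_neg, smul_smul]
    congr 2
    have h1 : (-1 : K) ≠ 0 := by simp
    rw [← zpow_natCast, ← zpow_add₀ h1, ← zpow_add₀ h1, ← zpow_add₀ h1]
    push_cast
    have h : ∀ m n : ℤ, Even (m - n) → (-1 : K) ^ m = (-1) ^ n := by
      intro m n hmn
      rw [show m = m - n + n by ring, zpow_add₀ h1, hmn.neg_one_zpow, one_mul]
    apply h
    exact ⟨-(i * j' : ℤ), by ring⟩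

theorem tensor_jacobi {k l m : ℤ} {z w r : C.carrier ⊗[K] L.carrier}
    (hz : z ∈ tensorDeg C L k) (hw : w ∈ tensorDeg C L l) (hr : r ∈ tensorDeg C L m) :
    tensorBracket C L z (tensorBracket C L w r) =
      tensorBracket C L (tensorBracket C L z w) r +
        (-1 : K) ^ (k * l) • tensorBracket C L w (tensorBracket C L z r) := by
  induction hr using Submodule.span_induction with
  | zero => simp
  | add a b _ _ ha hb => simp only [map_add, ha, hb, smul_add]; abel
  | smul c a _ ha => simp only [map_smul, ha, smul_add, smul_comm c]
  | mem r hr =>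
  induction hz, hw using Submodule.span_induction₂ with
  | zero_left => simp
  | zero_right => simp
  | add_left a b c _ _ _ ha hb =>
    simp only [map_add, LinearMap.add_apply, ha, hb, smul_add]; abel
  | add_right a b c _ _ _ ha hb =>
    simp only [map_add, LinearMap.add_apply, ha, hb, smul_add]; abel
  | smul_left c a b _ _ ha =>
    simp only [map_smul, LinearMap.smul_apply, ha, smul_add, smul_comm c]
  | smul_right c a b _ _ ha =>
    simp only [map_smul, LinearMap.smul_apply, ha, smul_add, smul_comm c]
  | mem_mem z w hz hw =>
    obtain ⟨i, j, rfl, a, ha, x, hx, rfl⟩ := hz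
    obtain ⟨i', j', rfl, b, hb, y, hy, rfl⟩ := hw
    obtain ⟨i'', j'', rfl, c, hc, t, ht, rfl⟩ := hr
    simp only [tensorBracket_tmul a hx hb, tensorBracket_tmul b hy hc, tensorBracket_tmul a hx hc,
      map_smul, LinearMap.smul_apply, tensorBracket_tmul a hx (C.mul_mem hb hc),
      tensorBracket_tmul (a * b) (L.bracket_mem hx hy) hc,
      tensorBracket_tmul b hy (C.mul_mem ha hc), L.jacobi hx hy ht, ← mul_assoc,
      C.mul_comm' hb ha]
    simp only [TensorProduct.tmul_add, TensorProduct.tmul_smul, ← TensorProduct.smul_tmul',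
      smul_smul, smul_add, smul_mul_assoc]
    have h1 : (-1 : K) ≠ 0 := by simp
    have h : ∀ m n : ℤ, Even (m - n) → (-1 : K) ^ m = (-1) ^ n := by
      intro m n hmn
      rw [show m = m - n + n by ring, zpow_add₀ h1, hmn.neg_one_zpow, one_mul]
    simp only [← zpow_natCast, ← zpow_add₀ h1]
    push_cast
    congr 2
    · apply h
      exact ⟨0, by ring⟩
    · apply h
      exact ⟨-(i * j' + i * i' : ℤ), by ring⟩

theorem tensor_leibniz {k l : ℤ} {z w : C.carrier ⊗[K] L.carrier} (hz : z ∈ tensorDeg C L k)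
    (hw : w ∈ tensorDeg C L l) :
    tensorD C L (tensorBracket C L z w) =
      tensorBracket C L (tensorD C L z) w + (-1 : K) ^ k • tensorBracket C L z (tensorD C L w) := by
  induction hz, hw using Submodule.span_induction₂ with
  | zero_left => simp
  | zero_right => simp
  | add_left a b c _ _ _ ha hb =>
    simp only [map_add, LinearMap.add_apply, ha, hb, smul_add]; abel
  | add_right a b c _ _ _ ha hb =>
    simp only [map_add, ha, hb, smul_add]; abel
  | smul_left c a b _ _ ha =>
    simp only [map_smul, LinearMap.smul_apply, ha, smul_add, smul_comm c]
  | smul_right c a b _ _ ha =>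
    simp only [map_smul, ha, smul_add, smul_comm c]
  | mem_mem z w hz hw =>
    obtain ⟨i, j, rfl, a, ha, x, hx, rfl⟩ := hz
    obtain ⟨i', j', rfl, b, hb, y, hy, rfl⟩ := hw
    simp only [tensorBracket_tmul a hx hb, tensorD_tmul ha, tensorD_tmul hb, map_smul, map_add,
      LinearMap.add_apply, LinearMap.smul_apply, tensorD_tmul (C.mul_mem ha hb),
      tensorBracket_tmul (C.d a) hx hb, tensorBracket_tmul a (L.d_mem hx) hb,
      tensorBracket_tmul a hx (C.d_mem hb), C.d_mul b ha, L.leibniz hx hy]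
    simp only [TensorProduct.tmul_add, TensorProduct.add_tmul, TensorProduct.tmul_smul,
      ← TensorProduct.smul_tmul', smul_smul, smul_add]
    have h1 : (-1 : K) ≠ 0 := by simp
    have h : ∀ m n : ℤ, Even (m - n) → (-1 : K) ^ m = (-1) ^ n := by
      intro m n hmn
      rw [show m = m - n + n by ring, zpow_add₀ h1, hmn.neg_one_zpow, one_mul]
    simp only [← zpow_natCast, ← zpow_add₀ h1]
    push_cast
    rw [h (j * i' + i) (i + j + j * (i' + 1)) ⟨-j, by ring⟩,
      h (j * i' + (i + i')) (i + (j + 1) * i') ⟨0, by ring⟩,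
      h (j * i' + (i + i' + j)) (i + j + (j * i' + i')) ⟨0, by ring⟩]
    abel_nf

end CDGA

/-- The differential graded Lie algebra `C ⊗ L`, for a commutative differential graded algebra `C`
and a differential graded Lie algebra `L`. -/
def CDGA.tensor {K : Type u} [Field K] [CharZero K] (C : CDGA.{u, v'} K) (L : DGLA.{u, v} K) :
    DGLA.{u, max v v'} K where
  carrier := C.carrier ⊗[K] L.carrier
  deg := tensorDeg C L
  internal := isInternal_tensorDeg
  d := tensorD C L
  d_mem := tensorD_mem
  d_d := tensorD_tensorD
  bracket := tensorBracket C L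
  bracket_mem := tensorBracket_mem
  bracket_skew := tensorBracket_skew
  jacobi := tensor_jacobi
  leibniz := tensor_leibniz

namespace CDGA

variable {K : Type u} [Field K]

theorem map_gradedScale {ι : Type} [DecidableEq ι] {M : Type v} [AddCommGroup M] [Module K M]
    {N : Type v'} [AddCommGroup N] [Module K N] {deg : ι → Submodule K M} {deg' : ι → Submodule K N}
    (h : DirectSum.IsInternal deg) (h' : DirectSum.IsInternal deg') (c : ι → K) (f : M →ₗ[K] N)
    (hf : ∀ i, ∀ x ∈ deg i, f x ∈ deg' i) (x : M) :
    f (gradedScale h c x) = gradedScale h' c (f x) := by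
  have hx : x ∈ iSup deg := h.submodule_iSup_eq_top ▸ trivial
  induction hx using Submodule.iSup_induction' with
  | zero => simp
  | add a b _ _ ha hb => rw [map_add, map_add, ha, hb, map_add, map_add]
  | mem i x hx => rw [gradedScale_apply h c hx, gradedScale_apply h' c (hf i x hx), map_smul]

section TensorMap

variable {C D : CDGA.{u, v'} K} {L M : DGLA.{u, v} K} (f : CDGA.Hom C D) (φ : DGLA.Hom L M)

theorem map_tensorDeg {k : ℤ} {z : C.carrier ⊗[K] L.carrier} (hz : z ∈ tensorDeg C L k) :
    TensorProduct.map f.toAlgHom.toLinearMap φ.toLinearMap z ∈ tensorDeg D M k := by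
  have : tensorDeg C L k ≤ (tensorDeg D M k).comap
      (TensorProduct.map f.toAlgHom.toLinearMap φ.toLinearMap) := by
    rw [tensorDeg, Submodule.span_le]
    rintro _ ⟨i, j, hk, a, ha, x, hx, rfl⟩
    exact tmul_mem_tensorDeg hk (f.map_deg ha) (φ.map_deg hx)
  exact this hz

theorem map_tensorD (z : C.carrier ⊗[K] L.carrier) :
    TensorProduct.map f.toAlgHom.toLinearMap φ.toLinearMap (tensorD C L z) =
      tensorD D M (TensorProduct.map f.toAlgHom.toLinearMap φ.toLinearMap z) := by
  induction z using TensorProduct.induction_on with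
  | zero => simp
  | add a b ha hb => simp only [map_add, ha, hb]
  | tmul a x =>
    have := map_gradedScale C.internal D.internal (fun i => (-1 : K) ^ i) f.toAlgHom.toLinearMap
      (fun _ _ => f.map_deg) a
    simp only [AlgHom.toLinearMap_apply] at this
    simp [tensorD, f.map_d, φ.map_d, this]

theorem map_tensorBracket (z w : C.carrier ⊗[K] L.carrier) :
    TensorProduct.map f.toAlgHom.toLinearMap φ.toLinearMap (tensorBracket C L z w) =
      tensorBracket D M (TensorProduct.map f.toAlgHom.toLinearMap φ.toLinearMap z)
        (TensorProduct.map f.toAlgHom.toLinearMap φ.toLinearMap w) := by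
  induction z using TensorProduct.induction_on with
  | zero => simp
  | add a b ha hb => simp only [map_add, LinearMap.add_apply, ha, hb]
  | tmul a x =>
    induction w using TensorProduct.induction_on with
    | zero => simp
    | add a b ha hb => simp only [map_add, ha, hb]
    | tmul b y =>
      have h1 := fun c => map_gradedScale C.internal D.internal c f.toAlgHom.toLinearMap
        (fun _ _ => f.map_deg) b
      have h2 := map_gradedScale L.internal M.internal (fun i => (-1 : K) ^ i) φ.toLinearMap
        (fun _ _ => φ.map_deg) x
      simp only [AlgHom.toLinearMap_apply] at h1
      simp [tensorBracket, φ.map_bracket, h1, h2]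

/-- The morphism `f ⊗ φ : C ⊗ L → D ⊗ M` of differential graded Lie algebras induced by a morphism
`f : C → D` of commutative differential graded algebras and a morphism `φ : L → M` of
differential graded Lie algebras. -/
def tensorMap [CharZero K] : DGLA.Hom (C.tensor L) (D.tensor M) where
  toLinearMap := TensorProduct.map f.toAlgHom.toLinearMap φ.toLinearMap
  map_deg := map_tensorDeg f φ
  map_d := map_tensorD f φ
  map_bracket := map_tensorBracket f φ

end TensorMap

theorem tensorMap_comm [CharZero K] {C C₁ C₂ D : CDGA.{u, v'} K} {L L₁ L₂ M : DGLA.{u, v} K}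
    (f₁ : CDGA.Hom C C₁) (f₂ : CDGA.Hom C₁ D) (e₁ : CDGA.Hom C C₂) (e₂ : CDGA.Hom C₂ D)
    (φ₁ : DGLA.Hom L L₁) (φ₂ : DGLA.Hom L₁ M) (ψ₁ : DGLA.Hom L L₂) (ψ₂ : DGLA.Hom L₂ M)
    (hf : ∀ a, f₂.toAlgHom (f₁.toAlgHom a) = e₂.toAlgHom (e₁.toAlgHom a))
    (hφ : ∀ x, φ₂.toLinearMap (φ₁.toLinearMap x) = ψ₂.toLinearMap (ψ₁.toLinearMap x))
    (z : C.carrier ⊗[K] L.carrier) :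
    (tensorMap f₂ φ₂).toLinearMap ((tensorMap f₁ φ₁).toLinearMap z) =
      (tensorMap e₂ ψ₂).toLinearMap ((tensorMap e₁ ψ₁).toLinearMap z) := by
  change TensorProduct.map _ _ (TensorProduct.map _ _ z) =
    TensorProduct.map _ _ (TensorProduct.map _ _ z)
  induction z using TensorProduct.induction_on with
  | zero => simp
  | add a b ha hb => simp only [map_add, ha, hb]
  | tmul a x => simp [hf, hφ]

/-- The identity morphism. -/
def Hom.id (C : CDGA.{u, v} K) : Hom C C where
  toAlgHom := AlgHom.id K C.carrier
  map_deg h := h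
  map_d _ := rfl

end CDGA

/-- A semicosimplicial differential graded Lie algebra: differential graded Lie algebras `g_n` for
`n ≥ 0` and morphisms `∂_{k,n+1} : g_n → g_{n+1}` for `0 ≤ k ≤ n + 1` such that
`∂_{k+1,n+2} ∂_{l,n+1} = ∂_{l,n+2} ∂_{k,n+1}` for `l ≤ k`. -/
structure SemicosimplicialDGLA (K : Type u) [Field K] where
  obj : ℕ → DGLA.{u, v} K
  coface : ∀ (n : ℕ), Fin (n + 2) → DGLA.Hom (obj n) (obj (n + 1))
  coface_coface : ∀ (n : ℕ) (k l : Fin (n + 2)), l ≤ k → ∀ x : (obj n).carrier,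
    (coface (n + 1) k.succ).toLinearMap ((coface n l).toLinearMap x) =
      (coface (n + 1) l.castSucc).toLinearMap ((coface n k).toLinearMap x)

namespace SemicosimplicialDGLA

variable {K : Type u} [Field K]

/-- Morphisms of semicosimplicial differential graded Lie algebras. -/
structure Hom (g h : SemicosimplicialDGLA.{u, v} K) where
  app : ∀ n, DGLA.Hom (g.obj n) (h.obj n)
  naturality : ∀ (n : ℕ) (k : Fin (n + 2)) (x : (g.obj n).carrier),
    (app (n + 1)).toLinearMap ((g.coface n k).toLinearMap x) =
      (h.coface n k).toLinearMap ((app n).toLinearMap x)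

/-- The objects of the truncation between levels `0` and `2`. -/
def truncObj (g : SemicosimplicialDGLA.{u, v} K) : ℕ → DGLA.{u, v} K
  | 0 => g.obj 0
  | 1 => g.obj 1
  | 2 => g.obj 2
  | _ + 3 => DGLA.zero K

/-- The coface maps of the truncation between levels `0` and `2`. -/
def truncCoface (g : SemicosimplicialDGLA.{u, v} K) :
    ∀ n : ℕ, Fin (n + 2) → DGLA.Hom (g.truncObj n) (g.truncObj (n + 1))
  | 0, k => g.coface 0 k
  | 1, k => g.coface 1 k
  | _ + 2, _ => DGLA.Hom.zero _ _

/-- The truncation `g^{Δ_[0,2]}` of a semicosimplicial differential graded Lie algebra: it agrees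
with `g` at the levels `0, 1, 2`, and vanishes at the levels above. -/
def trunc (g : SemicosimplicialDGLA.{u, v} K) : SemicosimplicialDGLA.{u, v} K where
  obj := g.truncObj
  coface := g.truncCoface
  coface_coface
    | 0, k, l, h, x => g.coface_coface 0 k l h x
    | _ + 1, _, _, _, _ => rfl

/-- The components of the canonical morphism from `g` to its truncation. -/
def truncApp (g : SemicosimplicialDGLA.{u, v} K) : ∀ n : ℕ, DGLA.Hom (g.obj n) (g.truncObj n)
  | 0 => DGLA.Hom.id _
  | 1 => DGLA.Hom.id _
  | 2 => DGLA.Hom.id _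
  | _ + 3 => DGLA.Hom.zero _ _

/-- The morphism `Id_[0,2] : g^Δ → g^{Δ_[0,2]}`, which is the identity at the levels `0, 1, 2` and
zero at the levels above. -/
def toTrunc (g : SemicosimplicialDGLA.{u, v} K) : Hom g g.trunc where
  app := g.truncApp
  naturality
    | 0, _, _ => rfl
    | 1, _, _ => rfl
    | _ + 2, _, _ => rfl

variable [CharZero K] (g : SemicosimplicialDGLA.{u, v} K)

/-- The differential graded Lie algebra `Ω_n ⊗ g_n`. -/
abbrev level (n : ℕ) : DGLA.{u, max u v} K := (simplexForms K n).tensor (g.obj n)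

/-- `δ^{k,n+1} ⊗ id : Ω_{n+1} ⊗ g_{n+1} → Ω_n ⊗ g_{n+1}`. -/
abbrev faceMap (n : ℕ) (k : Fin (n + 2)) :
    DGLA.Hom (g.level (n + 1)) ((simplexForms K n).tensor (g.obj (n + 1))) :=
  CDGA.tensorMap (simplexFace K n k) (DGLA.Hom.id _)

/-- `id ⊗ ∂_{k,n+1} : Ω_n ⊗ g_n → Ω_n ⊗ g_{n+1}`. -/
abbrev cofaceMap (n : ℕ) (k : Fin (n + 2)) :
    DGLA.Hom (g.level n) ((simplexForms K n).tensor (g.obj (n + 1))) :=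
  CDGA.tensorMap (CDGA.Hom.id _) (g.coface n k)

/-- The elements of degree `m` of the Thom-Whitney differential graded Lie algebra: the sequences
`(x_n)` with `x_n ∈ Ω_n ⊗ g_n` of total degree `m` and `δ^{k,n} x_n = ∂_{k,n} x_{n-1}` for all
`0 ≤ k ≤ n`. -/
def totDeg (m : ℤ) : Submodule K (∀ n, (g.level n).carrier) where
  carrier := {x | (∀ n, x n ∈ (g.level n).deg m) ∧
    ∀ n k, (g.faceMap n k).toLinearMap (x (n + 1)) = (g.cofaceMap n k).toLinearMap (x n)}
  zero_mem' := ⟨fun n => Submodule.zero_mem _, fun n k => by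
    rw [Pi.zero_apply, Pi.zero_apply, map_zero, map_zero]⟩
  add_mem' hx hy := ⟨fun n => Submodule.add_mem _ (hx.1 n) (hy.1 n), fun n k => by
    rw [Pi.add_apply, Pi.add_apply, map_add, map_add, hx.2, hy.2]⟩
  smul_mem' c _ hx := ⟨fun n => Submodule.smul_mem _ c (hx.1 n), fun n k => by
    rw [Pi.smul_apply, Pi.smul_apply, map_smul, map_smul, hx.2]⟩

/-- The differential on sequences `(x_n)` with `x_n ∈ Ω_n ⊗ g_n`. -/
def piD : (∀ n, (g.level n).carrier) →ₗ[K] (∀ n, (g.level n).carrier) :=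
  LinearMap.pi fun n => (g.level n).d ∘ₗ LinearMap.proj n

/-- The bracket on sequences `(x_n)` with `x_n ∈ Ω_n ⊗ g_n`. -/
def piBracket : (∀ n, (g.level n).carrier) →ₗ[K] (∀ n, (g.level n).carrier) →ₗ[K]
    (∀ n, (g.level n).carrier) :=
  LinearMap.mk₂ K (fun x y n => (g.level n).bracket (x n) (y n))
    (fun _ _ _ => by ext n; simp) (fun _ _ _ => by ext n; simp)
    (fun _ _ _ => by ext n; simp) (fun _ _ _ => by ext n; simp)

theorem piD_mem {m : ℤ} {x : ∀ n, (g.level n).carrier} (hx : x ∈ g.totDeg m) :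
    g.piD x ∈ g.totDeg (m + 1) :=
  ⟨fun n => (g.level n).d_mem (hx.1 n), fun n k => by
    change (g.faceMap n k).toLinearMap ((g.level (n + 1)).d (x (n + 1))) =
      (g.cofaceMap n k).toLinearMap ((g.level n).d (x n))
    rw [DGLA.Hom.map_d, DGLA.Hom.map_d, hx.2]⟩

theorem piBracket_mem {m l : ℤ} {x y : ∀ n, (g.level n).carrier} (hx : x ∈ g.totDeg m)
    (hy : y ∈ g.totDeg l) : g.piBracket x y ∈ g.totDeg (m + l) :=
  ⟨fun n => (g.level n).bracket_mem (hx.1 n) (hy.1 n), fun n k => by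
    change (g.faceMap n k).toLinearMap ((g.level (n + 1)).bracket (x (n + 1)) (y (n + 1))) =
      (g.cofaceMap n k).toLinearMap ((g.level n).bracket (x n) (y n))
    rw [DGLA.Hom.map_bracket, DGLA.Hom.map_bracket, hx.2, hy.2]⟩

/-- The space underlying the Thom-Whitney differential graded Lie algebra: the direct sum, over all
degrees, of the spaces of homogeneous elements. -/
def totSpace : Submodule K (∀ n, (g.level n).carrier) := ⨆ m, g.totDeg m

theorem piD_mem_totSpace {x : ∀ n, (g.level n).carrier} (hx : x ∈ g.totSpace) :
    g.piD x ∈ g.totSpace := by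
  have : g.totSpace ≤ g.totSpace.comap g.piD :=
    iSup_le fun m x hx => Submodule.mem_iSup_of_mem (m + 1) (g.piD_mem hx)
  exact this hx

theorem piBracket_mem_totSpace {x y : ∀ n, (g.level n).carrier} (hx : x ∈ g.totSpace)
    (hy : y ∈ g.totSpace) : g.piBracket x y ∈ g.totSpace := by
  have : Submodule.map₂ g.piBracket g.totSpace g.totSpace ≤ g.totSpace := by
    conv_lhs => rw [totSpace, Submodule.map₂_iSup_left]
    refine iSup_le fun m => ?_
    rw [Submodule.map₂_iSup_right]
    refine iSup_le fun l => ?_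
    rw [Submodule.map₂_le]
    exact fun a ha b hb => Submodule.mem_iSup_of_mem (m + l) (g.piBracket_mem ha hb)
  exact this (Submodule.apply_mem_map₂ _ hx hy)

theorem isInternal_totDeg :
    DirectSum.IsInternal (fun m => (g.totDeg m).submoduleOf g.totSpace) := by
  let E : (∀ n, (g.level n).carrier) →ₗ[K] (∀ n, (g.level n).carrier) :=
    LinearMap.pi fun n =>
      CDGA.tensorEuler (simplexForms K n) (g.obj n) ∘ₗ LinearMap.proj n
  have hE : ∀ m, ∀ x ∈ g.totDeg m, E x = (m : K) • x := fun m x hx =>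
    funext fun n => CDGA.tensorEuler_apply (hx.1 n)
  have hE' : g.totSpace ≤ g.totSpace.comap E := iSup_le fun m x hx => by
    rw [Submodule.mem_comap, hE m x hx]
    exact Submodule.smul_mem _ _ (Submodule.mem_iSup_of_mem m hx)
  refine isInternal_of_scale (E.restrict fun _ hx => hE' hx) (fun m => (m : K)) Int.cast_injective
    (fun m x hx => Subtype.ext (hE m x hx)) (eq_top_iff.2 ?_)
  rintro ⟨x, hx⟩ -
  have : g.totSpace ≤ (⨆ m, (g.totDeg m).submoduleOf g.totSpace).map g.totSpace.subtype :=
    iSup_le fun m x hx =>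
      ⟨⟨x, Submodule.mem_iSup_of_mem m hx⟩, Submodule.mem_iSup_of_mem m hx, rfl⟩
  obtain ⟨y, hy, rfl⟩ := this hx
  exact hy

/-- The Thom-Whitney differential graded Lie algebra `Tot_TW(g^Δ)`. -/
def tot : DGLA.{u, max u v} K where
  carrier := g.totSpace
  deg m := (g.totDeg m).submoduleOf g.totSpace
  internal := g.isInternal_totDeg
  d := g.piD.restrict fun _ => g.piD_mem_totSpace
  d_mem hx := g.piD_mem hx
  d_d x := Subtype.ext (funext fun n => (g.level n).d_d (x.1 n))
  bracket := LinearMap.mk₂ K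
    (fun x y => ⟨g.piBracket x y, g.piBracket_mem_totSpace x.2 y.2⟩)
    (fun _ _ _ => Subtype.ext (by simp)) (fun _ _ _ => Subtype.ext (by simp))
    (fun _ _ _ => Subtype.ext (by simp)) (fun _ _ _ => Subtype.ext (by simp))
  bracket_mem hx hy := g.piBracket_mem hx hy
  bracket_skew hx hy := Subtype.ext (funext fun n => (g.level n).bracket_skew (hx.1 n) (hy.1 n))
  jacobi hx hy hz :=
    Subtype.ext (funext fun n => (g.level n).jacobi (hx.1 n) (hy.1 n) (hz.1 n))
  leibniz hx hy := Subtype.ext (funext fun n => (g.level n).leibniz (hx.1 n) (hy.1 n))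

variable {g} {h : SemicosimplicialDGLA.{u, v} K} (φ : Hom g h)

/-- The map on sequences induced by a morphism of semicosimplicial DGLAs. -/
def piMap : (∀ n, (g.level n).carrier) →ₗ[K] (∀ n, (h.level n).carrier) :=
  LinearMap.pi fun n =>
    (CDGA.tensorMap (CDGA.Hom.id (simplexForms K n)) (φ.app n)).toLinearMap ∘ₗ LinearMap.proj n

theorem piMap_mem {m : ℤ} {x : ∀ n, (g.level n).carrier} (hx : x ∈ g.totDeg m) :
    piMap φ x ∈ h.totDeg m := by
  refine ⟨fun n => (CDGA.tensorMap (CDGA.Hom.id (simplexForms K n)) (φ.app n)).map_deg (hx.1 n),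
    fun n k => ?_⟩
  have h1 := CDGA.tensorMap_comm (CDGA.Hom.id (simplexForms K (n + 1))) (simplexFace K n k)
    (simplexFace K n k) (CDGA.Hom.id (simplexForms K n)) (φ.app (n + 1)) (DGLA.Hom.id _)
    (DGLA.Hom.id _) (φ.app (n + 1)) (fun _ => rfl) (fun _ => rfl) (x (n + 1))
  have h2 := CDGA.tensorMap_comm (CDGA.Hom.id (simplexForms K n)) (CDGA.Hom.id (simplexForms K n))
    (CDGA.Hom.id (simplexForms K n)) (CDGA.Hom.id (simplexForms K n)) (φ.app n) (h.coface n k)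
    (g.coface n k) (φ.app (n + 1)) (fun _ => rfl) (fun y => (φ.naturality n k y).symm) (x n)
  exact h1.trans ((congrArg _ (hx.2 n k)).trans h2.symm)

theorem piMap_mem_totSpace {x : ∀ n, (g.level n).carrier} (hx : x ∈ g.totSpace) :
    piMap φ x ∈ h.totSpace := by
  have : g.totSpace ≤ h.totSpace.comap (piMap φ) :=
    iSup_le fun m x hx => Submodule.mem_iSup_of_mem m (piMap_mem φ hx)
  exact this hx

/-- The morphism `Tot_TW(g^Δ) → Tot_TW(h^Δ)` of differential graded Lie algebras induced by a
morphism of semicosimplicial differential graded Lie algebras. -/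
def totMap : DGLA.Hom g.tot h.tot where
  toLinearMap := (piMap φ).restrict fun _ => piMap_mem_totSpace φ
  map_deg hx := piMap_mem φ hx
  map_d x := Subtype.ext (funext fun n =>
    (CDGA.tensorMap (CDGA.Hom.id (simplexForms K n)) (φ.app n)).map_d (x.1 n))
  map_bracket x y := Subtype.ext (funext fun n =>
    (CDGA.tensorMap (CDGA.Hom.id (simplexForms K n)) (φ.app n)).map_bracket (x.1 n) (y.1 n))

end SemicosimplicialDGLA

/-- The objects of the category `Art_K`: local Artinian `K`-algebras with residue field `K`. -/
structure ArtAlg (K : Type u) [Field K] where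
  carrier : Type w
  [commRing : CommRing carrier]
  [algebra : Algebra K carrier]
  [isLocalRing : IsLocalRing carrier]
  [isArtinianRing : IsArtinianRing carrier]
  residue : Function.Bijective (algebraMap K (IsLocalRing.ResidueField carrier))

attribute [instance] ArtAlg.commRing ArtAlg.algebra ArtAlg.isLocalRing ArtAlg.isArtinianRing

namespace ArtAlg

variable {K : Type u} [Field K]

/-- Morphisms in `Art_K` are homomorphisms of `K`-algebras (they are automatically local). -/
instance : Category (ArtAlg.{u, w} K) where
  Hom A B := A.carrier →ₐ[K] B.carrier
  id A := AlgHom.id K A.carrier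
  comp f g := AlgHom.comp g f

/-- The maximal ideal `m_A`. -/
abbrev max (A : ArtAlg.{u, w} K) : Ideal A.carrier := IsLocalRing.maximalIdeal A.carrier

theorem exists_max_pow (A : ArtAlg.{u, w} K) : ∃ N, A.max ^ N = ⊥ := by
  have h := IsArtinianRing.isNilpotent_jacobson_bot (R := A.carrier)
  rw [IsLocalRing.jacobson_eq_maximalIdeal ⊥ bot_ne_top] at h
  exact h

theorem map_mem_max {A B : ArtAlg.{u, w} K} (f : A.carrier →ₐ[K] B.carrier) {x : A.carrier}
    (hx : x ∈ A.max) : f x ∈ B.max := by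
  obtain ⟨N, hN⟩ := A.exists_max_pow
  have h : x ^ N = 0 := by
    have h := Ideal.pow_mem_pow hx N
    rwa [hN] at h
  rw [IsLocalRing.mem_maximalIdeal, mem_nonunits_iff]
  intro hu
  have h' : (f x) ^ N = 0 := by rw [← map_pow, h, map_zero]
  have := hu.pow N
  rw [h'] at this
  exact not_isUnit_zero this

/-- The map `m_A → m_B` induced by a morphism `A → B`. -/
def maxMap {A B : ArtAlg.{u, w} K} (f : A ⟶ B) : A.max →ₗ[K] B.max where
  toFun x := ⟨(show A.carrier →ₐ[K] B.carrier from f) x, map_mem_max _ x.2⟩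
  map_add' _ _ := Subtype.ext (map_add (show A.carrier →ₐ[K] B.carrier from f) _ _)
  map_smul' _ _ := Subtype.ext (map_smul (show A.carrier →ₐ[K] B.carrier from f) _ _)

/-- The multiplication `m_A × m_A → m_A`. -/
def maxMul (A : ArtAlg.{u, w} K) : A.max →ₗ[K] A.max →ₗ[K] A.max :=
  LinearMap.mk₂ K (fun x y => ⟨x * y, A.max.mul_mem_left _ y.2⟩)
    (fun _ _ _ => Subtype.ext (add_mul _ _ _)) (fun _ _ _ => Subtype.ext (smul_mul_assoc _ _ _))
    (fun _ _ _ => Subtype.ext (mul_add _ _ _)) (fun _ _ _ => Subtype.ext (mul_smul_comm _ _ _))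

theorem maxMap_maxMul {A B : ArtAlg.{u, w} K} (f : A ⟶ B) (x y : A.max) :
    maxMap f (A.maxMul x y) = B.maxMul (maxMap f x) (maxMap f y) :=
  Subtype.ext (map_mul (show A.carrier →ₐ[K] B.carrier from f) _ _)

end ArtAlg

namespace DGLA

variable {K : Type u} [Field K] (L : DGLA.{u, v} K) (A : ArtAlg.{u, w} K)

/-- The space `L ⊗ m_A`. -/
abbrev Nil : Type (max v w) := L.carrier ⊗[K] A.max

/-- The subspace `L^i ⊗ m_A` of `L ⊗ m_A`. -/
def nilDeg (i : ℤ) : Submodule K (L.Nil A) :=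
  LinearMap.range (TensorProduct.map (L.deg i).subtype (LinearMap.id : A.max →ₗ[K] A.max))

/-- The differential of `L ⊗ m_A`. -/
def nilD : L.Nil A →ₗ[K] L.Nil A := TensorProduct.map L.d LinearMap.id

/-- The bracket of `L ⊗ m_A`, `[x ⊗ a, y ⊗ b] = [x, y] ⊗ ab`. -/
def nilBracket : L.Nil A →ₗ[K] L.Nil A →ₗ[K] L.Nil A := TensorProduct.map₂ L.bracket A.maxMul

/-- The set `MC_L(A)` of Maurer-Cartan elements: those `x ∈ L^1 ⊗ m_A` with
`dx + 1/2 [x, x] = 0`. -/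
def MC : Set (L.Nil A) :=
  {x | x ∈ L.nilDeg A 1 ∧ L.nilD A x + (2 : K)⁻¹ • L.nilBracket A x x = 0}

/-- The gauge action `e^a * x = x + ∑_{n ≥ 0} (ad a)^n / (n + 1)! ([a, x] - da)`. The sum is finite,
see `finite_support_gauge`. -/
def gauge (a x : L.Nil A) : L.Nil A :=
  x + ∑ᶠ n : ℕ, ((n + 1).factorial : K)⁻¹ •
    ((L.nilBracket A a) ^ n) (L.nilBracket A a x - L.nilD A a)

/-- Gauge equivalence of Maurer-Cartan elements: `y = e^a * x` for some `a ∈ L^0 ⊗ m_A`. -/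
def GaugeEquiv (x y : L.MC A) : Prop := ∃ a ∈ L.nilDeg A 0, y.1 = L.gauge A a x.1

/-- The span of the elements `x ⊗ c` with `c ∈ m_A ^ N`. -/
def nilFil (N : ℕ) : Submodule K (L.Nil A) :=
  Submodule.span K {z | ∃ (x : L.carrier) (c : A.max), (c : A.carrier) ∈ A.max ^ N ∧ z = x ⊗ₜ c}

theorem nilBracket_mem_nilFil {N : ℕ} (a : L.Nil A) {z : L.Nil A} (hz : z ∈ L.nilFil A N) :
    L.nilBracket A a z ∈ L.nilFil A (N + 1) := by
  induction hz using Submodule.span_induction with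
  | zero => simp
  | add a b _ _ ha hb => rw [map_add]; exact Submodule.add_mem _ ha hb
  | smul c a _ ha => rw [map_smul]; exact Submodule.smul_mem _ _ ha
  | mem z hz =>
    obtain ⟨x, c, hc, rfl⟩ := hz
    induction a using TensorProduct.induction_on with
    | zero => simp
    | add a b ha hb => rw [map_add, LinearMap.add_apply]; exact Submodule.add_mem _ ha hb
    | tmul y b =>
      refine Submodule.subset_span ⟨L.bracket y x, A.maxMul b c, ?_, rfl⟩
      rw [pow_succ']
      exact Ideal.mul_mem_mul b.2 hc

theorem finite_support_gauge (a z : L.Nil A) :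
    (Function.support fun n : ℕ => ((n + 1).factorial : K)⁻¹ •
      ((L.nilBracket A a) ^ n) z).Finite := by
  obtain ⟨N, hN⟩ := A.exists_max_pow
  have h0 : z ∈ L.nilFil A 0 := by
    induction z using TensorProduct.induction_on with
    | zero => simp
    | add a b ha hb => exact Submodule.add_mem _ ha hb
    | tmul y b => exact Submodule.subset_span ⟨y, b, by simp, rfl⟩
  have h1 : ∀ n, ((L.nilBracket A a) ^ n) z ∈ L.nilFil A n := by
    intro n
    induction n with
    | zero => exact h0
    | succ n ih =>
      rw [pow_succ']
      exact L.nilBracket_mem_nilFil A a ih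
  have h2 : ∀ n, N ≤ n → L.nilFil A n = ⊥ := by
    intro n hn
    rw [nilFil, Submodule.span_eq_bot]
    rintro _ ⟨x, c, hc, rfl⟩
    have hc' := Ideal.pow_le_pow_right hn hc
    rw [hN] at hc'
    have : c = 0 := Subtype.ext hc'
    rw [this, TensorProduct.tmul_zero]
  refine (Set.finite_lt_nat N).subset fun n hn => ?_
  by_contra hlt
  have h3 := h1 n
  rw [h2 n (not_lt.1 hlt), Submodule.mem_bot] at h3
  exact hn (by simp only [h3, smul_zero])

section Map

variable {L A} {M : DGLA.{u, v} K} {B : ArtAlg.{u, w} K} (f : Hom L M) (α : A ⟶ B)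

/-- The map `L ⊗ m_A → M ⊗ m_B` induced by a morphism `L → M` and a morphism `A → B`. -/
def nilMap : L.Nil A →ₗ[K] M.Nil B := TensorProduct.map f.toLinearMap (ArtAlg.maxMap α)

theorem nilMap_nilD (x : L.Nil A) : nilMap f α (L.nilD A x) = M.nilD B (nilMap f α x) := by
  induction x using TensorProduct.induction_on with
  | zero => simp
  | add a b ha hb => simp only [map_add, ha, hb]
  | tmul y b => simp [nilMap, nilD, f.map_d]

theorem nilMap_nilBracket (x y : L.Nil A) :
    nilMap f α (L.nilBracket A x y) = M.nilBracket B (nilMap f α x) (nilMap f α y) := by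
  induction x using TensorProduct.induction_on with
  | zero => simp
  | add a b ha hb => simp only [map_add, LinearMap.add_apply, ha, hb]
  | tmul x a =>
    induction y using TensorProduct.induction_on with
    | zero => simp
    | add a b ha hb => simp only [map_add, ha, hb]
    | tmul y b => simp [nilMap, nilBracket, f.map_bracket, ArtAlg.maxMap_maxMul]

theorem nilMap_mem {i : ℤ} {x : L.Nil A} (hx : x ∈ L.nilDeg A i) :
    nilMap f α x ∈ M.nilDeg B i := by
  obtain ⟨y, rfl⟩ := hx
  induction y using TensorProduct.induction_on with
  | zero => simp
  | add a b ha hb => simp only [map_add]; exact Submodule.add_mem _ ha hb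
  | tmul y b => exact ⟨⟨f.toLinearMap y, f.map_deg y.2⟩ ⊗ₜ ArtAlg.maxMap α b, rfl⟩

theorem nilMap_gauge (a x : L.Nil A) :
    nilMap f α (L.gauge A a x) = M.gauge B (nilMap f α a) (nilMap f α x) := by
  have h : ∀ (n : ℕ) (z : L.Nil A), nilMap f α (((L.nilBracket A a) ^ n) z) =
      ((M.nilBracket B (nilMap f α a)) ^ n) (nilMap f α z) := by
    intro n
    induction n with
    | zero => intro z; rfl
    | succ n ih =>
      intro z
      rw [pow_succ, pow_succ, Module.End.mul_apply, Module.End.mul_apply, ih, nilMap_nilBracket]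
  rw [gauge, map_add, map_finsum _ (L.finite_support_gauge A a _), gauge]
  simp only [map_smul, h, map_sub, nilMap_nilBracket, nilMap_nilD]

/-- The map `MC_L(A) → MC_M(B)` induced by a morphism `L → M` and a morphism `A → B`. -/
def mcMap (x : L.MC A) : M.MC B :=
  ⟨nilMap f α x.1, nilMap_mem f α x.2.1, by
    rw [← nilMap_nilD, ← nilMap_nilBracket, ← map_smul, ← map_add, x.2.2, map_zero]⟩

/-- The map `MC_L(A) / gauge → MC_M(B) / gauge` induced by a morphism `L → M` and a morphism
`A → B`. -/
def defMap : Quot (L.GaugeEquiv A) → Quot (M.GaugeEquiv B) :=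
  Quot.map (mcMap f α) (by
    rintro x y ⟨a, ha, h⟩
    exact ⟨nilMap f α a, nilMap_mem f α ha, by
      change nilMap f α y.1 = M.gauge B (nilMap f α a) (nilMap f α x.1)
      rw [h, nilMap_gauge]⟩)

end Map

/-- The deformation functor `Def_L : Art_K → Set`, `Def_L(A) = MC_L(A) / gauge`. -/
def Def : ArtAlg.{u, w} K ⥤ Type (max v w) where
  obj A := Quot (L.GaugeEquiv A)
  map α := ↾(defMap (Hom.id L) α)
  map_id A := by
    ext x
    induction x using Quot.ind with
    | mk x =>
      refine congrArg (Quot.mk _) (Subtype.ext ?_)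
      exact LinearMap.congr_fun (TensorProduct.map_id (R := K) (M := L.carrier) (N := A.max)) x.1
  map_comp {A B C} α β := by
    ext x
    induction x using Quot.ind with
    | mk x =>
      refine congrArg (Quot.mk _) (Subtype.ext ?_)
      exact LinearMap.congr_fun (TensorProduct.map_comp (R := K) (LinearMap.id)
        (ArtAlg.maxMap β) (LinearMap.id) (ArtAlg.maxMap α)) x.1

/-- The natural transformation `Def_L → Def_M` induced by a morphism `L → M`. -/
def Hom.onDef {L M : DGLA.{u, v} K} (f : Hom L M) : Def.{u, v, w} L ⟶ Def.{u, v, w} M where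
  app A := ↾(defMap f (𝟙 A))
  naturality {A B} α := by
    ext x
    induction x using Quot.ind with
    | mk x =>
      refine congrArg (Quot.mk _) (Subtype.ext ?_)
      change nilMap f (𝟙 B) (nilMap (Hom.id L) α x.1) = nilMap (Hom.id M) α (nilMap f (𝟙 A) x.1)
      generalize x.1 = z
      induction z using TensorProduct.induction_on with
      | zero => simp
      | add a b ha hb => simp only [map_add, ha, hb]
      | tmul y b => rfl

end DGLA

end

/-! Write f for the morphism of totalizations induced by `toTrunc`. Two facts about f suffice: it is
surjective in every degree, and its kernel is acyclic in degrees 1 and 2. By `isIso_onDef`, any DGLA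
morphism with these properties induces an isomorphism of deformation functors.

Both facts about f are proved one simplicial level at a time. A compatible family of forms on the
faces of a simplex of dimension at least 2 extends to the simplex (`exists_rTensor_formFace_eq`),
and the semicosimplicial identities make the cofaces of an element already built into such a family
(`exists_face_eq_cofaceForm`). Hence a sequence prescribed at levels 0, 1, 2 continues to all
levels, which gives surjectivity.

A cocycle of degree at most 2 in the kernel vanishes at levels 0, 1, 2. At a level n ≥ 3, after
subtracting the differential of a filling of the primitive found so far, one is left with a closed
form on the n-simplex that vanishes on the boundary and has total degree less than n. Relative forms
with coefficients in L have cohomology H^{i-n}(L) in degree i, so the vanishing of negative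
cohomology should provide a primitive which again vanishes on the boundary. This is
`exists_primitive`, proved by induction on n. The homotopy contracting the simplex to its vertex 0
gives a primitive vanishing on every face through that vertex; its restriction to the opposite face
is a relative cocycle one dimension lower. The homotopy is contraction with the Euler vector field
divided by weight, the weights being eigenvalues of the Lie derivative.

The deformation-theoretic half is obstruction theory along the powers of the maximal ideal.
Acyclicity in degree 2 and the Bianchi identity allow a lift of a Maurer-Cartan element to be
corrected until its curvature vanishes (`exists_mem_MC_nilMap_eq`). Acyclicity in degree 1 allows
two Maurer-Cartan elements with the same image to be joined by gauge transformations
(`mk_eq_mk_of_nilMap_eq`), and surjectivity in degree 0 lifts gauge transformations. Nilpotency of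
the ideal ends both processes. -/

noncomputable section

/-! ### Pullback of polynomial forms along vertex maps, and extension from a face. -/

namespace SimplexForms

section Pullback

variable (K : Type u) [Field K] {l m n : ℕ}

theorem sum_funMk_X (n : ℕ) : ∑ i, funMk K n (MvPolynomial.X i) = 1 := by
  have h0 : funMk K n (∑ i, MvPolynomial.X i - 1) = 0 :=
    Ideal.Quotient.eq_zero_iff_mem.2 (Ideal.mem_span_singleton_self _)
  rwa [map_sub, map_one, map_sum, sub_eq_zero] at h0

theorem funHom_ext {B : Type*} [Semiring B] [Algebra K B] {f g : Fun K n →ₐ[K] B}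
    (h : ∀ i, f (funMk K n (MvPolynomial.X i)) = g (funMk K n (MvPolynomial.X i))) : f = g := by
  have : f.comp (funMk K n) = g.comp (funMk K n) := MvPolynomial.algHom_ext fun i => h i
  ext x
  obtain ⟨p, rfl⟩ := funMk_surjective K n x
  exact DFunLike.congr_fun this p

/-- The algebra map `t_i ↦ c_i` out of the functions on the simplex, for a family with
`∑ c_i = 1`. -/
def funLift {B : Type*} [CommRing B] [Algebra K B] (c : Fin (n + 1) → B) (hc : ∑ i, c i = 1) :
    Fun K n →ₐ[K] B :=
  Ideal.Quotient.liftₐ _ (MvPolynomial.aeval c) (by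
    intro f hf
    obtain ⟨g, rfl⟩ := Ideal.mem_span_singleton'.1 hf
    simp [hc])

theorem funLift_X {B : Type*} [CommRing B] [Algebra K B] (c : Fin (n + 1) → B)
    (hc : ∑ i, c i = 1) (i : Fin (n + 1)) :
    funLift K c hc (funMk K n (MvPolynomial.X i)) = c i :=
  MvPolynomial.aeval_X c i

/-- Pullback of functions along the affine map of simplices given by a map of vertices. -/
def funPull (φ : Fin (m + 1) → Fin (n + 1)) : Fun K n →ₐ[K] Fun K m :=
  funLift K (fun i => ∑ a, if φ a = i then funMk K m (MvPolynomial.X a) else 0) (by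
    rw [Finset.sum_comm]
    simp [sum_funMk_X])

theorem funPull_X (φ : Fin (m + 1) → Fin (n + 1)) (i : Fin (n + 1)) :
    funPull K φ (funMk K n (MvPolynomial.X i)) =
      ∑ a, if φ a = i then funMk K m (MvPolynomial.X a) else 0 :=
  funLift_X K _ _ i

theorem funPull_comp (ψ : Fin (l + 1) → Fin (m + 1)) (φ : Fin (m + 1) → Fin (n + 1)) :
    (funPull K ψ).comp (funPull K φ) = funPull K (φ ∘ ψ) := by
  refine funHom_ext K fun i => ?_
  rw [AlgHom.comp_apply, funPull_X, funPull_X, map_sum]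
  simp only [apply_ite, map_zero, funPull_X]
  have : ∀ a, (if φ a = i then ∑ b, (if ψ b = a then funMk K l (MvPolynomial.X b) else 0) else 0) =
      ∑ b, if ψ b = a then (if φ a = i then funMk K l (MvPolynomial.X b) else 0) else 0 := by
    intro a
    split_ifs <;> simp
  simp only [this]
  rw [Finset.sum_comm]
  simp

/-- Identities between faces and retractions thereby reduce to identities between maps of vertices.
-/
theorem funPull_succAbove (k : Fin (n + 2)) : funPull K k.succAbove = funFace K n k := by
  refine funHom_ext K fun i => ?_
  rw [funPull_X]
  induction i using Fin.succAboveCases k with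
  | x => simp [funFace_X_self, Fin.succAbove_ne]
  | p j => simp [funFace_X_succAbove]

theorem funPull_id : funPull K (id : Fin (n + 1) → Fin (n + 1)) = AlgHom.id K _ := by
  refine funHom_ext K fun i => ?_
  simp [funPull_X]

/-- Pullback of the `dt_i` along the affine map of simplices given by a map of vertices. -/
def cotPull (φ : Fin (m + 1) → Fin (n + 1)) : Cot K n →ₗ[K] Cot K m :=
  Submodule.mapQ _ _ (LinearMap.funLeft K K φ) (by
    rw [Submodule.span_singleton_le_iff_mem]
    exact Submodule.mem_span_singleton_self (1 : Fin (m + 1) → K))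

theorem cotMk_surjective (n : ℕ) : Function.Surjective (cotMk K n) :=
  Submodule.mkQ_surjective _

theorem cotPull_comp (ψ : Fin (l + 1) → Fin (m + 1)) (φ : Fin (m + 1) → Fin (n + 1)) :
    cotPull K ψ ∘ₗ cotPull K φ = cotPull K (φ ∘ ψ) := by
  ext x
  obtain ⟨x, rfl⟩ := cotMk_surjective K n x
  rfl

theorem cotPull_succAbove (k : Fin (n + 2)) : cotPull K k.succAbove = cotFace K n k := rfl

theorem cotPull_id : cotPull K (id : Fin (n + 1) → Fin (n + 1)) = LinearMap.id := by
  ext x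
  obtain ⟨x, rfl⟩ := cotMk_surjective K n x
  rfl

/-- Pullback of forms along the affine map of simplices given by a map of vertices. -/
def formPull (φ : Fin (m + 1) → Fin (n + 1)) : Form K n →ₐ[K] Form K m :=
  Algebra.TensorProduct.map (funPull K φ) (ExteriorAlgebra.map (cotPull K φ))

theorem formPull_formPull (ψ : Fin (l + 1) → Fin (m + 1)) (φ : Fin (m + 1) → Fin (n + 1))
    (z : Form K n) : formPull K ψ (formPull K φ z) = formPull K (φ ∘ ψ) z := by
  rw [formPull, formPull, formPull, ← funPull_comp, ← cotPull_comp, ← ExteriorAlgebra.map_comp_map,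
    Algebra.TensorProduct.map_comp]
  rfl

theorem formPull_succAbove (k : Fin (n + 2)) : formPull K k.succAbove = formFace K n k := by
  rw [formPull, funPull_succAbove, cotPull_succAbove, formFace]

theorem formPull_id : formPull K (id : Fin (n + 1) → Fin (n + 1)) = AlgHom.id K _ := by
  rw [formPull, funPull_id, cotPull_id, ExteriorAlgebra.map_id, Algebra.TensorProduct.map_id]

theorem extMap_mem {V : Type v} [AddCommGroup V] [Module K V] {W : Type v'} [AddCommGroup W]
    [Module K W] (f : V →ₗ[K] W) {i : ℕ} {l : ExteriorAlgebra K V} (hl : l ∈ ⋀[K]^i V) :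
    ExteriorAlgebra.map f l ∈ ⋀[K]^i W := by
  induction hl using Submodule.pow_induction_on_left' with
  | algebraMap r =>
    rw [AlgHom.commutes]; exact SetLike.algebraMap_mem_graded (fun i : ℕ => ⋀[K]^i W) r
  | add a b i ha hb iha ihb => rw [map_add]; exact Submodule.add_mem _ iha ihb
  | mem_mul m hm i a ha ih =>
    obtain ⟨y, rfl⟩ := hm
    rw [map_mul, ExteriorAlgebra.map_apply_ι]
    have h := Submodule.mul_mem_mul (LinearMap.mem_range_self (ExteriorAlgebra.ι K) (f y)) ih
    rwa [← pow_succ'] at h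

theorem formPull_mem (φ : Fin (m + 1) → Fin (n + 1)) {i : ℕ} {x : Form K n}
    (hx : x ∈ deg K n i) : formPull K φ x ∈ deg K m i := by
  have : deg K n i ≤ (deg K m i).comap (formPull K φ).toLinearMap := by
    rw [deg, Submodule.span_le]
    rintro _ ⟨f, l, hl, rfl⟩
    obtain ⟨g, hg⟩ := funMk_surjective K m (funPull K φ (funMk K n f))
    simp only [Submodule.comap_coe, Set.mem_preimage, SetLike.mem_coe, formPull,
      AlgHom.toLinearMap_apply, Algebra.TensorProduct.map_tmul, ← hg]
    exact tmul_mem_deg K m _ (extMap_mem K _ hl)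
  exact this hx

/-- The coordinate function `t_i` as a form. -/
def coord (n : ℕ) (i : Fin (n + 1)) : Form K n := funMk K n (MvPolynomial.X i) ⊗ₜ 1

theorem sum_coord (n : ℕ) : ∑ i, coord K n i = 1 := by
  simp only [coord, ← TensorProduct.sum_tmul, sum_funMk_X]
  rfl

theorem coord_mem (i : Fin (n + 1)) : coord K n i ∈ deg K n 0 :=
  tmul_mem_deg K n _ (SetLike.one_mem_graded (fun i : ℕ => ⋀[K]^i (Cot K n)))

theorem formFace_coord_self (k : Fin (n + 2)) : formFace K n k (coord K (n + 1) k) = 0 := by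
  simp [formFace, coord, funFace_X_self]

theorem formFace_coord_succAbove (k : Fin (n + 2)) (j : Fin (n + 1)) :
    formFace K n k (coord K (n + 1) (k.succAbove j)) = coord K n j := by
  simp [formFace, coord, funFace_X_succAbove]

/-- Restricting first to the face `i` and then to its face `j` is restricting first to the face
`i.succAbove j` and then to its face `j.predAbove i`. -/
theorem formFace_formFace (i : Fin (n + 3)) (j : Fin (n + 2)) (z : Form K (n + 2)) :
    formFace K n j (formFace K (n + 1) i z) =
      formFace K n (j.predAbove i) (formFace K (n + 1) (i.succAbove j) z) := by
  simp only [← formPull_succAbove, formPull_formPull]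
  congr 2
  ext a
  simp [Fin.succAbove_succAbove_succAbove_predAbove]

/-- Extension of forms from the face `r` to the simplex, `v ↦ ∑_j t_j p_j^* v`, where `p_j` is the
retraction of the simplex onto its face `r` which sends the vertex `r` to the vertex `j`. -/
def extend (n : ℕ) (r : Fin (n + 2)) : Form K n →ₗ[K] Form K (n + 1) :=
  ∑ j, LinearMap.mulLeft K (coord K (n + 1) (r.succAbove j)) ∘ₗ
    (formPull K (r.insertNth (α := fun _ => Fin (n + 1)) j id)).toLinearMap

theorem extend_apply (r : Fin (n + 2)) (z : Form K n) :
    extend K n r z = ∑ j, coord K (n + 1) (r.succAbove j) *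
      formPull K (r.insertNth (α := fun _ => Fin (n + 1)) j id) z := by
  simp [extend]

theorem extend_mem (r : Fin (n + 2)) {i : ℕ} {z : Form K n} (hz : z ∈ deg K n i) :
    extend K n r z ∈ deg K (n + 1) i := by
  rw [extend_apply]
  refine Submodule.sum_mem _ fun j _ => ?_
  have := mul_mem K (n + 1) (coord_mem K (r.succAbove j))
    (formPull_mem K (r.insertNth (α := fun _ => Fin (n + 1)) j id) hz)
  rwa [zero_add] at this

/-- Every retraction p_j is the identity on the face r, so the restriction is ∑ t_j z, and the
coordinates sum to 1. -/
theorem formFace_extend_self (r : Fin (n + 2)) (z : Form K n) :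
    formFace K n r (extend K n r z) = z := by
  rw [extend_apply, map_sum]
  have : ∀ j, formFace K n r (coord K (n + 1) (r.succAbove j) *
      formPull K (r.insertNth (α := fun _ => Fin (n + 1)) j id) z) = coord K n j * z := by
    intro j
    rw [map_mul, formFace_coord_succAbove, ← formPull_succAbove, formPull_formPull]
    have : r.insertNth (α := fun _ => Fin (n + 1)) j id ∘ r.succAbove = id := by
      ext a; simp
    rw [this, formPull_id]
    rfl
  simp only [this, ← Finset.sum_mul, sum_coord, one_mul]

/-- On a face other than r the retractions restrict to those of the smaller simplex. In particular,
extending a form that vanishes on one of its faces creates nothing on the corresponding face of the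
big simplex. -/
theorem formFace_extend (r : Fin (n + 3)) (k : Fin (n + 2)) (z : Form K (n + 1)) :
    formFace K (n + 1) (r.succAbove k) (extend K (n + 1) r z) =
      extend K n (k.predAbove r) (formFace K n k z) := by
  -- The summand j = k, whose retraction does not preserve this face, disappears because its
  -- coordinate vanishes there.
  rw [extend_apply, extend_apply, map_sum, Fin.sum_univ_succAbove _ k, map_mul,
    formFace_coord_self, zero_mul, zero_add]
  refine Finset.sum_congr rfl fun j _ => ?_
  rw [map_mul, ← Fin.succAbove_succAbove_succAbove_predAbove, formFace_coord_succAbove]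
  congr 1
  rw [← formPull_succAbove, ← formPull_succAbove, formPull_formPull, formPull_formPull]
  congr 2
  ext a
  induction a using Fin.succAboveCases (k.predAbove r) with
  | x => simp [Fin.succAbove_succAbove_predAbove]
  | p b => simp [Fin.succAbove_succAbove_succAbove_predAbove]

end Pullback

/-! ### Forms with coefficients: filling a compatible family on the boundary. -/

section Tensor

variable (K : Type u) [Field K] (V : Type v) [AddCommGroup V] [Module K V] {n : ℕ}

theorem rTensor_formFace_formFace (i : Fin (n + 3)) (j : Fin (n + 2)) (z : Form K (n + 2) ⊗[K] V) :
    (formFace K n j).toLinearMap.rTensor V ((formFace K (n + 1) i).toLinearMap.rTensor V z) =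
      (formFace K n (j.predAbove i)).toLinearMap.rTensor V
        ((formFace K (n + 1) (i.succAbove j)).toLinearMap.rTensor V z) := by
  rw [← LinearMap.rTensor_comp_apply, ← LinearMap.rTensor_comp_apply]
  congr 2
  exact LinearMap.ext fun z => formFace_formFace K i j z

theorem rTensor_formFace_extend_self (r : Fin (n + 2)) (z : Form K n ⊗[K] V) :
    (formFace K n r).toLinearMap.rTensor V ((extend K n r).rTensor V z) = z := by
  rw [← LinearMap.rTensor_comp_apply]
  have : (formFace K n r).toLinearMap ∘ₗ extend K n r = LinearMap.id :=
    LinearMap.ext fun z => formFace_extend_self K r z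
  rw [this, LinearMap.rTensor_id_apply]

theorem rTensor_formFace_extend (r : Fin (n + 3)) (k : Fin (n + 2)) (z : Form K (n + 1) ⊗[K] V) :
    (formFace K (n + 1) (r.succAbove k)).toLinearMap.rTensor V
        ((extend K (n + 1) r).rTensor V z) =
      (extend K n (k.predAbove r)).rTensor V ((formFace K n k).toLinearMap.rTensor V z) := by
  rw [← LinearMap.rTensor_comp_apply, ← LinearMap.rTensor_comp_apply]
  congr 2
  exact LinearMap.ext fun z => formFace_extend K r k z

/-- The remaining case of `formFace_extend`: a point has no faces, but the only summand carries the
factor t_1, which vanishes on face 1. -/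
theorem rTensor_formFace_one_extend (z : Form K 0 ⊗[K] V) :
    (formFace K 0 1).toLinearMap.rTensor V ((extend K 0 0).rTensor V z) = 0 := by
  rw [← LinearMap.rTensor_comp_apply]
  have : (formFace K 0 1).toLinearMap ∘ₗ extend K 0 0 = 0 := by
    refine LinearMap.ext fun z => ?_
    rw [LinearMap.comp_apply, AlgHom.toLinearMap_apply, extend_apply, map_sum,
      Fin.sum_univ_one, map_mul, Fin.succAbove_zero]
    have : formFace K 0 1 (coord K 1 (Fin.succ 0)) = 0 := formFace_coord_self K 1
    rw [this, zero_mul, LinearMap.zero_apply]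
  rw [this, LinearMap.rTensor_zero, LinearMap.zero_apply]

/-- A compatible family of forms on the faces of a simplex of dimension at least `2` extends to the
simplex, within any system of subspaces preserved by the face maps and the extension operators. -/
theorem exists_rTensor_formFace_eq (S : Submodule K (Form K (n + 2) ⊗[K] V))
    (T : Submodule K (Form K (n + 1) ⊗[K] V))
    (hST : ∀ k, ∀ z ∈ S, (formFace K (n + 1) k).toLinearMap.rTensor V z ∈ T)
    (hTS : ∀ k, ∀ z ∈ T, (extend K (n + 1) k).rTensor V z ∈ S)
    (w : Fin (n + 3) → Form K (n + 1) ⊗[K] V) (hw : ∀ k, w k ∈ T)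
    (hc : ∀ (i : Fin (n + 3)) (j : Fin (n + 2)),
      (formFace K n j).toLinearMap.rTensor V (w i) =
        (formFace K n (j.predAbove i)).toLinearMap.rTensor V (w (i.succAbove j))) :
    ∃ z ∈ S, ∀ k, (formFace K (n + 1) k).toLinearMap.rTensor V z = w k := by
  -- The faces are prescribed one after another; r counts those already correct.
  suffices ∀ r : ℕ, r ≤ n + 3 → ∃ z ∈ S, ∀ k : Fin (n + 3), (k : ℕ) < r →
      (formFace K (n + 1) k).toLinearMap.rTensor V z = w k by
    obtain ⟨z, hz, h⟩ := this (n + 3) le_rfl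
    exact ⟨z, hz, fun k => h k k.2⟩
  intro r
  induction r with
  | zero => exact fun _ => ⟨0, S.zero_mem, fun k hk => absurd hk (Nat.not_lt_zero _)⟩
  | succ r ih =>
    intro hr
    obtain ⟨z, hz, h⟩ := ih (by omega)
    let R : Fin (n + 3) := ⟨r, hr⟩
    -- Add the extension of the error on face R. By compatibility the error vanishes where R meets
    -- an earlier face, so its extension leaves the earlier faces unchanged.
    refine ⟨z + (extend K (n + 1) R).rTensor V
      (w R - (formFace K (n + 1) R).toLinearMap.rTensor V z),
      S.add_mem hz (hTS _ _ (T.sub_mem (hw _) (hST _ _ hz))), fun k hk => ?_⟩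
    rcases eq_or_ne k R with rfl | hkR
    · rw [map_add, rTensor_formFace_extend_self, add_sub_cancel]
    · have hk' : (k : ℕ) < r := lt_of_le_of_ne (Nat.lt_succ_iff.1 hk) fun h => hkR (Fin.ext h)
      obtain ⟨j, rfl⟩ := Fin.exists_succAbove_eq hkR
      rw [map_add, rTensor_formFace_extend, map_sub, hc, rTensor_formFace_formFace, h _ hk',
        sub_self, map_zero, add_zero]

end Tensor

end SimplexForms

/-! ### Operators on internally graded spaces. -/

section Graded

variable {K : Type u} [Field K] {ι : Type} [DecidableEq ι] {M : Type v} [AddCommGroup M]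
  [Module K M] {deg : ι → Submodule K M}

theorem IsInternal.induction (h : DirectSum.IsInternal deg) {p : M → Prop} (hz : p 0)
    (ha : ∀ x y, p x → p y → p (x + y))
    (hm : ∀ i, ∀ x ∈ deg i, p x) (x : M) : p x := by
  have hx : x ∈ iSup deg := h.submodule_iSup_eq_top ▸ trivial
  induction hx using Submodule.iSup_induction' with
  | zero => exact hz
  | add a b _ _ h1 h2 => exact ha a b h1 h2
  | mem i x hx => exact hm i x hx

theorem IsInternal.linearMap_ext (h : DirectSum.IsInternal deg) {N : Type v'}
    [AddCommGroup N] [Module K N] {f g : M →ₗ[K] N}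
    (hfg : ∀ i, ∀ x ∈ deg i, f x = g x) : f = g :=
  LinearMap.ext fun x => IsInternal.induction h (p := fun x => f x = g x) (by simp)
    (fun x y hx hy => by rw [map_add, map_add, hx, hy]) hfg x

theorem gradedScale_single_mem (h : DirectSum.IsInternal deg) (i : ι) (x : M) :
    gradedScale h (Pi.single i (1 : K)) x ∈ deg i := by
  refine IsInternal.induction h (p := fun x => gradedScale h (Pi.single i (1 : K)) x ∈ deg i)
    (by simp) (fun x y hx hy => ?_) (fun j x hx => ?_) x
  · rw [map_add]; exact Submodule.add_mem _ hx hy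
  · rw [gradedScale_apply h _ hx]
    rcases eq_or_ne j i with rfl | hji
    · exact Submodule.smul_mem _ _ hx
    · simp [Pi.single_eq_of_ne hji]

/-- An endomorphism which commutes with the projections onto the homogeneous components preserves
these components. -/
theorem mem_of_commute_gradedScale (h : DirectSum.IsInternal deg) {f : M →ₗ[K] M}
    (hf : ∀ (c : ι → K) x, f (gradedScale h c x) = gradedScale h c (f x)) {i : ι} {x : M}
    (hx : x ∈ deg i) : f x ∈ deg i := by
  have h1 : gradedScale h (Pi.single i (1 : K)) x = x := by
    rw [gradedScale_apply h _ hx, Pi.single_eq_same, one_smul]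
  rw [← h1, hf]
  exact gradedScale_single_mem h i _

end Graded

/-! ### The Euler vector field at the vertex 0 and its Lie derivative. -/

namespace SimplexForms

section Contraction

variable (K : Type u) [Field K] (n : ℕ)

/-- The covector `dt_j ↦ δ_{ij} - δ_{0j}`. -/
def covec (i : Fin (n + 1)) : Module.Dual K (Cot K n) :=
  (Submodule.span K {(1 : Fin (n + 1) → K)}).liftQ
    (LinearMap.proj (R := K) (φ := fun _ : Fin (n + 1) => K) i - LinearMap.proj 0) (by
    rw [Submodule.span_singleton_le_iff_mem]
    simp)

theorem covec_mk (i : Fin (n + 1)) (x : Fin (n + 1) → K) : covec K n i (cotMk K n x) = x i - x 0 :=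
  rfl

/-- The terms with x_0 contribute a multiple of ∑ dt_i = 0, so the redundant generators dt_i may be
used as if they were a basis. -/
theorem sum_covec_smul (y : Cot K n) :
    ∑ i, covec K n i y • cotMk K n (Pi.single i 1) = y := by
  obtain ⟨x, rfl⟩ := cotMk_surjective K n y
  have h1 : ∑ i : Fin (n + 1), (Pi.single i (1 : K) : Fin (n + 1) → K) = 1 :=
    Finset.univ_sum_single (1 : Fin (n + 1) → K)
  have h' : cotMk K n 1 = 0 :=
    (Submodule.Quotient.mk_eq_zero _).2 (Submodule.mem_span_singleton_self _)
  have h2 : ∑ i, x i • (Pi.single i (1 : K) : Fin (n + 1) → K) = x := by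
    conv_rhs => rw [← Finset.univ_sum_single x]
    refine Finset.sum_congr rfl fun i _ => ?_
    rw [← Pi.single_smul, smul_eq_mul, mul_one]
  simp only [covec_mk, sub_smul, Finset.sum_sub_distrib, ← map_smul, ← map_sum, h2]
  rw [← Finset.smul_sum, h1, map_sub, map_smul, h', smul_zero, sub_zero]

/-- Contraction of the exterior algebra with a covector. -/
def contract {V : Type v} [AddCommGroup V] [Module K V] (ξ : Module.Dual K V) :
    ExteriorAlgebra K V →ₗ[K] ExteriorAlgebra K V :=
  CliffordAlgebra.contractLeft (Q := (0 : QuadraticForm K V)) ξ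

section

variable {K} {V : Type v} [AddCommGroup V] [Module K V] (ξ : Module.Dual K V)

theorem contract_ι_mul (y : V) (l : ExteriorAlgebra K V) :
    contract K ξ (ExteriorAlgebra.ι K y * l) = ξ y • l - ExteriorAlgebra.ι K y * contract K ξ l :=
  CliffordAlgebra.contractLeft_ι_mul _ _ _

theorem contract_algebraMap (r : K) : contract K ξ (algebraMap K _ r) = 0 :=
  CliffordAlgebra.contractLeft_algebraMap _ _ r

theorem contract_eq_zero {l : ExteriorAlgebra K V} (hl : l ∈ ⋀[K]^0 V) : contract K ξ l = 0 := by
  change l ∈ LinearMap.range (ExteriorAlgebra.ι K) ^ 0 at hl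
  rw [pow_zero, Submodule.mem_one] at hl
  obtain ⟨r, rfl⟩ := hl
  exact contract_algebraMap ξ r

/-- The subtraction is truncated; for i = 0 the claim is harmless, the contraction being zero by
`contract_eq_zero`. -/
theorem contract_mem {i : ℕ} {l : ExteriorAlgebra K V} (hl : l ∈ ⋀[K]^i V) :
    contract K ξ l ∈ ⋀[K]^(i - 1) V := by
  induction hl using Submodule.pow_induction_on_left' with
  | algebraMap r => rw [contract_algebraMap]; exact Submodule.zero_mem _
  | add a b i ha hb iha ihb => rw [map_add]; exact Submodule.add_mem _ iha ihb
  | mem_mul m hm i a ha ih =>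
    obtain ⟨y, rfl⟩ := hm
    rw [contract_ι_mul]
    refine Submodule.sub_mem _ (Submodule.smul_mem _ _ ha) ?_
    rcases i with - | i
    · rw [contract_eq_zero ξ ha, mul_zero]; exact Submodule.zero_mem _
    · have h := Submodule.mul_mem_mul (LinearMap.mem_range_self (ExteriorAlgebra.ι K) y) ih
      rwa [← pow_succ'] at h

theorem extMap_contract {W : Type v'} [AddCommGroup W] [Module K W] (f : V →ₗ[K] W)
    (η : Module.Dual K W) (l : ExteriorAlgebra K V) :
    ExteriorAlgebra.map f (contract K (η ∘ₗ f) l) = contract K η (ExteriorAlgebra.map f l) := by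
  refine IsInternal.induction (DirectSum.Decomposition.isInternal (fun i : ℕ => ⋀[K]^i V))
    (p := fun l => ExteriorAlgebra.map f (contract K (η ∘ₗ f) l) =
      contract K η (ExteriorAlgebra.map f l)) (by simp)
    (fun x y hx hy => by simp only [map_add, hx, hy]) (fun i l hl => ?_) l
  induction hl using Submodule.pow_induction_on_left' with
  | algebraMap r => simp [contract_algebraMap]
  | add a b i ha hb iha ihb => simp only [map_add, iha, ihb]
  | mem_mul m hm i a ha ih =>
    obtain ⟨y, rfl⟩ := hm
    rw [contract_ι_mul, map_sub, map_mul, map_mul, ih, ExteriorAlgebra.map_apply_ι, contract_ι_mul,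
      map_smul]
    rfl

end

/-- The operator on the left counts factors: on a product y ∧ a, contracting y gives back y ∧ a by
`sum_covec_smul`, while moving dt_j past y cancels the sign of the contraction and leaves the count
for a. -/
theorem sum_dt_mul_contract {i : ℕ} {l : ExteriorAlgebra K (Cot K n)}
    (hl : l ∈ ⋀[K]^i (Cot K n)) :
    ∑ j, dt K n j * contract K (covec K n j) l = (i : K) • l := by
  induction hl using Submodule.pow_induction_on_left' with
  | algebraMap r => simp [contract_algebraMap]
  | add a b i ha hb iha ihb =>
    simp only [map_add, mul_add, Finset.sum_add_distrib, iha, ihb, smul_add]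
  | mem_mul m hm i a ha ih =>
    obtain ⟨y, rfl⟩ := hm
    have h1 : ∑ j, dt K n j * (covec K n j y • a) = ExteriorAlgebra.ι K y * a := by
      conv_rhs => rw [← sum_covec_smul K n y, map_sum, Finset.sum_mul]
      refine Finset.sum_congr rfl fun j _ => ?_
      rw [map_smul, mul_smul_comm, smul_mul_assoc, dt]
    have h2 : ∀ j, dt K n j * (ExteriorAlgebra.ι K y * contract K (covec K n j) a) =
        -(ExteriorAlgebra.ι K y * (dt K n j * contract K (covec K n j) a)) := by
      intro j
      have h := eq_neg_of_add_eq_zero_left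
        (ExteriorAlgebra.ι_add_mul_swap (R := K) (cotMk K n (Pi.single j 1)) y)
      rw [dt, ← mul_assoc, h, neg_mul, mul_assoc]
    simp only [contract_ι_mul, mul_sub, h2, sub_neg_eq_add]
    rw [Finset.sum_add_distrib, h1, ← Finset.mul_sum, ih, mul_smul_comm]
    push_cast
    rw [add_smul, one_smul, add_comm]

/-- Contraction of forms with the Euler vector field `∑ t_i (∂_i - ∂_0)` centred at the vertex
`0`. -/
def euler : Form K n →ₗ[K] Form K n :=
  ∑ i, TensorProduct.map (LinearMap.mulLeft K (funMk K n (MvPolynomial.X i)))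
    (contract K (covec K n i))

theorem euler_tmul (p : Fun K n) (l : ExteriorAlgebra K (Cot K n)) :
    euler K n (p ⊗ₜ l) =
      ∑ i, (funMk K n (MvPolynomial.X i) * p) ⊗ₜ[K] contract K (covec K n i) l := by
  simp [euler]

theorem euler_eq_zero {z : Form K n} (hz : z ∈ deg K n 0) : euler K n z = 0 := by
  have : deg K n 0 ≤ LinearMap.ker (euler K n) := by
    rw [deg, Submodule.span_le]
    rintro _ ⟨f, l, hl, rfl⟩
    simp [euler_tmul, contract_eq_zero _ hl]
  exact this hz

theorem euler_mem {i : ℕ} {z : Form K n} (hz : z ∈ deg K n i) : euler K n z ∈ deg K n (i - 1) := by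
  have : deg K n i ≤ (deg K n (i - 1)).comap (euler K n) := by
    rw [deg, Submodule.span_le]
    rintro _ ⟨f, l, hl, rfl⟩
    simp only [Submodule.comap_coe, Set.mem_preimage, SetLike.mem_coe, euler_tmul, ← map_mul]
    exact Submodule.sum_mem _ fun k _ => tmul_mem_deg K n _ (contract_mem _ hl)
  exact this hz

/-- Only the faces `k.succ` occur because they contain the centre of the vector field: the field is
tangent to them, its component along t_{k+1} vanishing there. The face opposite to the vertex 0 is
not preserved. -/
theorem formFace_euler (k : Fin (n + 1)) (z : Form K (n + 1)) :
    formFace K n k.succ (euler K (n + 1) z) = euler K n (formFace K n k.succ z) := by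
  induction z using TensorProduct.induction_on with
  | zero => simp
  | add a b ha hb => simp only [map_add, ha, hb]
  | tmul p l =>
    have h : ∀ j, covec K (n + 1) (k.succ.succAbove j) = covec K n j ∘ₗ cotFace K n k.succ := by
      intro j
      refine LinearMap.ext fun y => ?_
      obtain ⟨x, rfl⟩ := cotMk_surjective K (n + 1) y
      rw [LinearMap.comp_apply, cotFace_mk, covec_mk, covec_mk]
      simp [LinearMap.funLeft_apply]
    rw [euler_tmul, Fin.sum_univ_succAbove _ k.succ]
    simp only [map_add, map_sum, formFace, Algebra.TensorProduct.map_tmul, map_mul, funFace_X_self,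
      zero_mul, TensorProduct.zero_tmul, zero_add, funFace_X_succAbove, euler_tmul, h,
      extMap_contract]

/-- The Lie derivative along the Euler vector field. -/
def lie : Form K n →ₗ[K] Form K n := d K n ∘ₗ euler K n + euler K n ∘ₗ d K n

theorem lie_apply (z : Form K n) : lie K n z = d K n (euler K n z) + euler K n (d K n z) := rfl

theorem lie_d (z : Form K n) : lie K n (d K n z) = d K n (lie K n z) := by
  simp [lie_apply, d_comp_d]

theorem formFace_lie (k : Fin (n + 1)) (z : Form K (n + 1)) :
    formFace K n k.succ (lie K (n + 1) z) = lie K n (formFace K n k.succ z) := by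
  rw [lie_apply, lie_apply, map_add, formFace_d, formFace_euler, formFace_euler, formFace_d]

theorem lie_mem {i : ℕ} {z : Form K n} (hz : z ∈ deg K n i) : lie K n z ∈ deg K n i := by
  have h1 := euler_mem K n (d_mem K n hz)
  rw [add_tsub_cancel_right] at h1
  rw [lie_apply]
  refine Submodule.add_mem _ ?_ h1
  rcases i with - | i
  · rw [euler_eq_zero K n hz, map_zero]; exact Submodule.zero_mem _
  · have h2 := euler_mem K n hz
    rw [add_tsub_cancel_right] at h2
    exact d_mem K n h2

/-- In Cartan's formula the mixed terms dt_j ∧ ι_i occur in both composites with opposite signs.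
What survives is the derivative of the coefficient along the field, plus the counting operator on
the exterior part. -/
theorem lie_tmul (f : MvPolynomial (Fin (n + 1)) K) (l : ExteriorAlgebra K (Cot K n)) :
    lie K n (funMk K n f ⊗ₜ l) =
      (∑ i, ∑ j, covec K n i (cotMk K n (Pi.single j 1)) •
        (funMk K n (MvPolynomial.X i * MvPolynomial.pderiv j f) ⊗ₜ[K] l)) +
      funMk K n f ⊗ₜ ∑ i, dt K n i * contract K (covec K n i) l := by
  have h1 : d K n (euler K n (funMk K n f ⊗ₜ l)) =
      funMk K n f ⊗ₜ[K] ∑ i, dt K n i * contract K (covec K n i) l +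
      ∑ i, ∑ j, funMk K n (MvPolynomial.X i * MvPolynomial.pderiv j f) ⊗ₜ[K]
        (dt K n j * contract K (covec K n i) l) := by
    simp only [euler_tmul, ← map_mul, map_sum, d_tmul, TensorProduct.tmul_sum]
    rw [← Finset.sum_add_distrib]
    refine Finset.sum_congr rfl fun i _ => ?_
    simp only [Derivation.leibniz, smul_eq_mul, map_add, TensorProduct.add_tmul,
      Finset.sum_add_distrib]
    rw [add_comm]
    congr 1
    rw [Finset.sum_eq_single i]
    · simp
    · intro j _ hj
      rw [MvPolynomial.pderiv_X_of_ne hj.symm]; simp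
    · simp
  have h2 : euler K n (d K n (funMk K n f ⊗ₜ l)) =
      (∑ i, ∑ j, covec K n i (cotMk K n (Pi.single j 1)) •
        (funMk K n (MvPolynomial.X i * MvPolynomial.pderiv j f) ⊗ₜ[K] l)) -
      ∑ i, ∑ j, funMk K n (MvPolynomial.X i * MvPolynomial.pderiv j f) ⊗ₜ[K]
        (dt K n j * contract K (covec K n i) l) := by
    simp only [d_tmul, map_sum, euler_tmul, ← map_mul]
    rw [Finset.sum_comm, ← Finset.sum_sub_distrib]
    refine Finset.sum_congr rfl fun i _ => ?_
    rw [← Finset.sum_sub_distrib]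
    refine Finset.sum_congr rfl fun j _ => ?_
    rw [dt, contract_ι_mul, TensorProduct.tmul_sub, TensorProduct.tmul_smul]
  rw [lie_apply, h1, h2]
  abel

/-- Multiplication by `t_i - δ_{i0}` raises the weight by `1`. -/
theorem lie_coord_mul (i : Fin (n + 1)) (z : Form K n) :
    lie K n ((coord K n i - if i = 0 then 1 else 0) * z) =
      (coord K n i - if i = 0 then 1 else 0) * (lie K n z + z) := by
  induction z using TensorProduct.induction_on with
  | zero => simp
  | add a b ha hb => simp only [mul_add, map_add] at *; rw [ha, hb]; abel
  | tmul p l =>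
    obtain ⟨f, rfl⟩ := funMk_surjective K n p
    have h1 : ((coord K n i - if i = 0 then 1 else 0) : Form K n) =
        funMk K n (MvPolynomial.X i - if i = 0 then 1 else 0) ⊗ₜ 1 := by
      rw [map_sub, TensorProduct.sub_tmul]
      congr 1
      split_ifs
      · rw [map_one]; rfl
      · simp
    have h2 : ∀ j, MvPolynomial.pderiv j ((MvPolynomial.X i - if i = 0 then 1 else 0) :
        MvPolynomial (Fin (n + 1)) K) = if i = j then 1 else 0 := by
      intro j
      rw [map_sub, MvPolynomial.pderiv_X, Pi.single_apply]
      simp [apply_ite (MvPolynomial.pderiv j)]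
    rw [h1, Algebra.TensorProduct.tmul_mul_tmul, one_mul, ← map_mul, lie_tmul, lie_tmul, mul_add,
      mul_add, Algebra.TensorProduct.tmul_mul_tmul, Algebra.TensorProduct.tmul_mul_tmul, one_mul,
      one_mul, ← map_mul]
    have h3 : ∑ a, ∑ b, covec K n a (cotMk K n (Pi.single b 1)) •
        (funMk K n (MvPolynomial.X a * MvPolynomial.pderiv b
          ((MvPolynomial.X i - if i = 0 then 1 else 0) * f)) ⊗ₜ[K] l) =
        funMk K n (MvPolynomial.X i - if i = 0 then 1 else 0) ⊗ₜ[K] 1 *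
          (∑ a, ∑ b, covec K n a (cotMk K n (Pi.single b 1)) •
            (funMk K n (MvPolynomial.X a * MvPolynomial.pderiv b f) ⊗ₜ[K] l)) +
        funMk K n ((MvPolynomial.X i - if i = 0 then 1 else 0) * f) ⊗ₜ[K] l := by
      -- The Euler field sends t_i to t_i - δ_{i0}: the pairing of the a-th covector with dt_i is
      -- δ_{ai} - δ_{0i}, and ∑ t_a = 1.
      have h4 : funMk K n ((MvPolynomial.X i - if i = 0 then 1 else 0) * f) ⊗ₜ[K] l =
          ∑ a, covec K n a (cotMk K n (Pi.single i 1)) •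
            (funMk K n (MvPolynomial.X a * f) ⊗ₜ[K] l) := by
        simp only [map_mul, map_sub, sub_mul, TensorProduct.sub_tmul, covec_mk, sub_smul,
          Finset.sum_sub_distrib, ← Finset.smul_sum, ← TensorProduct.sum_tmul,
          ← Finset.sum_mul, sum_funMk_X, one_mul]
        congr 1
        · rw [Finset.sum_eq_single i]
          · simp
          · intro a _ ha
            simp [Pi.single_eq_of_ne ha]
          · simp
        · rcases eq_or_ne i 0 with rfl | hi
          · simp
          · simp [hi]
      rw [h4, Finset.mul_sum, ← Finset.sum_add_distrib]
      refine Finset.sum_congr rfl fun a _ => ?_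
      rw [Finset.mul_sum]
      have h5 : ∀ b, covec K n a (cotMk K n (Pi.single b 1)) •
          (funMk K n (MvPolynomial.X a * MvPolynomial.pderiv b
            ((MvPolynomial.X i - if i = 0 then 1 else 0) * f)) ⊗ₜ[K] l) =
          funMk K n (MvPolynomial.X i - if i = 0 then 1 else 0) ⊗ₜ[K] 1 *
            (covec K n a (cotMk K n (Pi.single b 1)) •
            (funMk K n (MvPolynomial.X a * MvPolynomial.pderiv b f) ⊗ₜ[K] l)) +
          if i = b then covec K n a (cotMk K n (Pi.single i 1)) •
            (funMk K n (MvPolynomial.X a * f) ⊗ₜ[K] l) else 0 := by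
        intro b
        rw [mul_smul_comm, Algebra.TensorProduct.tmul_mul_tmul, one_mul, ← map_mul,
          Derivation.leibniz, h2, mul_add, map_add, TensorProduct.add_tmul, smul_add]
        congr 1
        · rw [smul_eq_mul, mul_left_comm]
        · split_ifs with hb
          · subst hb; simp
          · simp
      simp only [h5, Finset.sum_add_distrib]
      simp
    rw [h3]
    abel

end Contraction

end SimplexForms

/-! ### Weight decomposition and the contracting homotopy. -/

namespace SimplexForms

section Weight

variable (K : Type u) [Field K] (n : ℕ)

theorem one_mem_deg : (1 : Form K n) ∈ deg K n 0 := by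
  have h := tmul_mem_deg K n (i := 0) 1 (l := 1)
    (SetLike.one_mem_graded (fun i : ℕ => ⋀[K]^i (Cot K n)))
  rw [map_one] at h
  exact h

theorem d_one : d K n 1 = 0 := by
  have h := d_tmul K n 1 1
  rw [map_one] at h
  refine h.trans (Finset.sum_eq_zero fun i _ => ?_)
  simp

theorem lie_one : lie K n 1 = 0 := by
  rw [lie_apply, euler_eq_zero K n (one_mem_deg K n), d_one, map_zero, map_zero, add_zero]

/-- The forms of weight `w`: the eigenspaces of the Lie derivative along the Euler vector field for
`w > 0`, and the constants for `w = 0`. -/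
def weight : ℕ → Submodule K (Form K n)
  | 0 => Submodule.span K {1}
  | w + 1 => Module.End.eigenspace (lie K n) ((w + 1 : ℕ) : K)

variable {K n}

theorem lie_of_mem_weight {w : ℕ} {z : Form K n} (hz : z ∈ weight K n w) :
    lie K n z = (w : K) • z := by
  cases w with
  | zero =>
    obtain ⟨c, rfl⟩ := Submodule.mem_span_singleton.1 hz
    rw [map_smul, lie_one]; simp
  | succ w => exact Module.End.mem_eigenspace_iff.1 hz

theorem mem_weight {w : ℕ} (hw : 0 < w) {z : Form K n} (h : lie K n z = (w : K) • z) :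
    z ∈ weight K n w := by
  cases w with
  | zero => exact absurd hw (lt_irrefl _)
  | succ w => exact Module.End.mem_eigenspace_iff.2 h

theorem map_mem_weight {m : ℕ} (f : Form K n →ₗ[K] Form K m)
    (hf : ∀ z, f (lie K n z) = lie K m (f z)) (h1 : f 1 ∈ Submodule.span K {(1 : Form K m)})
    {w : ℕ} {z : Form K n} (hz : z ∈ weight K n w) : f z ∈ weight K m w := by
  cases w with
  | zero =>
    obtain ⟨c, rfl⟩ := Submodule.mem_span_singleton.1 hz
    rw [map_smul]
    exact Submodule.smul_mem _ _ h1
  | succ w => exact mem_weight w.succ_pos (by rw [← hf, lie_of_mem_weight hz, map_smul])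

theorem lie_one_tmul {i : ℕ} {l : ExteriorAlgebra K (Cot K n)} (hl : l ∈ ⋀[K]^i (Cot K n)) :
    lie K n (1 ⊗ₜ l) = (i : K) • (1 ⊗ₜ l) := by
  have h := lie_tmul K n 1 l
  rw [map_one, sum_dt_mul_contract K n hl, TensorProduct.tmul_smul] at h
  rw [h]
  simp

variable (K n)

/-- A product λ of i differentials has weight i, and multiplication by t_i - δ_{i0} raises the
weight by one. So the span of the weight spaces contains all 1 ⊗ λ and is stable under
multiplication by every t_i. -/
theorem iSup_weight : iSup (weight K n) = ⊤ := by
  have h1 : ∀ (i : Fin (n + 1)) (z : Form K n), z ∈ iSup (weight K n) →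
      (coord K n i - if i = 0 then 1 else 0) * z ∈ iSup (weight K n) := by
    intro i z hz
    induction hz using Submodule.iSup_induction' with
    | zero => rw [mul_zero]; exact Submodule.zero_mem _
    | add a b _ _ ha hb => rw [mul_add]; exact Submodule.add_mem _ ha hb
    | mem w z hz =>
      refine Submodule.mem_iSup_of_mem (w + 1) (mem_weight w.succ_pos ?_)
      rw [lie_coord_mul, lie_of_mem_weight hz, mul_add, mul_smul_comm]
      push_cast
      rw [add_smul, one_smul]
  have h2 : ∀ (i : Fin (n + 1)) (z : Form K n), z ∈ iSup (weight K n) →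
      coord K n i * z ∈ iSup (weight K n) := by
    intro i z hz
    have := Submodule.add_mem _ (h1 i z hz)
      (show (if i = 0 then (1 : Form K n) else 0) * z ∈ iSup (weight K n) by
        split_ifs
        · rwa [one_mul]
        · rw [zero_mul]; exact Submodule.zero_mem _)
    rwa [← add_mul, sub_add_cancel] at this
  have h3 : ∀ l : ExteriorAlgebra K (Cot K n), (1 ⊗ₜ l : Form K n) ∈ iSup (weight K n) := by
    intro l
    refine IsInternal.induction
      (DirectSum.Decomposition.isInternal (fun i : ℕ => ⋀[K]^i (Cot K n)))
      (p := fun l => (1 ⊗ₜ l : Form K n) ∈ iSup (weight K n)) ?_ (fun x y hx hy => ?_)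
      (fun i l hl => Submodule.mem_iSup_of_mem i ?_) l
    · rw [TensorProduct.tmul_zero]; exact Submodule.zero_mem _
    · rw [TensorProduct.tmul_add]; exact Submodule.add_mem _ hx hy
    · cases i with
      | zero =>
        change l ∈ LinearMap.range (ExteriorAlgebra.ι K) ^ 0 at hl
        rw [pow_zero, Submodule.mem_one] at hl
        obtain ⟨r, rfl⟩ := hl
        rw [Algebra.algebraMap_eq_smul_one, TensorProduct.tmul_smul]
        exact Submodule.smul_mem _ _ (Submodule.mem_span_singleton_self _)
      | succ i => exact mem_weight i.succ_pos (lie_one_tmul hl)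
  rw [eq_top_iff]
  rintro x -
  induction x using TensorProduct.induction_on with
  | zero => exact Submodule.zero_mem _
  | add a b ha hb => exact Submodule.add_mem _ ha hb
  | tmul p l =>
    obtain ⟨f, rfl⟩ := funMk_surjective K n p
    induction f using MvPolynomial.induction_on with
    | C a =>
      rw [← MvPolynomial.algebraMap_eq, AlgHom.commutes, Algebra.algebraMap_eq_smul_one,
        ← TensorProduct.smul_tmul']
      exact Submodule.smul_mem _ _ (h3 l)
    | add f g hf hg => rw [map_add, TensorProduct.add_tmul]; exact Submodule.add_mem _ hf hg
    | mul_X f i hf =>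
      have := h2 i _ hf
      rwa [coord, Algebra.TensorProduct.tmul_mul_tmul, one_mul, ← map_mul, mul_comm] at this

variable [CharZero K]

/-- Since weight 0 was taken to be the constants rather than the kernel of `lie`, projection to
weight 0 has constant values by construction; `iSup_weight` shows that nothing is lost. -/
theorem isInternal_weight : DirectSum.IsInternal (weight K n) :=
  isInternal_of_scale (lie K n) (fun i => (i : K)) Nat.cast_injective
    (fun _ _ hz => lie_of_mem_weight hz) (iSup_weight K n)

/-- The projection onto the forms of weight `0`. -/
def constPart : Form K n →ₗ[K] Form K n := gradedScale (isInternal_weight K n) (Pi.single 0 1)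

/-- The contracting homotopy of the forms on the simplex, from the contraction of the simplex to
its vertex `0`. -/
def homotopy : Form K n →ₗ[K] Form K n :=
  euler K n ∘ₗ gradedScale (isInternal_weight K n) fun w => (w : K)⁻¹

theorem constPart_mem (z : Form K n) : constPart K n z ∈ Submodule.span K {(1 : Form K n)} :=
  gradedScale_single_mem (isInternal_weight K n) 0 z

/-- Division by the weight commutes with `d`, because `d` commutes with the Lie derivative. Cartan's
formula then turns the left side into the Lie derivative composed with its inverse on positive
weights. -/
theorem d_homotopy (z : Form K n) :
    d K n (homotopy K n z) + homotopy K n (d K n z) = z - constPart K n z := by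
  have h1 := CDGA.map_gradedScale (isInternal_weight K n) (isInternal_weight K n)
    (fun w => (w : K)⁻¹) (d K n) (fun w z hz => map_mem_weight (d K n)
      (fun z => (lie_d K n z).symm) (by rw [d_one]; exact Submodule.zero_mem _) hz) z
  rw [homotopy, LinearMap.comp_apply, LinearMap.comp_apply, ← h1, ← lie_apply]
  have h2 : lie K n ∘ₗ gradedScale (isInternal_weight K n) (fun w => (w : K)⁻¹) =
      LinearMap.id - constPart K n := by
    refine IsInternal.linearMap_ext (isInternal_weight K n) fun w z hz => ?_
    rw [LinearMap.comp_apply, gradedScale_apply _ _ hz, LinearMap.sub_apply, constPart,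
      gradedScale_apply _ _ hz, map_smul, lie_of_mem_weight hz, smul_smul, LinearMap.id_apply]
    -- In weight 0 the inverse takes its default value 0, so the homotopy ignores constants,
    -- matching the projection subtracted on the right.
    rcases eq_or_ne w 0 with rfl | hw
    · simp
    · rw [inv_mul_cancel₀ (Nat.cast_ne_zero.2 hw), Pi.single_eq_of_ne hw]
      simp
  exact LinearMap.congr_fun h2 z

/-- The Lie derivative preserves form degree, so scaling by degree preserves the weight spaces; the
two gradings therefore commute. -/
theorem gradedScale_weight_mem (c : ℕ → K) {i : ℕ} {z : Form K n} (hz : z ∈ deg K n i) :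
    gradedScale (isInternal_weight K n) c z ∈ deg K n i := by
  refine mem_of_commute_gradedScale (isInternal_deg K n) (fun b z => ?_) hz
  refine (CDGA.map_gradedScale (isInternal_weight K n) (isInternal_weight K n) c
    (gradedScale (isInternal_deg K n) b) (fun w z hz => map_mem_weight _ (fun z => ?_) ?_ hz)
    z).symm
  · exact (CDGA.map_gradedScale (isInternal_deg K n) (isInternal_deg K n) b (lie K n)
      (fun i z hz => lie_mem K n hz) z).symm
  · rw [gradedScale_apply _ _ (one_mem_deg K n)]
    exact Submodule.smul_mem _ _ (Submodule.mem_span_singleton_self _)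

theorem homotopy_eq_zero {z : Form K n} (hz : z ∈ deg K n 0) : homotopy K n z = 0 :=
  euler_eq_zero K n (gradedScale_weight_mem K n _ hz)

theorem homotopy_mem {i : ℕ} {z : Form K n} (hz : z ∈ deg K n i) :
    homotopy K n z ∈ deg K n (i - 1) :=
  euler_mem K n (gradedScale_weight_mem K n _ hz)

theorem formFace_gradedScale_weight (c : ℕ → K) (k : Fin (n + 1)) (z : Form K (n + 1)) :
    formFace K n k.succ (gradedScale (isInternal_weight K (n + 1)) c z) =
      gradedScale (isInternal_weight K n) c (formFace K n k.succ z) :=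
  CDGA.map_gradedScale (isInternal_weight K (n + 1)) (isInternal_weight K n) c
    (formFace K n k.succ).toLinearMap (fun w z hz => map_mem_weight
      (formFace K n k.succ).toLinearMap (fun z => formFace_lie K n k z)
      (by rw [AlgHom.toLinearMap_apply, map_one]; exact Submodule.mem_span_singleton_self _) hz) z

theorem formFace_homotopy (k : Fin (n + 1)) (z : Form K (n + 1)) :
    formFace K n k.succ (homotopy K (n + 1) z) = homotopy K n (formFace K n k.succ z) := by
  rw [homotopy, homotopy, LinearMap.comp_apply, LinearMap.comp_apply, formFace_euler,
    formFace_gradedScale_weight]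

/-- The value of a form at the vertex `0`. -/
def evalZero : Form K n →ₐ[K] K :=
  Algebra.TensorProduct.lift (funLift K (Pi.single 0 (1 : K)) (by simp))
    ExteriorAlgebra.algebraMapInv (fun _ _ => Commute.all _ _)

/-- Taking constant parts commutes with restriction to a face through the vertex 0, and a constant
is determined by its restriction, as evaluation at the vertex shows. -/
theorem constPart_eq_zero (k : Fin (n + 1)) {z : Form K (n + 1)}
    (hz : formFace K n k.succ z = 0) : constPart K (n + 1) z = 0 := by
  obtain ⟨c, hc⟩ := Submodule.mem_span_singleton.1 (constPart_mem K (n + 1) z)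
  have h := formFace_gradedScale_weight K n (Pi.single 0 1) k z
  rw [hz, map_zero] at h
  change formFace K n k.succ (constPart K (n + 1) z) = 0 at h
  rw [← hc, map_smul, map_one] at h
  have h' := congrArg (evalZero K n) h
  rw [map_smul, map_one, map_zero, smul_eq_mul, mul_one] at h'
  rw [← hc, h', zero_smul]

/-- On a point the Euler field is zero, hence so is the homotopy, and the homotopy formula says that
every form is constant. This identifies Ω_0 with K. -/
theorem constPart_zero (z : Form K 0) : constPart K 0 z = z := by
  have h : euler K 0 = 0 := by
    have : covec K 0 0 = 0 := by
      refine LinearMap.ext fun y => ?_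
      obtain ⟨x, rfl⟩ := cotMk_surjective K 0 y
      rw [covec_mk]; simp
    simp [euler, this, contract]
  have h1 := d_homotopy K 0 z
  rw [homotopy, h] at h1
  simp only [LinearMap.zero_comp, LinearMap.zero_apply, map_zero, add_zero] at h1
  exact (sub_eq_zero.1 h1.symm).symm

end Weight

end SimplexForms

/-! ### Forms with values in a DGLA and the relative Poincaré lemma. -/

namespace SimplexForms

open CDGA

variable (K : Type u) [Field K] [CharZero K] (n : ℕ) (g : DGLA.{u, v} K)

/-- The restriction `Ω_{n+1} ⊗ V → Ω_n ⊗ V` to the `k`-th face. -/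
abbrev face (n : ℕ) (V : Type v) [AddCommGroup V] [Module K V] (k : Fin (n + 2)) :
    Form K (n + 1) ⊗[K] V →ₗ[K] Form K n ⊗[K] V :=
  (formFace K n k).toLinearMap.rTensor V

/-- The elements of total degree `i` of `Ω_n ⊗ g`. -/
def totalDeg (i : ℤ) : Submodule K (Form K n ⊗[K] g.carrier) := tensorDeg (simplexForms K n) g i

/-- The differential of `Ω_n ⊗ g`. -/
def totalD : Form K n ⊗[K] g.carrier →ₗ[K] Form K n ⊗[K] g.carrier := tensorD (simplexForms K n) g

variable {K n g}

theorem totalDeg_le {i : ℤ} {S : Submodule K (Form K n ⊗[K] g.carrier)}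
    (h : ∀ (p : ℕ) (j : ℤ), (p : ℤ) + j = i → ∀ a ∈ deg K n p, ∀ x ∈ g.deg j, a ⊗ₜ x ∈ S) :
    totalDeg K n g i ≤ S := by
  refine Submodule.span_le.2 ?_
  rintro _ ⟨p, j, hk, a, ha, x, hx, rfl⟩
  exact h p j hk a ha x hx

theorem tmul_mem_totalDeg {p : ℕ} {i j : ℤ} (h : (p : ℤ) + j = i) {a : Form K n}
    (ha : a ∈ deg K n p) {x : g.carrier} (hx : x ∈ g.deg j) : a ⊗ₜ x ∈ totalDeg K n g i :=
  tmul_mem_tensorDeg (C := simplexForms K n) h ha hx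

theorem totalD_tmul {p : ℕ} {a : Form K n} (ha : a ∈ deg K n p) (x : g.carrier) :
    totalD K n g (a ⊗ₜ x) = d K n a ⊗ₜ x + (-1 : K) ^ p • (a ⊗ₜ g.d x) :=
  tensorD_tmul (C := simplexForms K n) ha x

theorem totalD_mem {i : ℤ} {z : Form K n ⊗[K] g.carrier} (hz : z ∈ totalDeg K n g i) :
    totalD K n g z ∈ totalDeg K n g (i + 1) :=
  tensorD_mem (C := simplexForms K n) hz

theorem totalD_totalD (z : Form K n ⊗[K] g.carrier) : totalD K n g (totalD K n g z) = 0 :=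
  tensorD_tensorD (C := simplexForms K n) z

variable (K n g)

theorem face_mem {i : ℤ} (k : Fin (n + 2)) {z : Form K (n + 1) ⊗[K] g.carrier}
    (hz : z ∈ totalDeg K (n + 1) g i) :
    face K n g.carrier k z ∈ totalDeg K n g i :=
  map_tensorDeg (simplexFace K n k) (DGLA.Hom.id g) hz

theorem face_totalD (k : Fin (n + 2)) (z : Form K (n + 1) ⊗[K] g.carrier) :
    face K n g.carrier k (totalD K (n + 1) g z) =
      totalD K n g (face K n g.carrier k z) :=
  map_tensorD (simplexFace K n k) (DGLA.Hom.id g) z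

theorem rTensor_extend_mem {i : ℤ} (k : Fin (n + 2)) {z : Form K n ⊗[K] g.carrier}
    (hz : z ∈ totalDeg K n g i) :
    (extend K n k).rTensor g.carrier z ∈ totalDeg K (n + 1) g i := by
  have : totalDeg K n g i ≤
      (totalDeg K (n + 1) g i).comap ((extend K n k).rTensor g.carrier) := by
    refine totalDeg_le fun i j hk a ha x hx => ?_
    exact tmul_mem_totalDeg hk (extend_mem K k ha) hx
  exact this hz

theorem rTensor_homotopy_mem {i : ℤ} {z : Form K n ⊗[K] g.carrier}
    (hz : z ∈ totalDeg K n g i) :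
    (homotopy K n).rTensor g.carrier z ∈ totalDeg K n g (i - 1) := by
  have : totalDeg K n g i ≤
      (totalDeg K n g (i - 1)).comap ((homotopy K n).rTensor g.carrier) := by
    refine totalDeg_le fun p j hk a ha x hx => ?_
    change homotopy K n a ⊗ₜ x ∈ totalDeg K n g (i - 1)
    -- In form degree 0 truncated subtraction would give the wrong total degree, so the vanishing of
    -- the homotopy there is needed.
    cases p with
    | zero =>
      rw [homotopy_eq_zero K n ha, TensorProduct.zero_tmul]
      exact Submodule.zero_mem _
    | succ p =>
      have h := homotopy_mem K n ha
      rw [add_tsub_cancel_right] at h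
      exact tmul_mem_totalDeg (by push_cast at hk; linarith) h hx
  exact this hz

/-- The homotopy lowers form degree by one, so the two terms involving the differential of `g` carry
opposite signs and cancel, leaving `d_homotopy`. -/
theorem totalD_rTensor_homotopy (z : Form K n ⊗[K] g.carrier) :
    totalD K n g ((homotopy K n).rTensor g.carrier z) +
      (homotopy K n).rTensor g.carrier (totalD K n g z) =
      z - (constPart K n).rTensor g.carrier z := by
  induction z using TensorProduct.induction_on with
  | zero => simp
  | add a b ha hb => simp only [map_add]; rw [add_add_add_comm, ha, hb]; abel
  | tmul a x =>
    refine IsInternal.induction (isInternal_deg K n) (p := fun a : Form K n =>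
      totalD K n g ((homotopy K n).rTensor g.carrier (a ⊗ₜ x)) +
      (homotopy K n).rTensor g.carrier (totalD K n g (a ⊗ₜ x)) =
      a ⊗ₜ x - (constPart K n).rTensor g.carrier (a ⊗ₜ x)) (by simp) (fun a b ha hb => ?_)
      (fun i a ha => ?_) a
    · simp only [TensorProduct.add_tmul, map_add]
      rw [add_add_add_comm, ha, hb]; abel
    · have h2 : totalD K n g (homotopy K n a ⊗ₜ x) =
          d K n (homotopy K n a) ⊗ₜ x + (-1 : K) ^ (i + 1) • (homotopy K n a ⊗ₜ g.d x) := by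
        cases i with
        | zero => rw [homotopy_eq_zero K n ha]; simp
        | succ i =>
          rw [totalD_tmul (homotopy_mem K n ha), add_tsub_cancel_right,
            pow_succ _ (i + 1), pow_succ _ i, mul_neg_one, mul_neg_one, neg_neg]
      rw [LinearMap.rTensor_tmul, totalD_tmul ha, h2, map_add, map_smul, LinearMap.rTensor_tmul,
        LinearMap.rTensor_tmul, LinearMap.rTensor_tmul, ← TensorProduct.sub_tmul, ← d_homotopy,
        TensorProduct.add_tmul, add_add_add_comm, ← add_smul,
        show (-1 : K) ^ (i + 1) + (-1) ^ i = 0 by ring, zero_smul, add_zero]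

theorem face_rTensor_homotopy (k : Fin (n + 1)) (z : Form K (n + 1) ⊗[K] g.carrier) :
    face K n g.carrier k.succ ((homotopy K (n + 1)).rTensor g.carrier z) =
      (homotopy K n).rTensor g.carrier (face K n g.carrier k.succ z) := by
  rw [← LinearMap.rTensor_comp_apply, ← LinearMap.rTensor_comp_apply]
  congr 2
  exact LinearMap.ext fun z => formFace_homotopy K n k z

theorem rTensor_constPart_eq_zero (k : Fin (n + 1)) {z : Form K (n + 1) ⊗[K] g.carrier}
    (hz : face K n g.carrier k.succ z = 0) : (constPart K (n + 1)).rTensor g.carrier z = 0 := by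
  -- Vanishing on elements of a kernel does not pass directly to tensors. Instead the constant part
  -- is written as a function of the restriction to the face, precomposing with `extend`, and this
  -- factorization survives tensoring.
  have h : constPart K (n + 1) =
      (constPart K (n + 1) ∘ₗ extend K n k.succ) ∘ₗ (formFace K n k.succ).toLinearMap := by
    refine LinearMap.ext fun z => ?_
    rw [LinearMap.comp_apply, LinearMap.comp_apply, AlgHom.toLinearMap_apply, ← sub_eq_zero,
      ← map_sub]
    refine constPart_eq_zero K n k ?_
    rw [map_sub, formFace_extend_self, sub_self]
  rw [h, LinearMap.rTensor_comp_apply, hz, map_zero]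

/-- The forms (with values in `V`) whose restrictions to all faces vanish. -/
def IsRelative {V : Type v} [AddCommGroup V] [Module K V] : ∀ n, Form K n ⊗[K] V → Prop
  | 0, _ => True
  | n + 1, z => ∀ k, face K n V k z = 0

/-- A form on a point is constant, so this is the vanishing of the negative cohomology of `g`
itself: the base of the induction over simplices. -/
theorem exists_primitive_zero
    (hg : ∀ j < 0, ∀ x ∈ g.deg j, g.d x = 0 → ∃ y ∈ g.deg (j - 1), g.d y = x)
    {i : ℤ} (hi : i < 0) {z : Form K 0 ⊗[K] g.carrier}
    (hz : z ∈ totalDeg K 0 g i) (hd : totalD K 0 g z = 0) :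
    ∃ y ∈ totalDeg K 0 g (i - 1), totalD K 0 g y = z := by
  have h1 : ∀ x, totalD K 0 g ((1 : Form K 0) ⊗ₜ x) = (1 : Form K 0) ⊗ₜ g.d x := by
    intro x
    rw [totalD_tmul (one_mem_deg K 0), d_one]; simp
  have h2 : ∃ x ∈ g.deg i, z = (1 : Form K 0) ⊗ₜ x := by
    have : totalDeg K 0 g i ≤ (g.deg i).map (TensorProduct.mk K (Form K 0) g.carrier 1) := by
      refine totalDeg_le fun p j hk a ha x hx => ?_
      obtain ⟨c, hc⟩ := Submodule.mem_span_singleton.1 (constPart_mem K 0 a)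
      rw [constPart_zero] at hc
      subst hc
      have hx' : c • x ∈ g.deg i := by
        rcases eq_or_ne c 0 with rfl | hc
        · rw [zero_smul]; exact Submodule.zero_mem _
        -- A nonzero constant has degree 0 only: otherwise its degree 0 component would vanish,
        -- whereas 1 takes the value 1 at the vertex.
        · have hp : p = 0 := by
            by_contra hp
            have h1 : (1 : Form K 0) ∈ deg K 0 p := by
              have := Submodule.smul_mem _ c⁻¹ ha
              rwa [smul_smul, inv_mul_cancel₀ hc, one_smul] at this
            have h2 := gradedScale_apply (isInternal_deg K 0) (Pi.single 0 1) h1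
            rw [gradedScale_apply (isInternal_deg K 0) (Pi.single 0 1) (one_mem_deg K 0),
              Pi.single_eq_same, Pi.single_eq_of_ne hp, one_smul, zero_smul] at h2
            have h3 := congrArg (evalZero K 0) h2
            rw [map_one, map_zero] at h3
            exact one_ne_zero h3
          subst hp
          rw [Nat.cast_zero, zero_add] at hk
          exact hk ▸ Submodule.smul_mem _ _ hx
      exact ⟨c • x, hx', (TensorProduct.smul_tmul c (1 : Form K 0) x).symm⟩
    obtain ⟨x, hx, h⟩ := this hz
    exact ⟨x, hx, h.symm⟩
  obtain ⟨x, hx, rfl⟩ := h2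
  have h3 : g.d x = 0 := by
    rw [h1] at hd
    -- Evaluation at the vertex recovers an element of `g` from its tensor with 1.
    have := congrArg ((TensorProduct.lid K g.carrier).toLinearMap ∘ₗ
      (evalZero K 0).toLinearMap.rTensor g.carrier) hd
    simpa using this
  obtain ⟨y, hy, rfl⟩ := hg i hi x hx h3
  exact ⟨(1 : Form K 0) ⊗ₜ y, tmul_mem_totalDeg (by simp) (one_mem_deg K 0) hy,
    h1 y⟩

/-- The relative Poincaré lemma: a closed form with values in `g` on the `n`-simplex which
vanishes on the boundary and whose total degree is less than `n` has a primitive which vanishes on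
the boundary. -/
theorem exists_primitive (hg : ∀ j < 0, ∀ x ∈ g.deg j, g.d x = 0 → ∃ y ∈ g.deg (j - 1), g.d y = x)
    (n : ℕ) {i : ℤ} (hi : i < n) {z : Form K n ⊗[K] g.carrier}
    (hz : z ∈ totalDeg K n g i) (hr : IsRelative K n z)
    (hd : totalD K n g z = 0) :
    ∃ y ∈ totalDeg K n g (i - 1), IsRelative K n y ∧
      totalD K n g y = z := by
  induction n generalizing i with
  | zero =>
    obtain ⟨y, hy, h⟩ := exists_primitive_zero K g hg hi hz hd
    exact ⟨y, hy, trivial, h⟩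
  | succ n ih =>
    -- This primitive vanishes on all faces through the vertex 0, where the homotopy commutes with
    -- restriction. Its restriction to the remaining face 0 is closed and relative, of degree i - 1
    -- < n, so the induction hypothesis applies to it.
    let y₁ := (homotopy K (n + 1)).rTensor g.carrier z
    have hy₁ : y₁ ∈ totalDeg K (n + 1) g (i - 1) := rTensor_homotopy_mem K _ g hz
    have hf : ∀ k : Fin (n + 1), face K n g.carrier k.succ y₁ = 0 := fun k => by
      rw [face_rTensor_homotopy, hr, map_zero]
    have hD : totalD K (n + 1) g y₁ = z := by
      have := totalD_rTensor_homotopy K (n + 1) g z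
      rwa [hd, map_zero, add_zero, rTensor_constPart_eq_zero K n g 0 (hr _), sub_zero] at this
    obtain ⟨u, hu, hur, hud⟩ := ih (i := i - 1) (z := face K n g.carrier 0 y₁)
      (by push_cast at hi; linarith) (face_mem K n g 0 hy₁) (by
        cases n with
        | zero => trivial
        | succ n =>
          intro k
          rw [rTensor_formFace_formFace]
          have := hf k
          rw [Fin.succAbove_zero, this, map_zero])
      (by rw [← face_totalD, hD, hr])
    -- Subtracting an exact term keeps a primitive of z. It cancels `y₁` on face 0, and since u is
    -- relative its extension vanishes on the other faces.
    refine ⟨y₁ - totalD K (n + 1) g ((extend K n 0).rTensor g.carrier u),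
      Submodule.sub_mem _ hy₁ ?_, fun k => ?_, ?_⟩
    · have := totalD_mem (rTensor_extend_mem K n g 0 hu)
      rwa [sub_add_cancel] at this
    · rw [map_sub, face_totalD]
      induction k using Fin.cases with
      | zero => rw [rTensor_formFace_extend_self, hud, sub_self]
      | succ k =>
        rw [hf]
        -- On a point `IsRelative` carries no information, so for n = 0 the vanishing on face 1
        -- comes from the factor t_1 in `extend` instead.
        cases n with
        | zero =>
          obtain rfl : k = 0 := Fin.fin_one_eq_zero k
          have := rTensor_formFace_one_extend K g.carrier u
          rw [Fin.succ_zero_eq_one, this, map_zero, sub_zero]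
        | succ n =>
          rw [← Fin.succAbove_zero, rTensor_formFace_extend, hur, map_zero, map_zero, sub_zero]
    · rw [map_sub, hD, totalD_totalD, sub_zero]

end SimplexForms

/-! ### The truncation map on totalizations: surjectivity and acyclicity of its kernel. -/

/-- Dependent choice along consecutive pairs. -/
theorem exists_seq_of_step {X : ℕ → Type*} (P : ∀ n, X n → X (n + 1) → Prop)
    (h0 : ∃ a b, P 0 a b) (hs : ∀ n a b, P n a b → ∃ c, P (n + 1) b c) :
    ∃ x : ∀ n, X n, ∀ n, P n (x n) (x (n + 1)) := by
  obtain ⟨a, b, hab⟩ := h0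
  choose c hc using hs
  let s : ∀ n, {p : X n × X (n + 1) // P n p.1 p.2} := fun n =>
    Nat.rec ⟨(a, b), hab⟩ (fun n p => ⟨(p.1.2, c n p.1.1 p.1.2 p.2), hc n _ _ p.2⟩) n
  exact ⟨fun n => (s n).1.1, fun n => (s n).2⟩

namespace SemicosimplicialDGLA

open SimplexForms

variable {K : Type u} [Field K] (g : SemicosimplicialDGLA.{u, v} K)

/-- The two orders of indices are combined into one identity of the same shape as
`formFace_formFace`, so that faces and cofaces can be matched without cases. -/
theorem coface_coface_succAbove (n : ℕ) (i : Fin (n + 3)) (j : Fin (n + 2))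
    (x : (g.obj n).carrier) :
    (g.coface (n + 1) i).toLinearMap ((g.coface n j).toLinearMap x) =
      (g.coface (n + 1) (i.succAbove j)).toLinearMap
        ((g.coface n (j.predAbove i)).toLinearMap x) := by
  rcases lt_or_ge j.castSucc i with h | h
  · obtain ⟨k, rfl⟩ := Fin.exists_succ_eq.2 (Fin.ne_zero_of_lt h)
    rw [Fin.succAbove_of_castSucc_lt _ _ h, Fin.predAbove_of_castSucc_lt _ _ h, Fin.pred_succ]
    exact g.coface_coface n k j (Fin.castSucc_lt_succ_iff.1 h) x
  · obtain ⟨k, rfl⟩ := Fin.exists_castSucc_eq.2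
      (ne_of_lt (lt_of_le_of_lt h (Fin.castSucc_lt_last j)))
    rw [Fin.succAbove_of_le_castSucc _ _ h, Fin.predAbove_of_le_castSucc _ _ h,
      Fin.castPred_castSucc]
    exact (g.coface_coface n j k (Fin.castSucc_le_castSucc_iff.1 h) x).symm

/-- `id ⊗ ∂_{k,n+1} : Ω_m ⊗ g_n → Ω_m ⊗ g_{n+1}`. -/
abbrev cofaceForm (m n : ℕ) (k : Fin (n + 2)) :
    Form K m ⊗[K] (g.obj n).carrier →ₗ[K] Form K m ⊗[K] (g.obj (n + 1)).carrier :=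
  (g.coface n k).toLinearMap.lTensor (Form K m)

theorem cofaceForm_cofaceForm (m n : ℕ) (i : Fin (n + 3)) (j : Fin (n + 2))
    (z : Form K m ⊗[K] (g.obj n).carrier) :
    g.cofaceForm m (n + 1) i (g.cofaceForm m n j z) =
      g.cofaceForm m (n + 1) (i.succAbove j) (g.cofaceForm m n (j.predAbove i) z) := by
  rw [← LinearMap.lTensor_comp_apply, ← LinearMap.lTensor_comp_apply]
  congr 2
  exact LinearMap.ext fun x => g.coface_coface_succAbove n i j x

theorem face_cofaceForm (m n : ℕ) (i : Fin (m + 2)) (j : Fin (n + 2))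
    (z : Form K (m + 1) ⊗[K] (g.obj n).carrier) :
    face K m _ i (g.cofaceForm (m + 1) n j z) = g.cofaceForm m n j (face K m _ i z) := by
  rw [← LinearMap.comp_apply, ← LinearMap.comp_apply, LinearMap.rTensor_comp_lTensor,
    LinearMap.lTensor_comp_rTensor]

variable [CharZero K]

theorem cofaceForm_mem (m n : ℕ) (k : Fin (n + 2)) {i : ℤ} {z : Form K m ⊗[K] (g.obj n).carrier}
    (hz : z ∈ totalDeg K m (g.obj n) i) : g.cofaceForm m n k z ∈ totalDeg K m (g.obj (n + 1)) i :=
  CDGA.map_tensorDeg (CDGA.Hom.id (simplexForms K m)) (g.coface n k) hz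

theorem cofaceForm_totalD (m n : ℕ) (k : Fin (n + 2)) (z : Form K m ⊗[K] (g.obj n).carrier) :
    g.cofaceForm m n k (totalD K m (g.obj n) z) =
      totalD K m (g.obj (n + 1)) (g.cofaceForm m n k z) :=
  CDGA.map_tensorD (CDGA.Hom.id (simplexForms K m)) (g.coface n k) z

theorem mem_totDeg_iff {m : ℤ} {x : ∀ n, (g.level n).carrier} :
    x ∈ g.totDeg m ↔ (∀ n, x n ∈ totalDeg K n (g.obj n) m) ∧
      ∀ n k, face K n (g.obj (n + 1)).carrier k (x (n + 1)) = g.cofaceForm n n k (x n) :=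
  Iff.rfl

/-- The cofaces of b agree on common faces: restricted there, they become double cofaces of a, which
coincide by the semicosimplicial identity. This is why each inductive step remembers two consecutive
levels. -/
theorem exists_face_eq_cofaceForm (n : ℕ) {m : ℤ} {a : Form K n ⊗[K] (g.obj n).carrier}
    {b : Form K (n + 1) ⊗[K] (g.obj (n + 1)).carrier}
    (hb : b ∈ totalDeg K (n + 1) (g.obj (n + 1)) m)
    (hab : ∀ k, face K n _ k b = g.cofaceForm n n k a) :
    ∃ c ∈ totalDeg K (n + 2) (g.obj (n + 2)) m,
      ∀ k, face K (n + 1) _ k c = g.cofaceForm (n + 1) (n + 1) k b := by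
  refine exists_rTensor_formFace_eq K _ _ (totalDeg K (n + 1) (g.obj (n + 2)) m)
    (fun k z hz => face_mem K _ _ k hz) (fun k z hz => rTensor_extend_mem K _ _ k hz) _
    (fun k => g.cofaceForm_mem _ _ k hb) fun i j => ?_
  have h1 := g.face_cofaceForm n (n + 1) j i b
  have h2 := g.face_cofaceForm n (n + 1) (j.predAbove i) (i.succAbove j) b
  rw [hab] at h1 h2
  exact h1.trans ((g.cofaceForm_cofaceForm n n i j a).trans h2.symm)

theorem tensorMap_id_id (C : CDGA.{u, v'} K) (L : DGLA.{u, v} K) (z : (C.tensor L).carrier) :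
    (CDGA.tensorMap (CDGA.Hom.id C) (DGLA.Hom.id L)).toLinearMap z = z :=
  LinearMap.congr_fun (TensorProduct.map_id (R := K) (M := C.carrier) (N := L.carrier)) z

instance subsingleton_level_trunc (n : ℕ) : Subsingleton (g.trunc.level (n + 3)).carrier := by
  refine subsingleton_of_forall_eq 0 fun z => ?_
  change Form K (n + 3) ⊗[K] PUnit.{v + 1} at z
  induction z using TensorProduct.induction_on with
  | zero => rfl
  | add a b ha hb => rw [ha, hb]; exact add_zero _
  | tmul a x => exact TensorProduct.tmul_zero _ a

theorem piMap_toTrunc_eq_zero_iff {x : ∀ n, (g.level n).carrier} :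
    piMap g.toTrunc x = 0 ↔ x 0 = 0 ∧ x 1 = 0 ∧ x 2 = 0 := by
  constructor
  · intro h
    exact ⟨(tensorMap_id_id _ _ _).symm.trans (congrFun h 0),
      (tensorMap_id_id _ _ _).symm.trans (congrFun h 1),
      (tensorMap_id_id _ _ _).symm.trans (congrFun h 2)⟩
  · rintro ⟨h0, h1, h2⟩
    funext n
    match n with
    | 0 => exact (tensorMap_id_id _ _ _).trans h0
    | 1 => exact (tensorMap_id_id _ _ _).trans h1
    | 2 => exact (tensorMap_id_id _ _ _).trans h2
    | n + 3 => exact Subsingleton.elim _ _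

/-- The map on Thom-Whitney totalizations induced by the truncation is surjective in each
degree. -/
theorem exists_piMap_toTrunc_eq {m : ℤ} {y : ∀ n, (g.trunc.level n).carrier}
    (hy : y ∈ g.trunc.totDeg m) : ∃ x ∈ g.totDeg m, piMap g.toTrunc x = y := by
  have key := exists_seq_of_step
    (X := fun n => Form K n ⊗[K] (g.obj n).carrier)
    (fun n a b => a ∈ totalDeg K n (g.obj n) m ∧
      b ∈ totalDeg K (n + 1) (g.obj (n + 1)) m ∧
      (∀ k, face K n _ k b = g.cofaceForm n n k a) ∧
      (CDGA.tensorMap (CDGA.Hom.id (simplexForms K n)) (g.truncApp n)).toLinearMap a = y n ∧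
      (CDGA.tensorMap (CDGA.Hom.id (simplexForms K (n + 1))) (g.truncApp (n + 1))).toLinearMap b =
        y (n + 1))
    ⟨y 0, y 1, hy.1 0, hy.1 1, hy.2 0, tensorMap_id_id _ _ _, tensorMap_id_id _ _ _⟩
  obtain ⟨x, hx⟩ := key (by
      rintro n a b ⟨ha, hb, hab, hay, hby⟩
      rcases n with - | n
      · obtain rfl : b = y 1 := (tensorMap_id_id _ _ _).symm.trans hby
        exact ⟨y 2, hb, hy.1 2, hy.2 1, hby, tensorMap_id_id _ _ _⟩
      -- From level 3 on the truncation is zero, so any filling maps to the prescribed element.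
      · obtain ⟨c, hc, hcf⟩ := g.exists_face_eq_cofaceForm (n + 1) hb hab
        exact ⟨c, hb, hc, hcf, hby,
          (subsingleton_level_trunc g n).elim _ _⟩)
  exact ⟨x, g.mem_totDeg_iff.2 ⟨fun n => (hx n).1, fun n => (hx n).2.2.1⟩,
      funext fun n => (hx n).2.2.2.1⟩

/-- The primitive is zero up to level 2. Above, a filling c with the prescribed boundary has the
right differential on the boundary, and the discrepancy is removed by the relative Poincaré lemma.
-/
theorem exists_primitive_seq
    (hg : ∀ i, ∀ j < 0, ∀ x ∈ (g.obj i).deg j, (g.obj i).d x = 0 →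
      ∃ y ∈ (g.obj i).deg (j - 1), (g.obj i).d y = x)
    {m : ℤ} (hm : m ≤ 2) {x : ∀ n, Form K n ⊗[K] (g.obj n).carrier}
    (hx : ∀ n, x n ∈ totalDeg K n (g.obj n) m)
    (hf : ∀ n k, face K n (g.obj (n + 1)).carrier k (x (n + 1)) = g.cofaceForm n n k (x n))
    (hx0 : x 0 = 0) (hx1 : x 1 = 0) (hx2 : x 2 = 0) (hd : ∀ n, totalD K n (g.obj n) (x n) = 0) :
    ∃ y : ∀ n, Form K n ⊗[K] (g.obj n).carrier, (∀ n, y n ∈ totalDeg K n (g.obj n) (m - 1)) ∧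
      (∀ n k, face K n (g.obj (n + 1)).carrier k (y (n + 1)) = g.cofaceForm n n k (y n)) ∧
      (∀ n ≤ 2, y n = 0) ∧ ∀ n, totalD K n (g.obj n) (y n) = x n := by
  have key := exists_seq_of_step
    (X := fun n => Form K n ⊗[K] (g.obj n).carrier)
    (fun n a b => a ∈ totalDeg K n (g.obj n) (m - 1) ∧
      b ∈ totalDeg K (n + 1) (g.obj (n + 1)) (m - 1) ∧
      (∀ k, face K n _ k b = g.cofaceForm n n k a) ∧ totalD K n (g.obj n) a = x n ∧
      totalD K (n + 1) (g.obj (n + 1)) b = x (n + 1) ∧ (n ≤ 2 → a = 0) ∧ (n ≤ 1 → b = 0))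
    ⟨0, 0, Submodule.zero_mem _, Submodule.zero_mem _, fun k => by rw [map_zero, map_zero],
      (map_zero _).trans hx0.symm, (map_zero _).trans hx1.symm, fun _ => rfl, fun _ => rfl⟩
  obtain ⟨y, hy⟩ := key (by
      rintro n a b ⟨ha, hb, hab, hda, hdb, ha0, hb0⟩
      rcases n with - | n
      · have hb0' := hb0 (by norm_num)
        refine ⟨0, hb, Submodule.zero_mem _, fun k => ?_, hdb, ?_, fun _ => hb0', fun _ => rfl⟩
        · rw [hb0', map_zero, map_zero]
        · rw [map_zero, hx2]
      · obtain ⟨c, hc, hcf⟩ := g.exists_face_eq_cofaceForm (n + 1) hb hab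
        -- The degree condition holds since m ≤ 2 < n + 3; this is exactly what truncating after
        -- level 2 allows. As e vanishes on the boundary, adding it does not disturb the matching
        -- conditions.
        obtain ⟨e, he, her, hed⟩ := exists_primitive K (g.obj (n + 3)) (hg (n + 3)) (n + 3) (i := m)
          (z := x (n + 3) - totalD K (n + 3) (g.obj (n + 3)) c) (by push_cast; omega) (by
            refine Submodule.sub_mem _ (hx _) ?_
            have := totalD_mem hc
            rwa [sub_add_cancel] at this) (fun k => by
            have h1 := hf (n + 2) k
            rw [map_sub, face_totalD, hcf, ← cofaceForm_totalD, hdb, h1, sub_self])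
          (by rw [map_sub, hd, totalD_totalD, sub_zero])
        refine ⟨c + e, hb, Submodule.add_mem _ hc he, fun k => ?_, hdb, ?_, fun h => hb0 (by omega),
          fun h => by omega⟩
        · rw [map_add, hcf, her k, add_zero]
        · rw [map_add, hed, add_sub_cancel])
  exact ⟨y, fun n => (hy n).1, fun n => (hy n).2.2.1, fun n => (hy n).2.2.2.2.2.1,
    fun n => (hy n).2.2.2.1⟩

/-- The kernel of the map on Thom-Whitney totalizations induced by the truncation is acyclic in
degrees at most `2`. -/
theorem exists_primitive_of_piMap_toTrunc_eq_zero
    (hg : ∀ i, ∀ j < 0, ∀ x ∈ (g.obj i).deg j, (g.obj i).d x = 0 →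
      ∃ y ∈ (g.obj i).deg (j - 1), (g.obj i).d y = x)
    {m : ℤ} (hm : m ≤ 2) {x : ∀ n, (g.level n).carrier} (hx : x ∈ g.totDeg m)
    (h0 : piMap g.toTrunc x = 0) (hd : g.piD x = 0) :
    ∃ y ∈ g.totDeg (m - 1), piMap g.toTrunc y = 0 ∧ g.piD y = x := by
  obtain ⟨hx0, hx1, hx2⟩ := g.piMap_toTrunc_eq_zero_iff.1 h0
  obtain ⟨y, hy, hyf, hy0, hyd⟩ := g.exists_primitive_seq hg hm (x := x) hx.1 hx.2 hx0 hx1 hx2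
    fun n => congrFun hd n
  exact ⟨y, g.mem_totDeg_iff.2 ⟨hy, hyf⟩, g.piMap_toTrunc_eq_zero_iff.2
    ⟨hy0 0 (by norm_num), hy0 1 (by norm_num), hy0 2 le_rfl⟩, funext hyd⟩

end SemicosimplicialDGLA

/-! ### Exponentials, calculus in L ⊗ m_A, and the gauge action on Maurer-Cartan elements. -/

/-- A bilinear map which satisfies the Leibniz rule with respect to nilpotent endomorphisms is
compatible with their exponentials. -/
theorem exp_apply_of_leibniz {K : Type u} [Field K] {P : Type v} {Q : Type v'} [AddCommGroup P]
    [AddCommGroup Q] [Module K P] [Module K Q] [Module ℚ P] [Module ℚ Q] (B : P →ₗ[K] P →ₗ[K] Q)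
    (E : Module.End K P) (F : Module.End K Q) (hE : IsNilpotent E) (hF : IsNilpotent F)
    (h : ∀ p q, F (B p q) = B (E p) q + B p (E q)) (p q : P) :
    IsNilpotent.exp F (B p q) = B (IsNilpotent.exp E p) (IsNilpotent.exp E q) := by
  let DL : Module.End K (P ⊗[K] P) := E.lTensor P
  let DR : Module.End K (P ⊗[K] P) := E.rTensor P
  have h_nilL : IsNilpotent DL := hE.map <| Module.End.lTensorAlgHom K P P
  have h_nilR : IsNilpotent DR := hE.map <| Module.End.rTensorAlgHom K P P
  have h_comm : Commute DL DR := by ext; simp [DL, DR]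
  -- The Leibniz rule says that m intertwines 1 ⊗ E + E ⊗ 1 with F; the two summands commute, so the
  -- exponential of their sum is a product.
  let m : P ⊗[K] P →ₗ[K] Q := TensorProduct.lift B
  have h₁ : IsNilpotent.exp F ∘ₗ m = m ∘ₗ IsNilpotent.exp (DL + DR) := by
    apply Module.End.commute_exp_left_of_commute (h_comm.isNilpotent_add h_nilL h_nilR) hF
    ext
    simp [DL, DR, m, h, add_comm]
  have h₂ : IsNilpotent.exp DL = (IsNilpotent.exp E).lTensor P :=
    (hE.map_exp (Module.End.lTensorAlgHom K P P)).symm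
  have h₃ : IsNilpotent.exp DR = (IsNilpotent.exp E).rTensor P :=
    (hE.map_exp (Module.End.rTensorAlgHom K P P)).symm
  have h₄ := LinearMap.congr_fun h₁ (p ⊗ₜ q)
  simpa [IsNilpotent.exp_add_of_commute h_comm h_nilL h_nilR, h₂, h₃, m] using h₄

namespace DGLA

variable {K : Type u} [Field K] {L : DGLA.{u, v} K} {A : ArtAlg.{u, w} K}

theorem nilD_tmul (x : L.carrier) (c : A.max) : L.nilD A (x ⊗ₜ c) = L.d x ⊗ₜ c := rfl

theorem nilBracket_tmul (x y : L.carrier) (b c : A.max) :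
    L.nilBracket A (x ⊗ₜ b) (y ⊗ₜ c) = L.bracket x y ⊗ₜ A.maxMul b c := rfl

theorem tmul_mem_nilDeg {i : ℤ} {x : L.carrier} (hx : x ∈ L.deg i) (c : A.max) :
    x ⊗ₜ c ∈ L.nilDeg A i := ⟨(⟨x, hx⟩ : L.deg i) ⊗ₜ c, rfl⟩

theorem nilDeg_induction {i : ℤ} {p : L.Nil A → Prop} (h0 : p 0)
    (ha : ∀ x y, p x → p y → p (x + y)) (ht : ∀ x ∈ L.deg i, ∀ c : A.max, p (x ⊗ₜ c))
    {z : L.Nil A} (hz : z ∈ L.nilDeg A i) : p z := by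
  obtain ⟨y, rfl⟩ := hz
  induction y using TensorProduct.induction_on with
  | zero => rwa [map_zero]
  | add a b h1 h2 => rw [map_add]; exact ha _ _ h1 h2
  | tmul y b => exact ht y y.2 b

theorem nilD_mem {i : ℤ} {z : L.Nil A} (hz : z ∈ L.nilDeg A i) :
    L.nilD A z ∈ L.nilDeg A (i + 1) := by
  refine nilDeg_induction (p := fun z => L.nilD A z ∈ L.nilDeg A (i + 1)) ?_ (fun x y hx hy => ?_)
    (fun x hx c => tmul_mem_nilDeg (L.d_mem hx) c) hz
  · rw [map_zero]; exact Submodule.zero_mem _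
  · rw [map_add]; exact Submodule.add_mem _ hx hy

theorem nilD_nilD (z : L.Nil A) : L.nilD A (L.nilD A z) = 0 := by
  induction z using TensorProduct.induction_on with
  | zero => simp
  | add a b ha hb => simp only [map_add, ha, hb, add_zero]
  | tmul x c => rw [nilD_tmul, nilD_tmul, L.d_d, TensorProduct.zero_tmul]

theorem nilBracket_mem {i j : ℤ} {y z : L.Nil A} (hy : y ∈ L.nilDeg A i) (hz : z ∈ L.nilDeg A j) :
    L.nilBracket A y z ∈ L.nilDeg A (i + j) := by
  refine nilDeg_induction (p := fun y => L.nilBracket A y z ∈ L.nilDeg A (i + j)) ?_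
    (fun x y hx hy => ?_) (fun x hx b => ?_) hy
  · rw [map_zero]; exact Submodule.zero_mem _
  · rw [map_add]; exact Submodule.add_mem _ hx hy
  refine nilDeg_induction (p := fun z => L.nilBracket A (x ⊗ₜ b) z ∈ L.nilDeg A (i + j)) ?_
    (fun x y hx hy => ?_) (fun y hy c => tmul_mem_nilDeg (L.bracket_mem hx hy) _) hz
  · rw [map_zero]; exact Submodule.zero_mem _
  · rw [map_add]; exact Submodule.add_mem _ hx hy

theorem maxMul_comm (b c : A.max) : A.maxMul b c = A.maxMul c b := Subtype.ext (mul_comm _ _)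

theorem maxMul_assoc (a b c : A.max) :
    A.maxMul (A.maxMul a b) c = A.maxMul a (A.maxMul b c) := Subtype.ext (mul_assoc _ _ _)

theorem nilBracket_skew {i j : ℤ} {y z : L.Nil A} (hy : y ∈ L.nilDeg A i)
    (hz : z ∈ L.nilDeg A j) :
    L.nilBracket A y z = -((-1 : K) ^ (i * j) • L.nilBracket A z y) := by
  refine nilDeg_induction
    (p := fun y => L.nilBracket A y z = -((-1 : K) ^ (i * j) • L.nilBracket A z y)) (by simp)
    (fun x y hx hy => ?_) (fun x hx b => ?_) hy
  · rw [map_add, LinearMap.add_apply, hx, hy, map_add, smul_add, neg_add]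
  refine nilDeg_induction (p := fun z => L.nilBracket A (x ⊗ₜ b) z =
      -((-1 : K) ^ (i * j) • L.nilBracket A z (x ⊗ₜ b))) (by simp)
    (fun x y hx hy => ?_) (fun y hy c => ?_) hz
  · rw [map_add, hx, hy, map_add, LinearMap.add_apply, smul_add, neg_add]
  · rw [nilBracket_tmul, nilBracket_tmul, L.bracket_skew hx hy, maxMul_comm b c,
      TensorProduct.neg_tmul, TensorProduct.smul_tmul']

theorem nil_leibniz {i j : ℤ} {y z : L.Nil A} (hy : y ∈ L.nilDeg A i)
    (hz : z ∈ L.nilDeg A j) :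
    L.nilD A (L.nilBracket A y z) =
      L.nilBracket A (L.nilD A y) z + (-1 : K) ^ i • L.nilBracket A y (L.nilD A z) := by
  refine nilDeg_induction (p := fun y => L.nilD A (L.nilBracket A y z) =
      L.nilBracket A (L.nilD A y) z + (-1 : K) ^ i • L.nilBracket A y (L.nilD A z)) (by simp)
    (fun x y hx hy => ?_) (fun x hx b => ?_) hy
  · simp only [map_add, LinearMap.add_apply, hx, hy, smul_add]; abel
  refine nilDeg_induction (p := fun z => L.nilD A (L.nilBracket A (x ⊗ₜ b) z) =
      L.nilBracket A (L.nilD A (x ⊗ₜ b)) z + (-1 : K) ^ i • L.nilBracket A (x ⊗ₜ b) (L.nilD A z))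
    (by simp) (fun x y hx hy => ?_) (fun y hy c => ?_) hz
  · simp only [map_add, hx, hy, smul_add]; abel
  · simp only [nilBracket_tmul, nilD_tmul, L.leibniz hx hy, TensorProduct.add_tmul,
      TensorProduct.smul_tmul']

theorem nil_jacobi {i j k : ℤ} {x y z : L.Nil A} (hx : x ∈ L.nilDeg A i) (hy : y ∈ L.nilDeg A j)
    (hz : z ∈ L.nilDeg A k) :
    L.nilBracket A x (L.nilBracket A y z) =
      L.nilBracket A (L.nilBracket A x y) z +
        (-1 : K) ^ (i * j) • L.nilBracket A y (L.nilBracket A x z) := by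
  refine nilDeg_induction (p := fun x => L.nilBracket A x (L.nilBracket A y z) =
      L.nilBracket A (L.nilBracket A x y) z +
        (-1 : K) ^ (i * j) • L.nilBracket A y (L.nilBracket A x z)) (by simp)
    (fun _ _ h1 h2 => ?_) (fun x hx a => ?_) hx
  · simp only [map_add, LinearMap.add_apply, h1, h2, smul_add]; abel
  refine nilDeg_induction (p := fun y => L.nilBracket A (x ⊗ₜ a) (L.nilBracket A y z) =
      L.nilBracket A (L.nilBracket A (x ⊗ₜ a) y) z +
        (-1 : K) ^ (i * j) • L.nilBracket A y (L.nilBracket A (x ⊗ₜ a) z)) (by simp)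
    (fun _ _ h1 h2 => ?_) (fun y hy b => ?_) hy
  · simp only [map_add, LinearMap.add_apply, h1, h2, smul_add]; abel
  refine nilDeg_induction (p := fun z => L.nilBracket A (x ⊗ₜ a) (L.nilBracket A (y ⊗ₜ b) z) =
      L.nilBracket A (L.nilBracket A (x ⊗ₜ a) (y ⊗ₜ b)) z +
        (-1 : K) ^ (i * j) • L.nilBracket A (y ⊗ₜ b) (L.nilBracket A (x ⊗ₜ a) z)) (by simp)
    (fun _ _ h1 h2 => ?_) (fun z hz c => ?_) hz
  · simp only [map_add, h1, h2, smul_add]; abel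
  · simp only [nilBracket_tmul, L.jacobi hx hy hz, TensorProduct.add_tmul]
    rw [maxMul_assoc, ← maxMul_assoc b a c, maxMul_comm b a, maxMul_assoc,
      ← TensorProduct.smul_tmul']

theorem mem_nilFil_zero (z : L.Nil A) : z ∈ L.nilFil A 0 := by
  induction z using TensorProduct.induction_on with
  | zero => simp
  | add a b ha hb => exact Submodule.add_mem _ ha hb
  | tmul y b => exact Submodule.subset_span ⟨y, b, by simp, rfl⟩

variable (L A) in
/-- The adjoint endomorphisms of `L ⊗ m_A` are uniformly nilpotent. -/
theorem exists_nilBracket_pow_eq_zero : ∃ N, ∀ a : L.Nil A, (L.nilBracket A a) ^ N = 0 := by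
  obtain ⟨N, hN⟩ := A.exists_max_pow
  refine ⟨N, fun a => LinearMap.ext fun z => ?_⟩
  have h1 : ∀ n, ((L.nilBracket A a) ^ n) z ∈ L.nilFil A n := by
    intro n
    induction n with
    | zero => exact mem_nilFil_zero z
    | succ n ih => rw [pow_succ']; exact L.nilBracket_mem_nilFil A a ih
  have h2 : L.nilFil A N = ⊥ := by
    rw [nilFil, Submodule.span_eq_bot]
    rintro _ ⟨x, c, hc, rfl⟩
    rw [hN] at hc
    rw [show c = 0 from Subtype.ext hc, TensorProduct.tmul_zero]
  have h3 := h1 N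
  rwa [h2, Submodule.mem_bot] at h3

theorem gauge_eq_sum {N : ℕ} {a : L.Nil A} (hN : (L.nilBracket A a) ^ N = 0) (x : L.Nil A) :
    L.gauge A a x = x + ∑ n ∈ Finset.range N, ((n + 1).factorial : K)⁻¹ •
      ((L.nilBracket A a) ^ n) (L.nilBracket A a x - L.nilD A a) := by
  rw [gauge, finsum_eq_sum_of_support_subset]
  intro n hn
  rw [Finset.coe_range, Set.mem_Iio]
  by_contra h
  exact hn (by simp only [pow_eq_zero_of_le (not_lt.1 h) hN, LinearMap.zero_apply, smul_zero])

section GaugeMC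

variable (a : L.Nil A) (ha : a ∈ L.nilDeg A 0)

theorem nilBracket_mem_one {a : L.Nil A} (ha : a ∈ L.nilDeg A 0) {z : L.Nil A}
    (hz : z ∈ L.nilDeg A 1) : L.nilBracket A a z ∈ L.nilDeg A 1 := by
  have := nilBracket_mem ha hz
  rwa [zero_add] at this

/-- The adjoint action of `a` on the degree `1` part of `L ⊗ m_A` extended by the differential `d`,
`[a, x + s d] = [a, x] - s da`. -/
def extAd : Module.End K (L.nilDeg A 1 × K) :=
  LinearMap.inl K _ _ ∘ₗ
    ((L.nilBracket A a).restrict (fun _ hz => nilBracket_mem_one ha hz) ∘ₗ LinearMap.fst K _ _ -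
      LinearMap.toSpanSingleton K _ ⟨L.nilD A a, by
        have := nilD_mem ha
        rwa [zero_add] at this⟩ ∘ₗ LinearMap.snd K _ _)

theorem extAd_fst (p : L.nilDeg A 1 × K) :
    ((extAd a ha p).1 : L.Nil A) = L.nilBracket A a p.1 - p.2 • L.nilD A a := rfl

theorem extAd_snd (p : L.nilDeg A 1 × K) : (extAd a ha p).2 = 0 := rfl

/-- After one application the d-component is zero, and from then on only the adjoint action of a
remains. The shift of exponent accounts for the (n + 1)! in the gauge formula. -/
theorem extAd_pow_fst (n : ℕ) (p : L.nilDeg A 1 × K) :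
    (((extAd a ha ^ (n + 1)) p).1 : L.Nil A) =
      ((L.nilBracket A a) ^ n) (L.nilBracket A a p.1 - p.2 • L.nilD A a) := by
  induction n generalizing p with
  | zero => rfl
  | succ n ih =>
    rw [pow_succ, Module.End.mul_apply, ih, extAd_snd, zero_smul, sub_zero, extAd_fst, pow_succ,
      Module.End.mul_apply]

theorem extAd_pow_snd (n : ℕ) (p : L.nilDeg A 1 × K) : ((extAd a ha ^ (n + 1)) p).2 = 0 := by
  rw [pow_succ', Module.End.mul_apply, extAd_snd]

theorem isNilpotent_extAd : IsNilpotent (extAd a ha) := by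
  obtain ⟨N, hN⟩ := exists_nilBracket_pow_eq_zero L A
  refine ⟨N + 1, LinearMap.ext fun p => Prod.ext (Subtype.ext ?_) (extAd_pow_snd a ha N p)⟩
  rw [extAd_pow_fst, hN]
  rfl

variable (L A) in
/-- The bracket of the degree `1` part of `L ⊗ m_A` extended by the differential `d`,
`[x + s d, y + t d] = [x, y] + s dy + t dx`. -/
def extBracket : (L.nilDeg A 1 × K) →ₗ[K] (L.nilDeg A 1 × K) →ₗ[K] L.Nil A :=
  LinearMap.mk₂ K (fun p q => L.nilBracket A p.1 q.1 + p.2 • L.nilD A q.1 + q.2 • L.nilD A p.1)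
    (fun p p' q => by simp [add_smul]; abel) (fun c p q => by simp [smul_smul, mul_comm])
    (fun p q q' => by simp [add_smul]; abel) (fun c p q => by simp [smul_smul, mul_comm])

theorem extBracket_apply (p q : L.nilDeg A 1 × K) : extBracket L A p q =
    L.nilBracket A p.1 q.1 + p.2 • L.nilD A q.1 + q.2 • L.nilD A p.1 := rfl

/-- This is the Jacobi identity in the DGLA with d adjoined; it unwinds to Jacobi for a, x, y,
Leibniz for [a, x] and [a, y], and d² = 0. -/
theorem nilBracket_extBracket (p q : L.nilDeg A 1 × K) :
    L.nilBracket A a (extBracket L A p q) =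
      extBracket L A (extAd a ha p) q + extBracket L A p (extAd a ha q) := by
  obtain ⟨⟨x, hx⟩, s⟩ := p
  obtain ⟨⟨y, hy⟩, t⟩ := q
  have hda : L.nilD A a ∈ L.nilDeg A 1 := by
    have := nilD_mem ha
    rwa [zero_add] at this
  have h1 := nil_jacobi ha hx hy
  have h2 := nil_leibniz ha hx
  have h3 := nil_leibniz ha hy
  have h4 := nilBracket_skew hx hda
  rw [zero_mul, zpow_zero, one_smul] at h1
  rw [zpow_zero, one_smul] at h2 h3
  rw [one_mul, zpow_one, neg_one_smul, neg_neg] at h4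
  simp only [extBracket_apply, extAd_fst, extAd_snd, map_add, map_sub, map_smul,
    LinearMap.sub_apply, LinearMap.smul_apply, h1, h2, h3, h4, nilD_nilD, zero_smul, smul_zero,
    smul_add, smul_sub]
  abel

variable [CharZero K]

/-- The pair (x, 1) stands for d + x. In the extended algebra the affine gauge action is the linear
action of the exponential of ad a. -/
theorem exp_extAd_apply [Module ℚ (L.nilDeg A 1)] (x : L.nilDeg A 1) :
    ((IsNilpotent.exp (extAd a ha) (x, 1)).1 : L.Nil A) = L.gauge A a x ∧
      (IsNilpotent.exp (extAd a ha) (x, 1)).2 = 1 := by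
  obtain ⟨N, hN⟩ := exists_nilBracket_pow_eq_zero L A
  have hE : extAd a ha ^ (N + 1) = 0 := by
    refine LinearMap.ext fun p => Prod.ext (Subtype.ext ?_) (extAd_pow_snd a ha N p)
    rw [extAd_pow_fst, hN]
    rfl
  have h : IsNilpotent.exp (extAd a ha) (x, 1) = (x, 1) +
      ∑ n ∈ Finset.range N, ((n + 1).factorial : K)⁻¹ • (extAd a ha ^ (n + 1)) (x, 1) := by
    rw [IsNilpotent.exp_eq_sum hE, Finset.sum_range_succ', LinearMap.add_apply,
      LinearMap.sum_apply, add_comm]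
    congr 1
    · simp
    · refine Finset.sum_congr rfl fun n _ => ?_
      rw [← Rat.cast_smul_eq_qsmul K, LinearMap.smul_apply]
      simp
  rw [h]
  constructor
  · have h1 : ∀ p : L.nilDeg A 1 × K, (p.1 : L.Nil A) =
      ((L.nilDeg A 1).subtype ∘ₗ LinearMap.fst K _ K) p := fun _ => rfl
    rw [gauge_eq_sum (hN a), h1, map_add, map_sum]
    refine congrArg₂ (· + ·) rfl (Finset.sum_congr rfl fun n _ => ?_)
    rw [map_smul, ← h1, extAd_pow_fst, one_smul]
  · have h1 : ∀ p : L.nilDeg A 1 × K, p.2 = LinearMap.snd K (L.nilDeg A 1) K p := fun _ => rfl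
    rw [h1, map_add, map_sum, Finset.sum_eq_zero, add_zero]
    · rfl
    · intro n _
      rw [map_smul, ← h1, extAd_pow_snd, smul_zero]

/-- The gauge action preserves the Maurer-Cartan elements. -/
theorem gauge_mem_MC {x : L.Nil A} (hx : x ∈ L.MC A) (ha : a ∈ L.nilDeg A 0) :
    L.gauge A a x ∈ L.MC A := by
  obtain ⟨hx₁, hx₂⟩ := hx
  let _ : Module ℚ (L.nilDeg A 1) := Module.compHom _ (algebraMap ℚ K)
  let _ : Module ℚ (L.Nil A) := Module.compHom _ (algebraMap ℚ K)
  have hF : IsNilpotent (L.nilBracket A a) :=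
    (exists_nilBracket_pow_eq_zero L A).imp fun N hN => hN a
  -- The self-bracket of d + x is twice the curvature of x, so the curvature of the transformed
  -- element is the exponential of ad a applied to that of x, namely zero.
  have h := exp_apply_of_leibniz (extBracket L A) (extAd a ha) (L.nilBracket A a)
    (isNilpotent_extAd a ha) hF (nilBracket_extBracket a ha) (⟨x, hx₁⟩, 1) (⟨x, hx₁⟩, 1)
  obtain ⟨h1, h2⟩ := exp_extAd_apply a ha ⟨x, hx₁⟩
  have h3 : ∀ y : L.Nil A, L.nilBracket A y y + (1 : K) • L.nilD A y + (1 : K) • L.nilD A y =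
      (2 : K) • (L.nilD A y + (2 : K)⁻¹ • L.nilBracket A y y) := by
    intro y
    rw [smul_add, smul_smul, mul_inv_cancel₀ two_ne_zero, two_smul, one_smul, one_smul]
    abel
  rw [extBracket_apply, extBracket_apply, h1, h2, h3, h3, hx₂, smul_zero, map_zero] at h
  refine ⟨h1 ▸ Subtype.property _, ?_⟩
  exact (smul_eq_zero.1 h.symm).resolve_left two_ne_zero

end GaugeMC

end DGLA

/-! ### Surjective morphisms with acyclic kernel and their deformation functors. -/

namespace DGLA

variable {K : Type u} [Field K] {L M : DGLA.{u, v} K} (f : Hom L M) (A : ArtAlg.{u, w} K)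

namespace Hom

/-- The kernel of a morphism of DGLAs in degree `i`. -/
def kerDeg (i : ℤ) : Submodule K L.carrier := L.deg i ⊓ LinearMap.ker f.toLinearMap

theorem d_mem_kerDeg {i : ℤ} {x : L.carrier} (hx : x ∈ f.kerDeg i) : L.d x ∈ f.kerDeg (i + 1) :=
  ⟨L.d_mem hx.1, by
    change f.toLinearMap (L.d x) = 0
    rw [f.map_d, LinearMap.mem_ker.1 hx.2, map_zero]⟩

/-- A linear section in degree `i` of a morphism which is surjective in degree `i`. -/
theorem exists_section {i : ℤ} (hf : ∀ y ∈ M.deg i, ∃ x ∈ L.deg i, f.toLinearMap x = y) :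
    ∃ s : M.carrier →ₗ[K] L.carrier, ∀ y ∈ M.deg i, s y ∈ L.deg i ∧ f.toLinearMap (s y) = y := by
  let fi : L.deg i →ₗ[K] M.deg i := f.toLinearMap.restrict fun _ hx => f.map_deg hx
  have hfi : LinearMap.range fi = ⊤ := LinearMap.range_eq_top.2 fun y => by
    obtain ⟨x, hx, h⟩ := hf y y.2
    exact ⟨⟨x, hx⟩, Subtype.ext h⟩
  obtain ⟨r, hr⟩ := fi.exists_rightInverse_of_surjective hfi
  obtain ⟨s, hs⟩ := ((L.deg i).subtype ∘ₗ r).exists_extend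
  refine ⟨s, fun y hy => ?_⟩
  have h : s y = r ⟨y, hy⟩ := LinearMap.congr_fun hs ⟨y, hy⟩
  rw [h]
  exact ⟨(r ⟨y, hy⟩).2, congrArg Subtype.val (LinearMap.congr_fun hr ⟨y, hy⟩)⟩

/-- A contracting homotopy in degree `i + 1` of the kernel of a morphism, when this kernel is
acyclic in degree `i + 1`. -/
theorem exists_homotopy {i : ℤ}
    (h : ∀ x ∈ f.kerDeg (i + 1), L.d x = 0 → ∃ y ∈ f.kerDeg i, L.d y = x) :
    ∃ h₁ h₂ : L.carrier →ₗ[K] L.carrier, (∀ x, h₁ x ∈ f.kerDeg i) ∧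
      (∀ x, h₂ x ∈ f.kerDeg (i + 1)) ∧ ∀ x ∈ f.kerDeg (i + 1), x = L.d (h₁ x) + h₂ (L.d x) := by
  let D : f.kerDeg (i + 1) →ₗ[K] L.carrier := L.d ∘ₗ (f.kerDeg (i + 1)).subtype
  obtain ⟨r, hr⟩ := D.rangeRestrict.exists_rightInverse_of_surjective D.range_rangeRestrict
  obtain ⟨τ, hτ⟩ := r.exists_extend
  let Z : Submodule K L.carrier := f.kerDeg (i + 1) ⊓ LinearMap.ker L.d
  let D' : (f.kerDeg i ⊓ (f.kerDeg (i + 1)).comap L.d : Submodule K L.carrier) →ₗ[K] Z :=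
    L.d.restrict fun x hx => ⟨hx.2, L.d_d x⟩
  have hD' : LinearMap.range D' = ⊤ := LinearMap.range_eq_top.2 fun x => by
    obtain ⟨y, hy, hyx⟩ := h x x.2.1 x.2.2
    exact ⟨⟨y, hy, f.d_mem_kerDeg hy⟩, Subtype.ext hyx⟩
  obtain ⟨r', hr'⟩ := D'.exists_rightInverse_of_surjective hD'
  obtain ⟨σ, hσ⟩ := r'.exists_extend
  -- Here τ splits d on its image and σ chooses primitives of cocycles, the cocycle being x - τ(dx).
  -- Both are extended to all of L so that they can be tensored with m_A.
  refine ⟨Submodule.subtype _ ∘ₗ σ ∘ₗ (LinearMap.id - Submodule.subtype _ ∘ₗ τ ∘ₗ L.d),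
    Submodule.subtype _ ∘ₗ τ, fun x => (σ _).2.1, fun x => (τ x).2, fun x hx => ?_⟩
  have h1 : L.d (τ (L.d x)) = L.d x := by
    have h2 : τ (L.d x) = r ⟨L.d x, ⟨⟨x, hx⟩, rfl⟩⟩ :=
      LinearMap.congr_fun hτ (⟨L.d x, ⟨⟨x, hx⟩, rfl⟩⟩ : LinearMap.range D)
    rw [h2]
    exact congrArg Subtype.val
      (LinearMap.congr_fun hr (⟨L.d x, ⟨⟨x, hx⟩, rfl⟩⟩ : LinearMap.range D))
  have hZ : x - τ (L.d x) ∈ Z := ⟨Submodule.sub_mem _ hx (τ _).2, by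
    change L.d (x - τ (L.d x)) = 0
    rw [map_sub, h1, sub_self]⟩
  have h3 : L.d (σ (x - τ (L.d x))) = x - τ (L.d x) := by
    have h4 : σ (x - τ (L.d x)) = r' ⟨_, hZ⟩ := LinearMap.congr_fun hσ ⟨_, hZ⟩
    rw [h4]
    exact congrArg Subtype.val (LinearMap.congr_fun hr' ⟨_, hZ⟩)
  change x = L.d (σ (x - τ (L.d x))) + τ (L.d x)
  rw [h3, sub_add_cancel]

/-- The span of the elements `x ⊗ c` with `x` of degree `i` in the kernel of `f` and
`c ∈ m_A ^ N`. -/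
def kerFil (i : ℤ) (N : ℕ) : Submodule K (L.Nil A) :=
  Submodule.span K {z | ∃ x ∈ f.kerDeg i, ∃ c : A.max, (c : A.carrier) ∈ A.max ^ N ∧ z = x ⊗ₜ c}

variable {f A}

theorem tmul_mem_kerFil {i : ℤ} {N : ℕ} {x : L.carrier} (hx : x ∈ f.kerDeg i) {c : A.max}
    (hc : (c : A.carrier) ∈ A.max ^ N) : x ⊗ₜ c ∈ f.kerFil A i N :=
  Submodule.subset_span ⟨x, hx, c, hc, rfl⟩

theorem kerFil_le {i : ℤ} {N : ℕ} {S : Submodule K (L.Nil A)}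
    (h : ∀ x ∈ f.kerDeg i, ∀ c : A.max, (c : A.carrier) ∈ A.max ^ N → x ⊗ₜ c ∈ S) :
    f.kerFil A i N ≤ S := by
  refine Submodule.span_le.2 ?_
  rintro _ ⟨x, hx, c, hc, rfl⟩
  exact h x hx c hc

theorem kerFil_le_nilDeg {i : ℤ} {N : ℕ} : f.kerFil A i N ≤ L.nilDeg A i :=
  kerFil_le fun _ hx c _ => tmul_mem_nilDeg hx.1 c

theorem kerFil_anti {i : ℤ} {N N' : ℕ} (h : N ≤ N') : f.kerFil A i N' ≤ f.kerFil A i N :=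
  kerFil_le fun _ hx _ hc => tmul_mem_kerFil hx (Ideal.pow_le_pow_right h hc)

theorem kerFil_eq_bot {i : ℤ} {N : ℕ} (h : A.max ^ N = ⊥) : f.kerFil A i N = ⊥ := by
  refine eq_bot_iff.2 (kerFil_le fun x hx c hc => ?_)
  rw [h] at hc
  rw [show c = 0 from Subtype.ext hc, TensorProduct.tmul_zero]
  exact Submodule.zero_mem _

theorem nilMap_of_mem_kerFil {i : ℤ} {N : ℕ} {z : L.Nil A} (hz : z ∈ f.kerFil A i N) :
    nilMap f (𝟙 A) z = 0 := by
  have : f.kerFil A i N ≤ LinearMap.ker (nilMap f (𝟙 A)) := kerFil_le fun x hx c _ => by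
    rw [LinearMap.mem_ker, nilMap, TensorProduct.map_tmul, LinearMap.mem_ker.1 hx.2,
      TensorProduct.zero_tmul]
  exact this hz

theorem nilD_mem_kerFil {i j : ℤ} (hij : i + 1 = j) {N : ℕ} {z : L.Nil A}
    (hz : z ∈ f.kerFil A i N) : L.nilD A z ∈ f.kerFil A j N := by
  subst hij
  have : f.kerFil A i N ≤ (f.kerFil A (i + 1) N).comap (L.nilD A) :=
    kerFil_le fun x hx c hc => tmul_mem_kerFil (f.d_mem_kerDeg hx) hc
  exact this hz

/-- The kernel is an ideal, and each bracket multiplies by an element of m_A. This gain of one step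
drives all successive approximations below. -/
theorem nilBracket_mem_kerFil {i j k : ℤ} (hk : i + j = k) {N : ℕ} {y z : L.Nil A}
    (hy : y ∈ L.nilDeg A i) (hz : z ∈ f.kerFil A j N) : L.nilBracket A y z ∈ f.kerFil A k (N + 1) := by
  subst hk
  refine nilDeg_induction (p := fun y => L.nilBracket A y z ∈ f.kerFil A (i + j) (N + 1)) ?_
    (fun x y hx hy => ?_) (fun x hx b => ?_) hy
  · rw [map_zero]; exact Submodule.zero_mem _
  · rw [map_add]; exact Submodule.add_mem _ hx hy
  have : f.kerFil A j N ≤ (f.kerFil A (i + j) (N + 1)).comap (L.nilBracket A (x ⊗ₜ b)) :=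
    kerFil_le fun y hy c hc => by
      refine tmul_mem_kerFil ⟨L.bracket_mem hx hy.1, ?_⟩ ?_
      · change f.toLinearMap (L.bracket x y) = 0
        rw [f.map_bracket, LinearMap.mem_ker.1 hy.2, map_zero]
      · rw [pow_succ']
        exact Ideal.mul_mem_mul b.2 hc
  exact this hz

/-- With z = d h₁z + h₂ dz, the error h₂ dz lies one step deeper because dz does; h₂ takes values in
the kernel, so dz need only be controlled in the filtration of L ⊗ m_A. -/
theorem exists_sub_nilD_mem_kerFil {i j : ℤ} (hij : i + 1 = j) {N : ℕ}
    (h : ∀ x ∈ f.kerDeg j, L.d x = 0 → ∃ y ∈ f.kerDeg i, L.d y = x) {z : L.Nil A}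
    (hz : z ∈ f.kerFil A j N) (hd : L.nilD A z ∈ L.nilFil A (N + 1)) :
    ∃ y ∈ f.kerFil A i N, z - L.nilD A y ∈ f.kerFil A j (N + 1) := by
  subst hij
  obtain ⟨h₁, h₂, hh₁, hh₂, hh⟩ := f.exists_homotopy h
  have e₁ : f.kerFil A (i + 1) N ≤ (f.kerFil A i N).comap (h₁.rTensor A.max) :=
    kerFil_le fun x hx c hc => tmul_mem_kerFil (hh₁ x) hc
  have e₂ : L.nilFil A (N + 1) ≤ (f.kerFil A (i + 1) (N + 1)).comap (h₂.rTensor A.max) := by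
    refine Submodule.span_le.2 ?_
    rintro _ ⟨x, c, hc, rfl⟩
    exact tmul_mem_kerFil (hh₂ x) hc
  have e₃ : f.kerFil A (i + 1) N ≤ LinearMap.ker (LinearMap.id - L.nilD A ∘ₗ h₁.rTensor A.max -
      h₂.rTensor A.max ∘ₗ L.nilD A) := kerFil_le fun x hx c hc => by
    change x ⊗ₜ c - L.d (h₁ x) ⊗ₜ c - h₂ (L.d x) ⊗ₜ c = 0
    rw [← TensorProduct.sub_tmul, ← TensorProduct.sub_tmul, sub_sub, ← hh x hx, sub_self,
      TensorProduct.zero_tmul]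
  refine ⟨h₁.rTensor A.max z, e₁ hz, ?_⟩
  have h3 : z - L.nilD A (h₁.rTensor A.max z) = h₂.rTensor A.max (L.nilD A z) :=
    sub_eq_zero.1 (e₃ hz)
  rw [h3]
  exact e₂ hd

theorem kerFil_le_nilFil {i : ℤ} {N : ℕ} : f.kerFil A i N ≤ L.nilFil A N :=
  kerFil_le fun x _ c hc => Submodule.subset_span ⟨x, c, hc, rfl⟩

theorem nilMap_id_tmul (x : L.carrier) (c : A.max) :
    nilMap f (𝟙 A) (x ⊗ₜ c) = f.toLinearMap x ⊗ₜ c := rfl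

theorem exists_nilMap_eq {i : ℤ} (hf : ∀ y ∈ M.deg i, ∃ x ∈ L.deg i, f.toLinearMap x = y)
    {y : M.Nil A} (hy : y ∈ M.nilDeg A i) : ∃ x ∈ L.nilDeg A i, nilMap f (𝟙 A) x = y := by
  obtain ⟨s, hs⟩ := f.exists_section hf
  refine nilDeg_induction (p := fun y => ∃ x ∈ L.nilDeg A i, nilMap f (𝟙 A) x = y)
    ⟨0, Submodule.zero_mem _, map_zero _⟩ ?_ (fun y hy c => ?_) hy
  · rintro _ _ ⟨x, hx, rfl⟩ ⟨x', hx', rfl⟩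
    exact ⟨x + x', Submodule.add_mem _ hx hx', map_add _ _ _⟩
  · exact ⟨s y ⊗ₜ c, tmul_mem_nilDeg (hs y hy).1 c, by rw [nilMap_id_tmul, (hs y hy).2]⟩

/-- Subtracting a linear section of the image moves any tensor into (kernel) ⊗ m_A, so the kernel of
the tensored map is the tensored kernel. -/
theorem mem_kerFil_one {i : ℤ} (hf : ∀ y ∈ M.deg i, ∃ x ∈ L.deg i, f.toLinearMap x = y)
    {x : L.Nil A} (hx : x ∈ L.nilDeg A i) (h : nilMap f (𝟙 A) x = 0) : x ∈ f.kerFil A i 1 := by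
  obtain ⟨s, hs⟩ := f.exists_section hf
  have h1 : x - s.rTensor A.max (nilMap f (𝟙 A) x) ∈ f.kerFil A i 1 := by
    refine nilDeg_induction (p := fun x => x - s.rTensor A.max (nilMap f (𝟙 A) x) ∈ f.kerFil A i 1)
      (by simp) (fun x y hx hy => ?_) (fun x hx c => ?_) hx
    · have := Submodule.add_mem _ hx hy
      rwa [sub_add_sub_comm, ← map_add, ← map_add] at this
    · rw [nilMap_id_tmul, LinearMap.rTensor_tmul, ← TensorProduct.sub_tmul]
      have hfx := hs _ (f.map_deg hx)
      refine tmul_mem_kerFil ⟨Submodule.sub_mem _ hx hfx.1, ?_⟩ (by simp)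
      change f.toLinearMap (x - s (f.toLinearMap x)) = 0
      rw [map_sub, hfx.2, sub_self]
  rwa [h, map_zero, sub_zero] at h1

variable (L A) in
/-- The curvature `dx + 1/2 [x, x]`. -/
def curv (x : L.Nil A) : L.Nil A := L.nilD A x + (2 : K)⁻¹ • L.nilBracket A x x

theorem curv_mem {x : L.Nil A} (hx : x ∈ L.nilDeg A 1) : curv L A x ∈ L.nilDeg A 2 := by
  have h1 := nilD_mem hx
  have h2 := nilBracket_mem hx hx
  rw [one_add_one_eq_two] at h1 h2
  exact Submodule.add_mem _ h1 (Submodule.smul_mem _ _ h2)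

theorem nilBracket_comm_one {x y : L.Nil A} (hx : x ∈ L.nilDeg A 1) (hy : y ∈ L.nilDeg A 1) :
    L.nilBracket A x y = L.nilBracket A y x := by
  rw [nilBracket_skew hx hy, one_mul, zpow_one, neg_one_smul, neg_neg]

/-- To first order a small gauge transformation subtracts da; every other term of the series
contains a bracket and lies one step deeper. -/
theorem gauge_sub_mem_kerFil {N : ℕ} {a x : L.Nil A} (ha : a ∈ f.kerFil A 0 N)
    (hx : x ∈ L.nilDeg A 1) :
    L.gauge A a x - x + L.nilD A a ∈ f.kerFil A 1 (N + 1) := by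
  have ha0 := kerFil_le_nilDeg ha
  obtain ⟨n, hn⟩ := exists_nilBracket_pow_eq_zero L A
  have hax : L.nilBracket A a x ∈ f.kerFil A 1 (N + 1) := by
    rw [nilBracket_skew ha0 hx]
    exact Submodule.neg_mem _ (Submodule.smul_mem _ _
      (nilBracket_mem_kerFil (add_zero 1) hx ha))
  have hw : L.nilBracket A a x - L.nilD A a ∈ f.kerFil A 1 N :=
    Submodule.sub_mem _ (kerFil_anti N.le_succ hax) (nilD_mem_kerFil (zero_add 1) ha)
  have hp : ∀ k, ((L.nilBracket A a) ^ (k + 1)) (L.nilBracket A a x - L.nilD A a) ∈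
      f.kerFil A 1 (N + 1) := by
    intro k
    induction k with
    | zero => exact nilBracket_mem_kerFil (zero_add 1) ha0 hw
    | succ k ih =>
      rw [pow_succ']
      exact kerFil_anti (N + 1).le_succ (nilBracket_mem_kerFil (zero_add 1) ha0 ih)
  rw [gauge_eq_sum (pow_eq_zero_of_le n.le_succ (hn a)), add_sub_cancel_left,
    Finset.sum_range_succ', add_assoc]
  refine Submodule.add_mem _
    (Submodule.sum_mem _ fun k _ => Submodule.smul_mem _ _ (hp k)) ?_
  simpa using hax

variable [CharZero K]

/-- The Bianchi identity. -/
theorem nilD_curv {x : L.Nil A} (hx : x ∈ L.nilDeg A 1) :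
    L.nilD A (curv L A x) = -L.nilBracket A x (curv L A x) := by
  have h1 := nil_jacobi hx hx hx
  have h2 := nilBracket_skew (nilBracket_mem hx hx) hx
  have h3 := nilBracket_skew (nilD_mem hx) hx
  have h4 := nil_leibniz hx hx
  have e : ((-1 : K) ^ (2 : ℤ)) = 1 := by norm_num
  have e2 : (1 : ℤ) + 1 = 2 := by norm_num
  rw [e2, mul_one, e, one_smul] at h2 h3
  rw [mul_one, zpow_one, neg_one_smul, h2] at h1
  rw [zpow_one, neg_one_smul, h3, ← neg_add, ← two_smul K] at h4
  have h5 : L.nilBracket A x (L.nilBracket A x x) = 0 := by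
    -- For x of degree 1, Jacobi and skew symmetry give [x, [x, x]] = -2 [x, [x, x]].
    have : (3 : K) • L.nilBracket A x (L.nilBracket A x x) = 0 := by
      rw [← sub_eq_zero.2 h1]
      module
    exact (smul_eq_zero.1 this).resolve_left three_ne_zero
  rw [curv, map_add, map_smul, nilD_nilD, zero_add, h4, smul_neg, smul_smul,
    inv_mul_cancel₀ two_ne_zero, one_smul, map_add, map_smul, h5, smul_zero, add_zero]

/-- The curvature of a lift lies in the kernel and, by the Bianchi identity, is closed modulo the
next step. It is thus a differential dz up to deeper terms, and replacing x by x - z pushes the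
curvature deeper without changing the image. -/
theorem exists_mem_MC_nilMap_eq (h₁ : ∀ y ∈ M.deg 1, ∃ x ∈ L.deg 1, f.toLinearMap x = y)
    (h₂ : ∀ y ∈ M.deg 2, ∃ x ∈ L.deg 2, f.toLinearMap x = y)
    (hac : ∀ x ∈ f.kerDeg 2, L.d x = 0 → ∃ y ∈ f.kerDeg 1, L.d y = x) {y : M.Nil A}
    (hy : y ∈ M.MC A) : ∃ x ∈ L.MC A, nilMap f (𝟙 A) x = y := by
  have key : ∀ N : ℕ, ∃ x ∈ L.nilDeg A 1, nilMap f (𝟙 A) x = y ∧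
      curv L A x ∈ f.kerFil A 2 (N + 1) := by
    intro N
    induction N with
    | zero =>
      obtain ⟨x, hx, rfl⟩ := exists_nilMap_eq h₁ hy.1
      refine ⟨x, hx, rfl, mem_kerFil_one h₂ (curv_mem hx) ?_⟩
      rw [curv, map_add, map_smul, nilMap_nilD, nilMap_nilBracket]
      exact hy.2
    | succ N ih =>
      obtain ⟨x, hx, hxy, hc⟩ := ih
      obtain ⟨z, hz, hz'⟩ := exists_sub_nilD_mem_kerFil (i := 1) (by norm_num) hac hc (by
        rw [nilD_curv hx]
        exact Submodule.neg_mem _ (kerFil_le_nilFil (nilBracket_mem_kerFil rfl hx hc)))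
      have hz1 := kerFil_le_nilDeg hz
      refine ⟨x - z, Submodule.sub_mem _ hx hz1, ?_, ?_⟩
      · rw [map_sub, nilMap_of_mem_kerFil hz, sub_zero, hxy]
      · have h3 : curv L A (x - z) = (curv L A x - L.nilD A z) - L.nilBracket A x z +
            (2 : K)⁻¹ • L.nilBracket A z z := by
          simp only [curv, map_sub, LinearMap.sub_apply, nilBracket_comm_one hz1 hx]
          have : L.nilBracket A x z = (2 : K)⁻¹ • L.nilBracket A x z +
            (2 : K)⁻¹ • L.nilBracket A x z := by
            rw [← add_smul, ← two_mul, mul_inv_cancel₀ two_ne_zero, one_smul]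
          conv_rhs => rw [this]
          simp only [smul_sub]
          abel
        rw [h3]
        exact Submodule.add_mem _
          (Submodule.sub_mem _ hz' (nilBracket_mem_kerFil (by norm_num) hx hz))
          (Submodule.smul_mem _ _ (nilBracket_mem_kerFil (by norm_num) hz1 hz))
  obtain ⟨N, hN⟩ := A.exists_max_pow
  obtain ⟨x, hx, hxy, hc⟩ := key N
  have h0 := kerFil_anti (Nat.le_succ N) hc
  rw [kerFil_eq_bot hN, Submodule.mem_bot] at h0
  exact ⟨x, ⟨hx, h0⟩, hxy⟩

/-- The difference of the two elements is moved ever deeper by successive gauge transformations.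
Working with classes in the quotient means that these never have to be composed into one, so no
Baker-Campbell-Hausdorff formula is needed. -/
theorem mk_eq_mk_of_nilMap_eq (h₁ : ∀ y ∈ M.deg 1, ∃ x ∈ L.deg 1, f.toLinearMap x = y)
    (hac : ∀ x ∈ f.kerDeg 1, L.d x = 0 → ∃ y ∈ f.kerDeg 0, L.d y = x) (x x' : L.MC A)
    (h : nilMap f (𝟙 A) x.1 = nilMap f (𝟙 A) x'.1) :
    Quot.mk (L.GaugeEquiv A) x = Quot.mk (L.GaugeEquiv A) x' := by
  have key : ∀ N : ℕ, ∃ z : L.MC A, Quot.mk (L.GaugeEquiv A) x = Quot.mk (L.GaugeEquiv A) z ∧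
      x'.1 - z.1 ∈ f.kerFil A 1 (N + 1) := by
    intro N
    induction N with
    | zero =>
      refine ⟨x, rfl, mem_kerFil_one h₁ (Submodule.sub_mem _ x'.2.1 x.2.1) ?_⟩
      rw [map_sub, h, sub_self]
    | succ N ih =>
      obtain ⟨z, hz, he⟩ := ih
      obtain ⟨c, hc, hc'⟩ := exists_sub_nilD_mem_kerFil (i := 0) (zero_add 1) hac he (by
        have e1 := nilBracket_mem_kerFil rfl (Submodule.add_mem _ x'.2.1 z.2.1) he
        -- Subtracting the two Maurer-Cartan equations shows that the difference is closed up to a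
        -- bracket with itself, hence modulo the next step.
        have e2 : L.nilD A (x'.1 - z.1) =
            -((2 : K)⁻¹ • L.nilBracket A (x'.1 + z.1) (x'.1 - z.1)) := by
          rw [map_sub, eq_neg_of_add_eq_zero_left x'.2.2, eq_neg_of_add_eq_zero_left z.2.2]
          simp only [map_add, map_sub, LinearMap.add_apply, nilBracket_comm_one z.2.1 x'.2.1,
            smul_sub, smul_add]
          abel
        rw [e2]
        exact Submodule.neg_mem _ (Submodule.smul_mem _ _ (kerFil_le_nilFil e1)))
      have hc0 := Submodule.neg_mem _ hc
      -- The sign makes the gauge transformation add dc to first order, which is the leading part of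
      -- the difference.
      refine ⟨⟨L.gauge A (-c) z.1, gauge_mem_MC _ z.2 (kerFil_le_nilDeg hc0)⟩,
        hz.trans (Quot.sound ⟨-c, kerFil_le_nilDeg hc0, rfl⟩), ?_⟩
      have e3 : x'.1 - L.gauge A (-c) z.1 = x'.1 - z.1 - L.nilD A c -
          (L.gauge A (-c) z.1 - z.1 + L.nilD A (-c)) := by
        rw [map_neg]
        abel
      change x'.1 - L.gauge A (-c) z.1 ∈ f.kerFil A 1 (N + 1 + 1)
      rw [e3]
      exact Submodule.sub_mem _ hc' (gauge_sub_mem_kerFil hc0 z.2.1)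
  obtain ⟨N, hN⟩ := A.exists_max_pow
  obtain ⟨z, hz, he⟩ := key N
  have h0 := kerFil_anti (Nat.le_succ N) he
  rw [kerFil_eq_bot hN, Submodule.mem_bot, sub_eq_zero] at h0
  rw [hz, Subtype.ext h0]

/-- A morphism of DGLAs which is surjective in each degree and whose kernel is acyclic in
degrees `1` and `2` induces an isomorphism of deformation functors. -/
theorem isIso_onDef (hf : ∀ i, ∀ y ∈ M.deg i, ∃ x ∈ L.deg i, f.toLinearMap x = y)
    (hac₁ : ∀ x ∈ f.kerDeg 1, L.d x = 0 → ∃ y ∈ f.kerDeg 0, L.d y = x)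
    (hac₂ : ∀ x ∈ f.kerDeg 2, L.d x = 0 → ∃ y ∈ f.kerDeg 1, L.d y = x) :
    IsIso (Hom.onDef.{u, v, w} f) := by
  rw [NatTrans.isIso_iff_isIso_app]
  intro A
  rw [isIso_iff_bijective]
  change Function.Bijective (defMap f (𝟙 A))
  constructor
  · intro p q
    induction p using Quot.ind with
    | mk x =>
    induction q using Quot.ind with
    | mk x' =>
    intro h
    -- Equality of classes is read as a zigzag of gauge transformations, avoiding a proof that
    -- `GaugeEquiv` is an equivalence relation.
    have h' := Quot.eqvGen_exact h
    have key : ∀ y y' : M.MC A, Relation.EqvGen (M.GaugeEquiv A) y y' → ∀ x x' : L.MC A,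
        mcMap f (𝟙 A) x = y → mcMap f (𝟙 A) x' = y' →
        Quot.mk (L.GaugeEquiv A) x = Quot.mk (L.GaugeEquiv A) x' := by
      intro y y' hyy'
      induction hyy' with
      | rel y y' hr =>
        rintro x x' rfl rfl
        obtain ⟨b, hb, hbx⟩ := hr
        obtain ⟨a, ha, rfl⟩ := exists_nilMap_eq (hf 0) hb
        refine (Quot.sound (r := L.GaugeEquiv A) (b := ⟨L.gauge A a x.1, gauge_mem_MC a x.2 ha⟩)
          ⟨a, ha, rfl⟩).trans (mk_eq_mk_of_nilMap_eq (hf 1) hac₁ _ _ ?_)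
        exact (nilMap_gauge f (𝟙 A) a x.1).trans hbx.symm
      | refl y =>
        rintro x x' h1 h2
        exact mk_eq_mk_of_nilMap_eq (hf 1) hac₁ _ _ (congrArg Subtype.val (h1.trans h2.symm))
      | symm y y' _ ih => exact fun x x' h1 h2 => (ih x' x h2 h1).symm
      | trans y y' y'' _ _ ih₁ ih₂ =>
        intro x x' h1 h2
        -- The intermediate point of the zigzag lives downstairs and must be lifted to a
        -- Maurer-Cartan element, so acyclicity in degree 2 enters injectivity too.
        obtain ⟨z, hz, hzy⟩ := exists_mem_MC_nilMap_eq (hf 1) (hf 2) hac₂ y'.2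
        exact (ih₁ x ⟨z, hz⟩ h1 (Subtype.ext hzy)).trans (ih₂ ⟨z, hz⟩ x' (Subtype.ext hzy) h2)
    exact key _ _ h' x x' rfl rfl
  · intro q
    induction q using Quot.ind with
    | mk y =>
    obtain ⟨x, hx, hxy⟩ := exists_mem_MC_nilMap_eq (hf 1) (hf 2) hac₂ y.2
    exact ⟨Quot.mk _ ⟨x, hx⟩, congrArg (Quot.mk _) (Subtype.ext hxy)⟩

end Hom

end DGLA

/-! ### Assembly of the two halves. -/

theorem SemicosimplicialDGLA.isIso_onDef_totMap_toTrunc {K : Type u} [Field K] [CharZero K]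
    (g : SemicosimplicialDGLA.{u, v} K)
    (hg : ∀ i, ∀ j < 0, ∀ x ∈ (g.obj i).deg j, (g.obj i).d x = 0 →
      ∃ y ∈ (g.obj i).deg (j - 1), (g.obj i).d y = x) :
    IsIso (DGLA.Hom.onDef.{u, max u v, w} (SemicosimplicialDGLA.totMap g.toTrunc)) := by
  have hac : ∀ i j : ℤ, j ≤ 2 → j - 1 = i → ∀ x ∈ (totMap g.toTrunc).kerDeg j, g.tot.d x = 0 →
      ∃ y ∈ (totMap g.toTrunc).kerDeg i, g.tot.d y = x := by
    rintro i j hj rfl x ⟨hx, hx0⟩ hd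
    obtain ⟨y, hy, hy0, hyd⟩ := g.exists_primitive_of_piMap_toTrunc_eq_zero hg hj (x := x.1) hx
      (congrArg Subtype.val hx0) (congrArg Subtype.val hd)
    exact ⟨⟨y, Submodule.mem_iSup_of_mem _ hy⟩, ⟨hy, Subtype.ext hy0⟩, Subtype.ext hyd⟩
  refine DGLA.Hom.isIso_onDef (fun i y hy => ?_) (hac 0 1 (by norm_num) (by norm_num))
    (hac 1 2 (by norm_num) (by norm_num))
  obtain ⟨x, hx, hxy⟩ := g.exists_piMap_toTrunc_eq (y := y.1) hy
  exact ⟨⟨x, Submodule.mem_iSup_of_mem _ hx⟩, hx, Subtype.ext hxy⟩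

theorem DGLA.exists_d_eq_of_subsingleton_cohomology {K : Type u} [Field K] {L : DGLA.{u, v} K}
    {j : ℤ} (h : Subsingleton (L.cohomology j)) {x : L.carrier} (hx : x ∈ L.deg j)
    (hd : L.d x = 0) : ∃ y ∈ L.deg (j - 1), L.d y = x := by
  have hx' : x ∈ L.cocycles j := ⟨hx, hd⟩
  have h0 : (Submodule.Quotient.mk ⟨x, hx'⟩ : L.cohomology j) = 0 := Subsingleton.elim _ _
  exact (Submodule.Quotient.mk_eq_zero _).1 h0

end

theorem mainTheorem6 {K : Type u} [Field K] [IsAlgClosed K] [CharZero K]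
    (g : SemicosimplicialDGLA.{u, v} K)
    (hg : ∀ (i : ℕ) (j : ℤ), j < 0 → Subsingleton ((g.obj i).cohomology j)) :
    IsIso (DGLA.Hom.onDef.{u, max u v, w} (SemicosimplicialDGLA.totMap g.toTrunc)) :=
  g.isIso_onDef_totMap_toTrunc fun i j hj _ hx hd =>
    DGLA.exists_d_eq_of_subsingleton_cohomology (hg i j hj) hx hd
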